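/- Let $R$ be a finite irreducible reduced crystallographic root system, not of type $A_n$ or $G_2$, in a Euclidean space; so $R$ has type $B_n$ ($n\ge 2$), $C_n$ ($n\ge 2$), $D_n$ ($n\ge 4$), $E_6$, $E_7$, $E_8$ or $F_4$. Let $W$ be its Weyl group and fix a basis of simple roots. An element $\lambda$ of the root lattice is a small weight if no $2\beta$, $\beta\in R$, lies in the convex hull of $W\lambda$. A minimal expression of $\lambda$ is an expression of $\lambda$ as a sum of the least possible number of roots. For $\lambda$ small, the blocks of a minimal expression are the classes of its terms under the equivalence relation $(\beta_i,\beta_j)>0$; a $\lambda$-block is a block of some minimal expression of $\lambda$, and the height of a block is the sum of the heights of its elements. For $\lambda$ small and dominant, a canonical block decomposition is, for $\lambda=0$, the empty one, and otherwise a decomposition $\lambda=B_1+\dots+B_N$ into all the blocks of a minimal expression such that $B_N$ has the smallest height among all $\lambda$-blocks and $B_1+\dots+B_{N-1}$ is a canonical block decomposition of $\lambda-B_N$. The symbol $[\lambda]$ is the sequence of the sizes of $B_1,\dots,B_N$, where, if $R$ is not simply laced, the entry $1$ of a one-element block is written $1_s$ or $1_\ell$ according to whether its root is short or long. As the only exception,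 if $R$ is simply laced, $N=2$, both blocks are single roots, and the irreducible component containing $B_2$ of the root system of all roots orthogonal to $B_1$ has type $A_1$ (this happens in type $D_n$ only), then the symbol is written $[1,1]$, and it is different from $[1^2]$. Here $a^k$ stands for $k$ consecutive entries $a$, and $[\emptyset]$ is the symbol of $0$. The symbol of an orbit is the symbol of its dominant element. Theorem. The inclusion of convex hulls is a partial order on the $W$-orbits of small weights. Each such orbit has exactly one symbol. The relation on the symbols of small weights of $R$ in which $s\le t$ if and only if there are orbits $O$, $O'$ of small weights with symbols $s$, $t$ and $\mathrm{conv}(O)\subseteq\mathrm{conv}(O')$ is a partial order, and its cover relations ($t\gtrdot s$: $t$ covers $s$) are exactly the following. - $B_n$: $[1_\ell^k,1_s]\gtrdot[1_\ell^k]$ for $k\ge1$, $2k+1\le n$; $[1_\ell^k]\gtrdot[1_\ell^{k-1},1_s]$ for $k\ge1$, $2k\le n$; $[1_\ell]\gtrdot[1_s]\gtrdot[\emptyset]$. - $C_n$: $[1_\ell,1_s^k]\gtrdot[1_\ell,1_s^{k-1}]$ for $k\ge1$, $2k+1\le n$; $[1_\ell,1_s^k]\gtrdot[1_s^{k+1}]\gtrdot[1_s^k]$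 for $k\ge1$, $2k+2\le n$; $[1_\ell]\gtrdot[1_s]\gtrdot[\emptyset]$. - $D_n$: $[2,1^k]\gtrdot[2,1^{k-1}]$ for $k\ge1$, $2k+3\le n$; $[2,1^k]\gtrdot[1^{k+2}]\gtrdot[1^{k+1}]$ for $k\ge0$, $2k+4\le n$; $[2]\gtrdot[1,1]\gtrdot[1]\gtrdot[\emptyset]$; where, for $n=4$, $[1^2]$ is to be read as $[1,1]$. - $E_6$: $[2^2]\gtrdot[2,1]\gtrdot[2]\gtrdot[1^2]\gtrdot[1]\gtrdot[\emptyset]$. - $E_7$: $[2,1]\gtrdot[1^3]\gtrdot[1^2]\gtrdot[1]\gtrdot[\emptyset]$ and $[2,1]\gtrdot[2]\gtrdot[1^2]$. - $E_8$: $[2,1]\gtrdot[2]\gtrdot[1^2]\gtrdot[1]\gtrdot[\emptyset]$. - $F_4$: $[1_\ell,1_s]\gtrdot[1_\ell]\gtrdot[1_s]\gtrdot[\emptyset]$. -/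

import Mathlib

namespace SmallWeights

/-! ### Weights, minimal expressions and blocks -/

section Weights

variable {ι V N : Type*} [Fintype ι] [AddCommGroup V] [Module ℝ V] [AddCommGroup N] [Module ℝ N]
variable (P : RootPairing ι ℝ V N)

/-- `v` is small: it lies in the root lattice, and twice a root never lies in the convex hull of
its Weyl group orbit (that is, twice a root is not a weight of the irreducible representation
whose highest weight is the dominant weight in the orbit of `v`). -/
def IsSmall (v : V) : Prop :=
  v ∈ AddSubgroup.closure (Set.range P.root) ∧
    ∀ i : ι, (2 : ℝ) • P.root i ∉ convexHull ℝ (MulAction.orbit P.weylGroup v)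

/-- The Weyl group orbits of small weights. -/
def smallOrbits : Set (Set V) :=
  {O | ∃ v : V, IsSmall P v ∧ O = MulAction.orbit P.weylGroup v}

/-- The type of the Weyl group orbits of small weights. -/
def SmallOrbit : Type _ := {O : Set V // O ∈ smallOrbits P}

/-- A minimal expression of `v`: a multiset of (indices of) roots with sum `v` and with the least
possible number of terms. That number is the co-length of `v`. -/
def IsMinimalExpression (v : V) (m : Multiset ι) : Prop :=
  (m.map P.root).sum = v ∧
    ∀ m' : Multiset ι, (m'.map P.root).sum = v → Multiset.card m ≤ Multiset.card m'

open Classical in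
/-- The block of the root `i` in the expression `m`: all the terms of `m` that have positive scalar
product with the root `i`. (`P.RootForm` is the canonical Weyl group invariant scalar product.) -/
noncomputable def blockOf (m : Multiset ι) (i : ι) : Multiset ι :=
  m.filter fun j => 0 < P.RootForm (P.root i) (P.root j)

/-- `B` is a block of the expression `m`. -/
def IsBlockIn (m B : Multiset ι) : Prop :=
  ∃ i ∈ m, B = blockOf P m i

/-- `B` is a `v`-block: a block of some minimal expression of `v`. -/
def IsBlock (v : V) (B : Multiset ι) : Prop :=
  ∃ m : Multiset ι, IsMinimalExpression P v m ∧ IsBlockIn P m B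

/-- `L` lists, without repetition, the blocks of some minimal expression of `v`. -/
def IsBlockDecomposition (v : V) (L : List (Multiset ι)) : Prop :=
  ∃ m : Multiset ι, IsMinimalExpression P v m ∧ L.Nodup ∧ ∀ B, B ∈ L ↔ IsBlockIn P m B

/-- All the roots have the same length. -/
def IsSimplyLaced : Prop :=
  ∀ i j : ι, P.RootForm (P.root i) (P.root i) = P.RootForm (P.root j) (P.root j)

/-- Some root is strictly longer than the root `i`. -/
def IsShort (i : ι) : Prop :=
  ∃ j : ι, P.RootForm (P.root i) (P.root i) < P.RootForm (P.root j) (P.root j)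

/-- Some root is strictly shorter than the root `i`. -/
def IsLong (i : ι) : Prop :=
  ∃ j : ι, P.RootForm (P.root j) (P.root j) < P.RootForm (P.root i) (P.root i)

variable {P} (b : P.Base)

/-- `v` is dominant with respect to the base `b`. -/
def IsDominant (v : V) : Prop :=
  ∀ i ∈ b.support, 0 ≤ P.coroot' i v

/-- The height of (the sum of) a block. -/
noncomputable def blockHeight (B : Multiset ι) : ℤ :=
  (B.map b.height).sum

/-- `IsCanonical b v [B₁, …, B_N]` says that `v = B₁ + ⋯ + B_N` is a canonical block decomposition
of `v`: the last block has the smallest height among all `v`-blocks, and the remaining ones form a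
canonical block decomposition of `v - B_N`. -/
inductive IsCanonical : V → List (Multiset ι) → Prop
  | zero : IsCanonical 0 []
  | snoc (v : V) (L : List (Multiset ι)) (B : Multiset ι)
      (hdecomp : IsBlockDecomposition P v (L ++ [B]))
      (hmin : ∀ B' : Multiset ι, IsBlock P v B' → blockHeight b B ≤ blockHeight b B')
      (hrest : IsCanonical (v - (B.map P.root).sum) L) :
      IsCanonical v (L ++ [B])

end Weights

/-! ### Symbols -/

/-- The entries of symbols: `one` is `1` (simply laced case), `oneShort` is `1_s`, `oneLong` is
`1_ℓ`, and `two` is `2`. -/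
inductive BlockLabel
  | one
  | oneShort
  | oneLong
  | two

/-- Symbols: `word w` is the symbol with the entries `w`, and `oneOne` is the symbol
`[1, 1] = [1^{D_n}, 1^{A_1}]`, which is different from the word `[1²]`. -/
inductive WeightSymbol
  | word (w : List BlockLabel)
  | oneOne

section HasSymbol

variable {ι V N : Type*} [Fintype ι] [AddCommGroup V] [Module ℝ V] [AddCommGroup N] [Module ℝ N]
variable (P : RootPairing ι ℝ V N)

/-- The label of a block: its size and, when the block has one element and there are two root
lengths, the length of that element. -/
def HasLabel (B : Multiset ι) : BlockLabel → Prop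
  | .one => IsSimplyLaced P ∧ Multiset.card B = 1
  | .oneShort => ∃ i, B = {i} ∧ IsShort P i
  | .oneLong => ∃ i, B = {i} ∧ IsLong P i
  | .two => Multiset.card B = 2

/-- The root system is simply laced, the blocks are two single roots `i`, `j`, and the irreducible
component containing `j` of the root system `{α | (α, root i) = 0}` has type `A₁`. -/
def IsOneOne (L : List (Multiset ι)) : Prop :=
  IsSimplyLaced P ∧ ∃ i j : ι, L = [{i}, {j}] ∧
    ∀ k : ι, P.RootForm (P.root k) (P.root i) = 0 →
      P.root k = P.root j ∨ P.root k = -P.root j ∨ P.RootForm (P.root k) (P.root j) = 0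

/-- `s` is the symbol that records the blocks `L`, in their order. -/
def IsSymbolOfBlocks (L : List (Multiset ι)) : WeightSymbol → Prop
  | .word w => ¬ IsOneOne P L ∧ List.Forall₂ (HasLabel P) L w
  | .oneOne => IsOneOne P L

variable {P} (b : P.Base)

/-- `s` arises from a canonical block decomposition of a dominant weight in the orbit `O`. -/
def HasSymbol (O : Set V) (s : WeightSymbol) : Prop :=
  ∃ v ∈ O, IsDominant b v ∧
    ∃ L : List (Multiset ι), IsCanonical b v L ∧ IsSymbolOfBlocks P L s

/-- The symbols of the orbits of small weights. -/
def SmallSymbol : Type :=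
  {s : WeightSymbol // ∃ O ∈ smallOrbits P, HasSymbol b O s}

end HasSymbol

/-! ### The types and the list of covers -/

/-- The types of irreducible reduced root systems other than `A_n` and `G₂`. -/
inductive DynkinType
  | B (n : ℕ) (hn : 2 ≤ n)
  | C (n : ℕ) (hn : 2 ≤ n)
  | D (n : ℕ) (hn : 4 ≤ n)
  | E6
  | E7
  | E8
  | F4

/-- The rank. -/
def DynkinType.rank : DynkinType → ℕ
  | .B n _ => n
  | .C n _ => n
  | .D n _ => n
  | .E6 => 6
  | .E7 => 7
  | .E8 => 8
  | .F4 => 4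

/-- The Cartan matrix, with entries `⟨αᵢ, αⱼ^∨⟩`. -/
def DynkinType.cartanMatrix : (X : DynkinType) → Matrix (Fin X.rank) (Fin X.rank) ℤ
  | .B n _ => CartanMatrix.B n
  | .C n _ => CartanMatrix.C n
  | .D n _ => CartanMatrix.D n
  | .E6 => CartanMatrix.E₆
  | .E7 => CartanMatrix.E₇
  | .E8 => CartanMatrix.E₈
  | .F4 => CartanMatrix.F₄

open BlockLabel WeightSymbol

/-- `[1_ℓ^k]` -/
def longs (k : ℕ) : WeightSymbol := word (List.replicate k oneLong)

/-- `[1_ℓ^k, 1_s]` -/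
def longsShort (k : ℕ) : WeightSymbol := word (List.replicate k oneLong ++ [oneShort])

/-- `[1_s^k]` -/
def shorts (k : ℕ) : WeightSymbol := word (List.replicate k oneShort)

/-- `[1_ℓ, 1_s^k]` -/
def longShorts (k : ℕ) : WeightSymbol := word (oneLong :: List.replicate k oneShort)

/-- `[1^k]` -/
def ones (k : ℕ) : WeightSymbol := word (List.replicate k one)

/-- `[2, 1^k]` -/
def twoOnes (k : ℕ) : WeightSymbol := word (two :: List.replicate k one)

/-- `[1^k]` in type `D_n`. As `D₂ = A₁ + A₁`, the symbols `[1²] = [1^{D₄}, 1^{D₂}]` and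
`[1, 1] = [1^{D₄}, 1^{A₁}]` coincide in type `D₄`. -/
def onesD (n k : ℕ) : WeightSymbol := if n = 4 ∧ k = 2 then oneOne else ones k

/-- The list of covers: `Covers X t s` stands for `t ⋗ s` in type `X`. The inequalities on `k` say
that the symbols occur in rank `n`. -/
inductive Covers : DynkinType → WeightSymbol → WeightSymbol → Prop
  -- type `B_n`
  | B_a (n : ℕ) (hn : 2 ≤ n) (k : ℕ) (hk : 1 ≤ k) (h : 2 * k + 1 ≤ n) :
      Covers (.B n hn) (longsShort k) (longs k)
  | B_b (n : ℕ) (hn : 2 ≤ n) (k : ℕ) (hk : 1 ≤ k) (h : 2 * k ≤ n) :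
      Covers (.B n hn) (longs k) (longsShort (k - 1))
  | B_c (n : ℕ) (hn : 2 ≤ n) : Covers (.B n hn) (word [oneLong]) (word [oneShort])
  | B_d (n : ℕ) (hn : 2 ≤ n) : Covers (.B n hn) (word [oneShort]) (word [])
  -- type `C_n`
  | C_a (n : ℕ) (hn : 2 ≤ n) (k : ℕ) (hk : 1 ≤ k) (h : 2 * k + 1 ≤ n) :
      Covers (.C n hn) (longShorts k) (longShorts (k - 1))
  | C_b (n : ℕ) (hn : 2 ≤ n) (k : ℕ) (hk : 1 ≤ k) (h : 2 * k + 2 ≤ n) :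
      Covers (.C n hn) (longShorts k) (shorts (k + 1))
  | C_c (n : ℕ) (hn : 2 ≤ n) (k : ℕ) (hk : 1 ≤ k) (h : 2 * k + 2 ≤ n) :
      Covers (.C n hn) (shorts (k + 1)) (shorts k)
  | C_d (n : ℕ) (hn : 2 ≤ n) : Covers (.C n hn) (word [oneLong]) (word [oneShort])
  | C_e (n : ℕ) (hn : 2 ≤ n) : Covers (.C n hn) (word [oneShort]) (word [])
  -- type `D_n`
  | D_a (n : ℕ) (hn : 4 ≤ n) (k : ℕ) (hk : 1 ≤ k) (h : 2 * k + 3 ≤ n) :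
      Covers (.D n hn) (twoOnes k) (twoOnes (k - 1))
  | D_b (n : ℕ) (hn : 4 ≤ n) (k : ℕ) (h : 2 * k + 4 ≤ n) :
      Covers (.D n hn) (twoOnes k) (onesD n (k + 2))
  | D_c (n : ℕ) (hn : 4 ≤ n) (k : ℕ) (h : 2 * k + 4 ≤ n) :
      Covers (.D n hn) (onesD n (k + 2)) (onesD n (k + 1))
  | D_d (n : ℕ) (hn : 4 ≤ n) : Covers (.D n hn) (word [two]) oneOne
  | D_e (n : ℕ) (hn : 4 ≤ n) : Covers (.D n hn) oneOne (word [one])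
  | D_f (n : ℕ) (hn : 4 ≤ n) : Covers (.D n hn) (word [one]) (word [])
  -- type `E₆`
  | E6_a : Covers .E6 (word [two, two]) (word [two, one])
  | E6_b : Covers .E6 (word [two, one]) (word [two])
  | E6_c : Covers .E6 (word [two]) (word [one, one])
  | E6_d : Covers .E6 (word [one, one]) (word [one])
  | E6_e : Covers .E6 (word [one]) (word [])
  -- type `E₇`
  | E7_a : Covers .E7 (word [two, one]) (word [one, one, one])
  | E7_b : Covers .E7 (word [one, one, one]) (word [one, one])
  | E7_c : Covers .E7 (word [one, one]) (word [one])
  | E7_d : Covers .E7 (word [one]) (word [])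
  | E7_e : Covers .E7 (word [two, one]) (word [two])
  | E7_f : Covers .E7 (word [two]) (word [one, one])
  -- type `E₈`
  | E8_a : Covers .E8 (word [two, one]) (word [two])
  | E8_b : Covers .E8 (word [two]) (word [one, one])
  | E8_c : Covers .E8 (word [one, one]) (word [one])
  | E8_d : Covers .E8 (word [one]) (word [])
  -- type `F₄`
  | F4_a : Covers .F4 (word [oneLong, oneShort]) (word [oneLong])
  | F4_b : Covers .F4 (word [oneLong]) (word [oneShort])
  | F4_c : Covers .F4 (word [oneShort]) (word [])

end SmallWeights

/-! Everything is moved to integral coordinates with respect to the simple roots. A dominant weight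
is the coordinatewise largest element of its orbit, and for dominant u, v the inclusion conv(Wu) ⊆
conv(Wv) means that v - u has nonnegative coordinates (`IsDominant.coord_le`,
`IsDominant.mem_convexHull_of_coord_le`). Hence, with θ_s the highest short root, a dominant λ in
the root lattice is small exactly when 2θ_s ≤ λ fails, and orbits of small weights are compared as
integer vectors.

Scale the invariant form so that short roots have square length 2 and long ones 4 (all have 2 if
there is one length). For λ small and dominant, (λ, β) is at most 3 for β of square length 2 and at
most 4 for β long. Two terms of a minimal expression never have negative scalar product, since
otherwise they would cancel or merge into one root. With the bounds this leaves two kinds of blocks: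
a single root, or two short roots with scalar product 1 (`blockOf_cases`). Removing a block lowers
the square length by 2, 4 or 6 and the co-length by the number of terms.

For every λ ≠ 0 a weight `pred` is given that arises by removing a block and lies above all small
dominant q ≤ λ with such a drop. For any block B, then, λ - B ≤ `pred` coordinatewise
(`IsBlock.bound`), so B has at least the height of λ - `pred`, with equality only if B sums to λ -
`pred`. The sum of a lowest block is therefore unique, even if its two roots are not, and the symbol
is well defined by induction on the co-length (`IsCanonical.inversion`, `isSymbolOfBlocks_iff`).

What remains is to supply a `SmallData` for each type. In the exceptional types this is a finite
check through the inverse Cartan matrix. In the classical types the coordinates are, up to the last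
ones, partial sums of orthogonal coordinates; dominance makes them concave and nondecreasing, and
smallness bounds the first steps. This leaves e₁+…+e_k in type B, and e₁+…+e_{2s} and
2e₁+e₂+…+e_{2s-1} in types C and D, up to the sign of eₙ in type D. Orbits that share a symbol are
related by diagram automorphisms (types D and E₆), and the order on symbols becomes an explicit
finite poset (`main_of_smallData`). -/

set_option linter.unusedSectionVars false
set_option linter.unusedSimpArgs false

open RootPairing

namespace SmallWeights


/-! ### Dominant weights and convex hulls of Weyl group orbits. -/

section Dominance

variable {ι V N : Type*} [Fintype ι] [AddCommGroup V] [Module ℝ V] [AddCommGroup N] [Module ℝ N]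
variable (P : RootPairing ι ℝ V N)

lemma two_mul_rootForm_root (x : V) (k : ι) :
    2 * P.RootForm x (P.root k) = P.coroot' k x * P.RootForm (P.root k) (P.root k) := by
  have h := P.rootForm_reflection_reflection_apply k x (P.root k)
  rw [reflection_apply, reflection_apply_self] at h
  simp only [map_sub, map_neg, map_smul, LinearMap.sub_apply, LinearMap.smul_apply,
    smul_eq_mul] at h
  linarith

lemma rootForm_comm (x y : V) : P.RootForm x y = P.RootForm y x :=
  by simpa using P.rootForm_symmetric.eq x y

lemma rootForm_root_pos (k : ι) : 0 < P.RootForm (P.root k) (P.root k) :=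
  P.rootForm_pos_of_ne_zero (Submodule.subset_span ⟨k, rfl⟩) (P.ne_zero k)

lemma rootForm_smul_smul (w : P.weylGroup) (x y : V) :
    P.RootForm (w • x) (w • y) = P.RootForm x y :=
  RootPairing.InvariantForm.apply_weylGroup_smul P (B := P.toInvariantForm) w x y

lemma weylGroup_smul_smul (w : P.weylGroup) (a : ℝ) (x : V) : w • (a • x) = a • (w • x) :=
  smul_comm (w : P.Aut) a x

lemma finite_weylGroup [P.IsRootSystem] : Finite P.weylGroup := by
  have : Function.Injective P.weylGroupToPerm := by
    intro w w' h
    have hs : ∀ x : V, w • x = w' • x := by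
      intro x
      have hx : x ∈ Submodule.span ℝ (Set.range P.root) := by
        have := IsRootSystem.span_root_eq_top (P := P)
        rw [this]; trivial
      induction hx using Submodule.span_induction with
      | mem x hx =>
        obtain ⟨k, rfl⟩ := hx
        rw [weylGroup_apply_root, weylGroup_apply_root, h]
      | zero => simp
      | add x y _ _ h1 h2 => rw [smul_add, smul_add, h1, h2]
      | smul a x _ h1 =>
        rw [weylGroup_smul_smul, h1, weylGroup_smul_smul]
    apply Subtype.ext
    apply Equiv.weightHom_injective P
    ext x
    exact hs x
  exact Finite.of_injective _ this

variable [P.IsRootSystem] [P.IsCrystallographic] [P.IsReduced]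
variable {P} (b : P.Base)

/-- The coordinates with respect to the simple roots. -/
noncomputable def coord (v : V) (i : b.support) : ℝ := b.toWeightBasis.repr v i

lemma coord_add (v w : V) : coord b (v + w) = coord b v + coord b w := by
  ext i; simp [coord]

lemma coord_sub (v w : V) : coord b (v - w) = coord b v - coord b w := by
  ext i; simp [coord]

lemma coord_smul (a : ℝ) (v : V) : coord b (a • v) = a • coord b v := by
  ext i; simp [coord]

lemma coord_simple (i j : b.support) [Decidable (j = i)] :
    coord b (P.root i) j = if j = i then 1 else 0 := by
  classical
  simp [coord, Finsupp.single_apply, eq_comm]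

lemma sum_coord (v : V) : ∑ i, coord b v i • P.root i = v := by
  have := b.toWeightBasis.sum_repr v
  simpa [coord] using this

lemma coord_injective {v w : V} (h : coord b v = coord b w) : v = w := by
  rw [← sum_coord b v, ← sum_coord b w, h]

lemma coord_nonneg_of_isPos {k : ι} (hk : b.IsPos k) (i : b.support) :
    0 ≤ coord b (P.root k) i := by
  classical
  have key : ∀ f : ι → ℕ, coord b (∑ j ∈ b.support, f j • P.root j) i = f i := by
    intro f
    have : ∑ j ∈ b.support, f j • P.root j = ∑ j : b.support, (f j : ℝ) • P.root j := by
      rw [← Finset.sum_coe_sort]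
      exact Finset.sum_congr rfl fun j _ ↦ by rw [Nat.cast_smul_eq_nsmul]
    rw [this, coord, map_sum, Finsupp.finsetSum_apply]
    simp [Finsupp.single_apply]
  obtain ⟨f, -, hf | hf⟩ := b.exists_root_eq_sum_nat_or_neg k
  · rw [hf, key]; positivity
  · exfalso
    have h2 : P.root k = ∑ j ∈ b.support, (fun j ↦ -(f j : ℤ)) j • P.root j := by
      rw [hf, ← Finset.sum_neg_distrib]
      exact Finset.sum_congr rfl fun j _ ↦ by simp
    have h3 := Base.height_eq_sum h2
    rw [b.isPos_iff, h3] at hk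
    have : ∑ j ∈ b.support, -(f j : ℤ) ≤ 0 := Finset.sum_nonpos fun j _ ↦ by simp
    omega

lemma IsDominant.rootForm_nonneg {v : V} (hv : IsDominant b v) {x : V}
    (hx : ∀ i, 0 ≤ coord b x i) : 0 ≤ P.RootForm v x := by
  rw [← sum_coord b x, map_sum]
  refine Finset.sum_nonneg fun i _ ↦ ?_
  rw [map_smul, smul_eq_mul]
  refine mul_nonneg (hx i) ?_
  have h := two_mul_rootForm_root P v i
  have h1 := rootForm_root_pos P (i : ι)
  have h2 := mul_nonneg (hv i i.2) h1.le
  linarith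

lemma IsDominant.coroot'_nonneg {v : V} (hv : IsDominant b v) {k : ι} (hk : b.IsPos k) :
    0 ≤ P.coroot' k v := by
  have h := two_mul_rootForm_root P v k
  have h1 := rootForm_root_pos P k
  have h2 := hv.rootForm_nonneg b (coord_nonneg_of_isPos b hk)
  by_contra! h3
  have := mul_neg_of_neg_of_pos h3 h1
  linarith

/-- The action of a word in the simple reflections. -/
noncomputable def wordAct (l : List b.support) (v : V) : V :=
  l.foldr (fun i v ↦ P.reflection i v) v

@[simp] lemma wordAct_nil (v : V) : wordAct b [] v = v := rfl

@[simp] lemma wordAct_cons (i : b.support) (l : List b.support) (v : V) :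
    wordAct b (i :: l) v = P.reflection i (wordAct b l v) := rfl

lemma wordAct_append (l l' : List b.support) (v : V) :
    wordAct b (l ++ l') v = wordAct b l (wordAct b l' v) := by
  simp [wordAct]

/-- Words in the simple reflections permit induction on the length. Every root is reached from a
simple one by simple reflections, and its reflection is conjugated accordingly. -/
lemma exists_wordAct_eq_reflection (k : ι) :
    ∃ l : List b.support, ∀ v : V, P.reflection k v = wordAct b l v := by
  refine b.induction_reflect k (p := fun k ↦ ∃ l : List b.support,
    ∀ v : V, P.reflection k v = wordAct b l v) ?_ ?_ ?_
  · rintro k ⟨l, hl⟩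
    refine ⟨l, fun v ↦ ?_⟩
    rw [reflection_reflectionPerm]
    simpa using hl v
  · exact fun i hi ↦ ⟨[⟨i, hi⟩], fun v ↦ rfl⟩
  · rintro k j ⟨l, hl⟩ hj
    refine ⟨⟨j, hj⟩ :: (l ++ [⟨j, hj⟩]), fun v ↦ ?_⟩
    rw [reflection_reflectionPerm]
    simp [wordAct_append, hl]

lemma exists_wordAct_eq_smul (w : P.weylGroup) :
    ∃ l : List b.support, ∀ v : V, w • v = wordAct b l v := by
  obtain ⟨w, hw⟩ := w
  induction hw using weylGroup.induction with
  | mem k => exact exists_wordAct_eq_reflection b k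
  | one => exact ⟨[], fun v ↦ one_smul _ v⟩
  | mul x y hx hy h1 h2 =>
    obtain ⟨l, hl⟩ := h1
    obtain ⟨l', hl'⟩ := h2
    refine ⟨l ++ l', fun v ↦ ?_⟩
    rw [wordAct_append, ← hl', ← hl, ← mul_smul]
    rfl

/-- The inverse of a word, acting on the indices of the roots. -/
def wordPermInv (l : List b.support) (k : ι) : ι :=
  l.foldl (fun k i ↦ P.reflectionPerm i k) k

lemma reflection_wordAct (l : List b.support) (k : ι) (v : V) :
    P.reflection k (wordAct b l v) = wordAct b l (P.reflection (wordPermInv b l k) v) := by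
  induction l generalizing k with
  | nil => rfl
  | cons i l ih =>
    have : wordPermInv b (i :: l) k = wordPermInv b l (P.reflectionPerm i k) := rfl
    rw [this, wordAct_cons, wordAct_cons, ← ih, reflection_reflectionPerm]
    simp

lemma wordAct_sub (l : List b.support) (v w : V) :
    wordAct b l (v - w) = wordAct b l v - wordAct b l w := by
  induction l with
  | nil => rfl
  | cons i l ih => rw [wordAct_cons, ih, map_sub]; rfl

lemma wordAct_smul (l : List b.support) (a : ℝ) (v : V) :
    wordAct b l (a • v) = a • wordAct b l v := by
  induction l with
  | nil => rfl
  | cons i l ih => rw [wordAct_cons, ih, map_smul]; rfl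

lemma wordAct_root_wordPermInv (l : List b.support) (k : ι) :
    wordAct b l (P.root (wordPermInv b l k)) = P.root k := by
  induction l generalizing k with
  | nil => rfl
  | cons i l ih =>
    have : wordPermInv b (i :: l) k = wordPermInv b l (P.reflectionPerm i k) := rfl
    rw [this, wordAct_cons, ih, root_reflectionPerm]
    simp

/-- The exchange condition. -/
lemma exists_shorter_wordAct (l : List b.support) (k : ι) (hk : b.IsPos k)
    (hl : ¬ b.IsPos (wordPermInv b l k)) :
    ∃ l' : List b.support, l'.length + 1 = l.length ∧
      ∀ v : V, P.reflection k (wordAct b l v) = wordAct b l' v := by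
  induction l generalizing k with
  | nil => exact absurd hk hl
  | cons i l ih =>
    by_cases hki : k = i
    · subst hki
      exact ⟨l, rfl, fun v ↦ by simp⟩
    · obtain ⟨l', hlen, hl'⟩ := ih (P.reflectionPerm i k) (hk.reflectionPerm i.2 hki) hl
      refine ⟨i :: l', by simp [← hlen], fun v ↦ ?_⟩
      rw [wordAct_cons, wordAct_cons, ← hl', reflection_reflectionPerm]
      simp

/-- Let w be the tail of the word and α the simple root of its head. If w⁻¹α is positive, then s_α w
v = w v - ⟨v, (w⁻¹α)^∨⟩ α lies below w v, because v is dominant. If w⁻¹α is negative, the exchange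
condition yields a shorter word. -/
lemma coord_wordAct_le {v : V} (hv : IsDominant b v) (l : List b.support) :
    coord b (wordAct b l v) ≤ coord b v := by
  induction hn : l.length using Nat.strong_induction_on generalizing l with
  | _ n ih =>
    cases l with
    | nil => exact le_rfl
    | cons i l =>
      by_cases hp : b.IsPos (wordPermInv b l i)
      · refine le_trans ?_ (ih l.length (by simp [← hn]) l rfl)
        rw [wordAct_cons, reflection_wordAct, reflection_apply, wordAct_sub, wordAct_smul,
          wordAct_root_wordPermInv, coord_sub, coord_smul]
        intro j
        have h1 := coord_nonneg_of_isPos b (b.isPos_of_mem_support i.2) j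
        have h2 := hv.coroot'_nonneg b hp
        have := mul_nonneg h2 h1
        simp only [Pi.sub_apply, Pi.smul_apply, smul_eq_mul]
        linarith
      · obtain ⟨l', hlen, hl'⟩ := exists_shorter_wordAct b l i (b.isPos_of_mem_support i.2) hp
        rw [wordAct_cons, hl']
        exact ih l'.length (by simp [← hn]; omega) l' rfl

lemma IsDominant.coord_le {v u : V} (hv : IsDominant b v)
    (hu : u ∈ MulAction.orbit P.weylGroup v) : coord b u ≤ coord b v := by
  obtain ⟨w, rfl⟩ := hu
  obtain ⟨l, hl⟩ := exists_wordAct_eq_smul b w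
  change coord b (w • v) ≤ _
  rw [hl]
  exact coord_wordAct_le b hv l

lemma IsDominant.eq_of_mem_orbit {v u : V} (hv : IsDominant b v) (hu : IsDominant b u)
    (h : u ∈ MulAction.orbit P.weylGroup v) : u = v :=
  coord_injective b (le_antisymm (hv.coord_le b h)
    (hu.coord_le b (MulAction.mem_orbit_symm.mp h)))

/-- Every orbit contains a dominant element. -/
lemma exists_isDominant_mem_orbit (v : V) :
    ∃ u ∈ MulAction.orbit P.weylGroup v, IsDominant b u := by
  have := finite_weylGroup P
  have hfin : (MulAction.orbit P.weylGroup v).Finite := Set.finite_range _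
  -- At a maximum of the coordinate sum no simple coroot is negative, since otherwise the simple
  -- reflection would increase the sum.
  obtain ⟨u, hu, hmax⟩ := hfin.exists_maximalFor (fun u ↦ ∑ i, coord b u i) _
    ⟨v, MulAction.mem_orbit_self v⟩
  refine ⟨u, hu, fun i hi ↦ ?_⟩
  classical
  by_contra! hneg
  have hmem : P.reflection i u ∈ MulAction.orbit P.weylGroup v := by
    have := MulAction.mem_orbit_of_mem_orbit (weylGroup.ofIdx P i) hu
    simpa using this
  have h := hmax hmem
  have hsum : ∑ j, coord b (P.reflection i u) j = ∑ j, coord b u j - P.coroot' i u := by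
    rw [reflection_apply, coord_sub, coord_smul]
    simp only [Pi.sub_apply, Pi.smul_apply, Finset.sum_sub_distrib, smul_eq_mul, ← Finset.mul_sum]
    have : ∑ j, coord b (P.root i) j = 1 := by
      simp [coord_simple b ⟨i, hi⟩]
    rw [this, mul_one]
  simp only [hsum] at h
  have := h (by linarith)
  linarith

/-- The action of an element of the Weyl group, as a linear map. -/
noncomputable def weylLin (w : P.weylGroup) : V →ₗ[ℝ] V where
  toFun v := w • v
  map_add' := smul_add w
  map_smul' := weylGroup_smul_smul P w

lemma smul_mem_convexHull_orbit {u v : V} (w : P.weylGroup)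
    (hu : u ∈ convexHull ℝ (MulAction.orbit P.weylGroup v)) :
    w • u ∈ convexHull ℝ (MulAction.orbit P.weylGroup v) := by
  have h := Set.mem_image_of_mem (weylLin w) hu
  rw [(weylLin w).image_convexHull] at h
  refine convexHull_mono ?_ h
  rintro _ ⟨x, hx, rfl⟩
  exact MulAction.mem_orbit_of_mem_orbit w hx

lemma convexHull_orbit_subset {u v : V}
    (hu : u ∈ convexHull ℝ (MulAction.orbit P.weylGroup v)) :
    convexHull ℝ (MulAction.orbit P.weylGroup u) ⊆
      convexHull ℝ (MulAction.orbit P.weylGroup v) := by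
  refine convexHull_min ?_ (convex_convexHull ℝ _)
  rintro _ ⟨w, rfl⟩
  exact smul_mem_convexHull_orbit w hu

lemma IsDominant.coord_le_of_mem_convexHull {u v : V} (hv : IsDominant b v)
    (hu : u ∈ convexHull ℝ (MulAction.orbit P.weylGroup v)) : coord b u ≤ coord b v := by
  have hconv : Convex ℝ {u : V | coord b u ≤ coord b v} := by
    intro x hx y hy r s hr hs hrs i
    have h1 := mul_le_mul_of_nonneg_left (hx i) hr
    have h2 := mul_le_mul_of_nonneg_left (hy i) hs
    have h3 : (r + s) * coord b v i = coord b v i := by rw [hrs, one_mul]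
    rw [coord_add, coord_smul, coord_smul]
    simp only [Pi.add_apply, Pi.smul_apply, smul_eq_mul]
    linarith
  exact convexHull_min (fun x hx ↦ hv.coord_le b hx) hconv hu

/-- As s_i ρ = ρ - α_i, a functional that is maximal on Wρ at wρ is nonnegative on every wα_i. This
replaces the choice of a chamber in the next argument. -/
lemma exists_coroot'_eq_one : ∃ ρ : V, ∀ i ∈ b.support, P.coroot' i ρ = 1 := by
  obtain ⟨ρ, hρ⟩ := (LinearMap.IsPerfPair.bijective_left P.toLinearMap).2
    (b.toCoweightBasis.constr ℝ (fun _ ↦ (1 : ℝ)))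
  refine ⟨ρ, fun i hi ↦ ?_⟩
  have h := LinearMap.congr_fun hρ (P.coroot i)
  have h2 := b.toCoweightBasis.constr_basis ℝ (fun _ ↦ (1 : ℝ)) ⟨i, hi⟩
  rw [Base.toCoweightBasis_apply] at h2
  rw [h2] at h
  exact h

lemma apply_nonneg_of_coord_nonneg (g : V →ₗ[ℝ] ℝ) (hg : ∀ i : b.support, 0 ≤ g (P.root i))
    {x : V} (hx : 0 ≤ coord b x) : 0 ≤ g x := by
  rw [← sum_coord b x, map_sum]
  refine Finset.sum_nonneg fun i _ ↦ ?_
  rw [map_smul, smul_eq_mul]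
  exact mul_nonneg (hx i) (hg i)

/-- Otherwise a functional F separates u from Wv. Choose w with F(wρ) maximal; then g = F ∘ w is
nonnegative on the simple roots. Both u - w⁻¹u and v - u have nonnegative coordinates, so F(u) =
g(w⁻¹u) ≤ g(u) ≤ g(v) = F(wv), against the separation. -/
lemma IsDominant.mem_convexHull_of_coord_le {u v : V} (hu : IsDominant b u)
    (h : coord b u ≤ coord b v) : u ∈ convexHull ℝ (MulAction.orbit P.weylGroup v) := by
  have := finite_weylGroup P
  have hfin : (MulAction.orbit P.weylGroup v).Finite := Set.finite_range _
  by_contra hnot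
  -- No topology is given on V, so the separation takes place in the coordinate space.
  let φ := b.toWeightBasis.equivFun
  have hnot' : φ u ∉ convexHull ℝ (φ '' MulAction.orbit P.weylGroup v) := by
    have h1 := (φ : V →ₗ[ℝ] (b.support → ℝ)).image_convexHull (MulAction.orbit P.weylGroup v)
    have h2 : φ '' (convexHull ℝ (MulAction.orbit P.weylGroup v)) =
      convexHull ℝ (φ '' MulAction.orbit P.weylGroup v) := h1
    rw [← h2, φ.injective.mem_set_image]
    exact hnot
  obtain ⟨f, r, hf, hr⟩ := geometric_hahn_banach_closed_point (convex_convexHull ℝ _)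
    ((hfin.image φ).isClosed_convexHull ℝ) hnot'
  let F : V →ₗ[ℝ] ℝ := (f : (b.support → ℝ) →ₗ[ℝ] ℝ) ∘ₗ (φ : V →ₗ[ℝ] (b.support → ℝ))
  have hF : ∀ w : P.weylGroup, F (w • v) < r := fun w ↦
    hf _ (subset_convexHull ℝ _ ⟨w • v, MulAction.mem_orbit _ _, rfl⟩)
  obtain ⟨ρ, hρ⟩ := exists_coroot'_eq_one b
  obtain ⟨w, hw⟩ := Finite.exists_max fun w : P.weylGroup ↦ F (w • ρ)
  let g : V →ₗ[ℝ] ℝ := F ∘ₗ weylLin w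
  have hg : ∀ i : b.support, 0 ≤ g (P.root i) := by
    intro i
    have h1 := hw (w * weylGroup.ofIdx P i)
    rw [mul_smul, weylGroup.ofIdx_smul, Equiv.reflection_smul, reflection_apply, hρ i i.2,
      one_smul, smul_sub, map_sub] at h1
    change 0 ≤ F (w • P.root i)
    linarith
  have h1 : 0 ≤ g (u - w⁻¹ • u) := apply_nonneg_of_coord_nonneg b g hg (by
    rw [coord_sub, sub_nonneg]
    exact hu.coord_le b (MulAction.mem_orbit _ _))
  have h2 : 0 ≤ g (v - u) := apply_nonneg_of_coord_nonneg b g hg (by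
    rw [coord_sub, sub_nonneg]; exact h)
  have h3 : g (w⁻¹ • u) = F u := by
    change F (w • w⁻¹ • u) = F u
    rw [smul_inv_smul]
  have h4 : g v < r := hF w
  have h5 : r < F u := hr
  rw [map_sub] at h1 h2
  linarith

/-- These points form the segment from v to its reflection. -/
lemma sub_smul_root_mem_convexHull {v : V} {k : ι} {t : ℝ} (ht : 0 ≤ t)
    (htv : t ≤ P.coroot' k v) :
    v - t • P.root k ∈ convexHull ℝ (MulAction.orbit P.weylGroup v) := by
  have hmem : P.reflection k v ∈ MulAction.orbit P.weylGroup v :=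
    ⟨weylGroup.ofIdx P k, by simp⟩
  rcases ht.eq_or_lt with rfl | hpos
  · rw [zero_smul, sub_zero]
    exact subset_convexHull ℝ _ (MulAction.mem_orbit_self v)
  · have hk : 0 < P.coroot' k v := hpos.trans_le htv
    have h := (convex_convexHull ℝ (MulAction.orbit P.weylGroup v))
      (subset_convexHull ℝ _ (MulAction.mem_orbit_self v)) (subset_convexHull ℝ _ hmem)
      (a := 1 - t / P.coroot' k v) (b := t / P.coroot' k v)
      (by rw [sub_nonneg]; exact div_le_one_of_le₀ htv hk.le) (by positivity) (by ring)
    convert h using 1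
    rw [reflection_apply, smul_sub, smul_smul, div_mul_cancel₀ _ hk.ne']
    module

end Dominance


/-! ### The root lattice in integral coordinates, and an arithmetic description of roots. -/

section Lattice

variable {n : ℕ} (A : Matrix (Fin n) (Fin n) ℤ) (d : Fin n → ℤ)

/-- The value of the `j`th simple coroot at the vector with coordinates `c`. -/
def pair (c : Fin n → ℤ) (j : Fin n) : ℤ := ∑ i, c i * A i j

/-- The invariant form with `(αᵢ, αⱼ) = Aᵢⱼ dⱼ`. -/
def form (c c' : Fin n → ℤ) : ℤ := ∑ j, pair A c j * (d j * c' j)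

lemma pair_sub (c c' : Fin n → ℤ) (j : Fin n) :
    pair A (c - c') j = pair A c j - pair A c' j := by
  simp [pair, sub_mul, Finset.sum_sub_distrib]

lemma pair_single (i j : Fin n) : pair A (Pi.single i 1) j = A i j := by
  simp [pair, Pi.single_apply]

lemma pair_smul (a : ℤ) (c : Fin n → ℤ) (j : Fin n) : pair A (a • c) j = a * pair A c j := by
  simp [pair, Finset.mul_sum, mul_assoc]

lemma form_sub_left (c c' e : Fin n → ℤ) :
    form A d (c - c') e = form A d c e - form A d c' e := by
  simp [form, pair_sub, sub_mul, Finset.sum_sub_distrib]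

lemma form_sub_right (c c' e : Fin n → ℤ) :
    form A d e (c - c') = form A d e c - form A d e c' := by
  simp [form, mul_sub, Finset.sum_sub_distrib]

lemma form_smul_left (a : ℤ) (c e : Fin n → ℤ) : form A d (a • c) e = a * form A d c e := by
  simp only [form, pair_smul, Finset.mul_sum, mul_assoc]

lemma form_smul_right (a : ℤ) (c e : Fin n → ℤ) : form A d e (a • c) = a * form A d e c := by
  simp only [form, Pi.smul_apply, smul_eq_mul, Finset.mul_sum]
  exact Finset.sum_congr rfl fun j _ ↦ by ring

lemma form_single_right (c : Fin n → ℤ) (j : Fin n) :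
    form A d c (Pi.single j 1) = pair A c j * d j := by
  simp [form, Pi.single_apply]

/-- The vector with coordinates `c` behaves like a root of square length `2 d₀`. -/
def IsRootCoord (d₀ : ℤ) (c : Fin n → ℤ) : Prop :=
  -- The divisibility makes the coroot 2c/(c,c) = ∑ (c j * d j / d₀) α_j^∨ integral. For d₀ = 2 it
  -- excludes vectors of square length 4 that are not roots, such as e₁+e₂+e₃+e₄ in type C.
  form A d c c = 2 * d₀ ∧ ∀ j, d₀ ∣ c j * d j

/-- A positive definite Cartan matrix, symmetrized by numbers equal to `1` or `2`. -/
structure IsCartan : Prop where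
  diag : ∀ i, A i i = 2
  nonpos : ∀ i j, i ≠ j → A i j ≤ 0
  d_mem : ∀ i, d i = 1 ∨ d i = 2
  symm : ∀ i j, A i j * d j = A j i * d i
  pos : ∀ c, c ≠ 0 → 0 < form A d c c

variable {A d}

lemma form_eq (c c' : Fin n → ℤ) : form A d c c' = ∑ i, ∑ j, c i * (A i j * d j) * c' j := by
  rw [form, Finset.sum_comm]
  refine Finset.sum_congr rfl fun j _ ↦ ?_
  rw [pair, Finset.sum_mul]
  exact Finset.sum_congr rfl fun i _ ↦ by ring

lemma form_comm_of_symm (h : ∀ i j, A i j * d j = A j i * d i) (c c' : Fin n → ℤ) :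
    form A d c c' = form A d c' c := by
  rw [form_eq, form_eq, Finset.sum_comm]
  refine Finset.sum_congr rfl fun j _ ↦ Finset.sum_congr rfl fun i _ ↦ ?_
  rw [h i j]; ring

namespace IsCartan

variable (h : IsCartan A d)
include h

lemma d_pos (i : Fin n) : 0 < d i := by
  rcases h.d_mem i with h | h <;> omega

lemma form_comm (c c' : Fin n → ℤ) : form A d c c' = form A d c' c :=
  form_comm_of_symm h.symm c c'

lemma form_sub_sub (c c' : Fin n → ℤ) :
    form A d (c - c') (c - c') = form A d c c - 2 * form A d c c' + form A d c' c' := by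
  rw [form_sub_left, form_sub_right, form_sub_right, h.form_comm c' c]; ring

lemma isRootCoord_single (i : Fin n) : IsRootCoord A d (d i) (Pi.single i 1) := by
  refine ⟨by rw [form_single_right, pair_single, h.diag], fun j ↦ ?_⟩
  by_cases hj : j = i
  · subst hj; simp
  · simp [hj]

lemma isRootCoord_reflect {d₀ : ℤ} {c : Fin n → ℤ} (hc : IsRootCoord A d d₀ c) (j : Fin n) :
    IsRootCoord A d d₀ (c - pair A c j • Pi.single j 1) := by
  obtain ⟨h1, h2⟩ := hc
  refine ⟨?_, fun i ↦ ?_⟩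
  · rw [h.form_sub_sub, form_smul_right, form_smul_left, form_smul_right, form_single_right,
      form_single_right, pair_single, h.diag, h1]
    ring
  · by_cases hi : i = j
    · subst hi
      have : d₀ ∣ pair A c i * d i := by
        rw [pair, Finset.sum_mul]
        refine Finset.dvd_sum fun k _ ↦ ?_
        have : c k * A k i * d i = c k * d k * A i k := by
          rw [mul_assoc, h.symm]; ring
        rw [this]
        exact (h2 k).mul_right _
      simpa [sub_mul] using dvd_sub (h2 i) this
    · simpa [hi] using h2 i

lemma isRootCoord_neg {d₀ : ℤ} {c : Fin n → ℤ} (hc : IsRootCoord A d d₀ c) :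
    IsRootCoord A d d₀ (-c) := by
  refine ⟨?_, fun j ↦ ?_⟩
  · rw [← neg_one_smul ℤ c, form_smul_left, form_smul_right, hc.1]; ring
  · simpa using hc.2 j

-- Off-diagonal terms occur in equal pairs.
omit h in
lemma two_mul_dvd_sum_sum {ι : Type*} [DecidableEq ι] (F : ι → ι → ℤ) (m : ℤ)
    (hF : ∀ i j, F i j = F j i) (h1 : ∀ i j, m ∣ F i j) (h2 : ∀ i, 2 * m ∣ F i i)
    (s : Finset ι) : 2 * m ∣ ∑ i ∈ s, ∑ j ∈ s, F i j := by
  induction s using Finset.induction_on with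
  | empty => simp
  | insert a s ha ih =>
    have : ∑ i ∈ insert a s, ∑ j ∈ insert a s, F i j =
        F a a + 2 * ∑ j ∈ s, F a j + ∑ i ∈ s, ∑ j ∈ s, F i j := by
      rw [Finset.sum_insert ha]
      simp only [Finset.sum_insert ha, Finset.sum_add_distrib]
      have : ∑ i ∈ s, F i a = ∑ i ∈ s, F a i := Finset.sum_congr rfl fun i _ ↦ hF i a
      rw [this]; ring
    rw [this]
    exact dvd_add (dvd_add (h2 a) (mul_dvd_mul_left 2 (Finset.dvd_sum fun j _ ↦ h1 a j))) ih

lemma two_mul_dvd_form {d₀ : ℤ} {c : Fin n → ℤ} (hc : ∀ j, d₀ ∣ c j * d j) :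
    2 * d₀ ∣ form A d c c := by
  rw [form_eq]
  refine two_mul_dvd_sum_sum _ d₀ (fun i j ↦ ?_) (fun i j ↦ ?_) (fun i ↦ ?_) _
  · rw [h.symm]; ring
  · obtain ⟨a, ha⟩ := hc j
    exact ⟨c i * A i j * a, by linear_combination (c i * A i j) * ha⟩
  · obtain ⟨a, ha⟩ := hc i
    rw [h.diag]
    exact ⟨c i * a, by linear_combination (2 * c i) * ha⟩

/-- Write c = p - q with p, q ≥ 0 of disjoint support, so that (p, q) ≤ 0. Both (p, p) and (q, q)
are divisible by 2d₀; if neither vanished, (c, c) would be at least 4d₀, but it is 2d₀. -/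
lemma nonneg_or_nonpos {d₀ : ℤ} {c : Fin n → ℤ} (hd₀ : 0 < d₀) (hc : IsRootCoord A d d₀ c) :
    0 ≤ c ∨ c ≤ 0 := by
  have hsub : c = c⁺ - c⁻ := (posPart_sub_negPart c).symm
  have hp : ∀ j, c⁺ j = max (c j) 0 := fun j ↦ rfl
  have hq : ∀ j, c⁻ j = max (-c j) 0 := fun j ↦ rfl
  have hpd : ∀ j, d₀ ∣ c⁺ j * d j := fun j ↦ by
    rw [hp]; rcases max_choice (c j) 0 with h0 | h0 <;> rw [h0]
    · exact hc.2 j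
    · simp
  have hqd : ∀ j, d₀ ∣ c⁻ j * d j := fun j ↦ by
    rw [hq]; rcases max_choice (-c j) 0 with h0 | h0 <;> rw [h0]
    · simpa using hc.2 j
    · simp
  have hpq : form A d c⁺ c⁻ ≤ 0 := by
    rw [form_eq]
    refine Finset.sum_nonpos fun i _ ↦ Finset.sum_nonpos fun j _ ↦ ?_
    have h1 : 0 ≤ c⁺ i := by rw [hp]; exact le_max_right _ _
    have h2 : 0 ≤ c⁻ j := by rw [hq]; exact le_max_right _ _
    by_cases hij : i = j
    · subst hij
      have : c⁺ i * c⁻ i = 0 := by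
        rw [hp, hq]
        rcases le_total (c i) 0 with h0 | h0
        · rw [max_eq_right h0, zero_mul]
        · rw [max_eq_right (by omega : -c i ≤ 0), mul_zero]
      have h3 : c⁺ i * (A i i * d i) * c⁻ i = (A i i * d i) * (c⁺ i * c⁻ i) := by ring
      rw [h3, this, mul_zero]
    · have h3 : A i j * d j ≤ 0 := mul_nonpos_of_nonpos_of_nonneg (h.nonpos i j hij) (h.d_pos j).le
      exact mul_nonpos_of_nonpos_of_nonneg (mul_nonpos_of_nonneg_of_nonpos h1 h3) h2
  have hform : form A d c c = form A d c⁺ c⁺ - 2 * form A d c⁺ c⁻ + form A d c⁻ c⁻ := by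
    conv_lhs => rw [hsub]
    exact h.form_sub_sub _ _
  by_contra! hcon
  have hp0 : c⁺ ≠ 0 := fun h0 ↦ hcon.2 (posPart_eq_zero.mp h0)
  have hq0 : c⁻ ≠ 0 := fun h0 ↦ hcon.1 (negPart_eq_zero.mp h0)
  have h1 := Int.le_of_dvd (h.pos _ hp0) (h.two_mul_dvd_form hpd)
  have h2 := Int.le_of_dvd (h.pos _ hq0) (h.two_mul_dvd_form hqd)
  have h3 := hc.1
  omega

end IsCartan

end Lattice

/-! ### Comparison of the integral coordinates with the root system. -/

section Realization

variable {ι V N : Type*} [Fintype ι] [AddCommGroup V] [Module ℝ V] [AddCommGroup N] [Module ℝ N]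
variable {P : RootPairing ι ℝ V N} [P.IsRootSystem] [P.IsCrystallographic] [P.IsReduced]
variable (b : P.Base) {n : ℕ} (e : b.support ≃ Fin n)

/-- The vector with integral coordinates `c` with respect to the simple roots. -/
noncomputable def vec (c : Fin n → ℤ) : V := ∑ i, c i • P.root (e.symm i)

lemma vec_eq_sum (c : Fin n → ℤ) : vec b e c = ∑ i : b.support, (c (e i) : ℝ) • P.root i := by
  rw [vec, ← e.sum_comp]
  exact Finset.sum_congr rfl fun i _ ↦ by rw [Int.cast_smul_eq_zsmul, e.symm_apply_apply]

lemma coord_vec (c : Fin n → ℤ) (i : b.support) : coord b (vec b e c) i = c (e i) := by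
  classical
  rw [vec_eq_sum, coord, map_sum, Finsupp.finsetSum_apply]
  simp [Finsupp.single_apply]

lemma vec_injective : Function.Injective (vec b e) := by
  intro c c' h
  ext j
  have := congrFun (congrArg (coord b) h) (e.symm j)
  simpa [coord_vec] using this

lemma coord_vec_le_iff (c c' : Fin n → ℤ) :
    coord b (vec b e c) ≤ coord b (vec b e c') ↔ c ≤ c' := by
  constructor
  · intro h j
    have := h (e.symm j)
    simpa [coord_vec] using this
  · intro h i
    rw [coord_vec, coord_vec]
    exact Int.cast_le.mpr (h (e i))

lemma vec_sub (c c' : Fin n → ℤ) : vec b e (c - c') = vec b e c - vec b e c' := by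
  simp [vec, sub_smul, Finset.sum_sub_distrib]

lemma vec_add (c c' : Fin n → ℤ) : vec b e (c + c') = vec b e c + vec b e c' := by
  simp [vec, add_smul, Finset.sum_add_distrib]

@[simp] lemma vec_zero : vec b e 0 = 0 := by simp [vec]

lemma vec_neg (c : Fin n → ℤ) : vec b e (-c) = -vec b e c := by
  simp [vec]

lemma vec_smul (a : ℤ) (c : Fin n → ℤ) : vec b e (a • c) = a • vec b e c := by
  simp [vec, Finset.smul_sum, mul_smul]

lemma vec_single (j : Fin n) : vec b e (Pi.single j 1) = P.root (e.symm j) := by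
  classical
  simp [vec, Pi.single_apply, ite_smul]

lemma exists_vec_root (k : ι) : ∃ c, P.root k = vec b e c := by
  obtain ⟨f, -, -, hf⟩ := b.exists_root_eq_sum_int k
  refine ⟨fun i ↦ f (e.symm i), ?_⟩
  rw [hf, vec_eq_sum, ← Finset.sum_coe_sort]
  exact Finset.sum_congr rfl fun i _ ↦ by rw [Int.cast_smul_eq_zsmul, e.symm_apply_apply]

lemma mem_rootLattice_iff (v : V) :
    v ∈ AddSubgroup.closure (Set.range P.root) ↔ ∃ c, v = vec b e c := by
  constructor
  · intro hv
    induction hv using AddSubgroup.closure_induction with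
    | mem x hx => obtain ⟨k, rfl⟩ := hx; exact exists_vec_root b e k
    | zero => exact ⟨0, by simp⟩
    | add x y _ _ hx hy =>
      obtain ⟨c, rfl⟩ := hx
      obtain ⟨c', rfl⟩ := hy
      exact ⟨c + c', (vec_add b e c c').symm⟩
    | neg x _ hx =>
      obtain ⟨c, rfl⟩ := hx
      exact ⟨-c, (vec_neg b e c).symm⟩
  · rintro ⟨c, rfl⟩
    exact sum_mem fun i _ ↦ zsmul_mem (AddSubgroup.subset_closure (Set.mem_range_self _)) _

lemma height_eq_of_root_eq_vec {k : ι} {c : Fin n → ℤ} (h : P.root k = vec b e c) :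
    b.height k = ∑ i, c i := by
  classical
  let f : ι → ℤ := fun k ↦ if hk : k ∈ b.support then c (e ⟨k, hk⟩) else 0
  have hf : ∀ i : b.support, f i = c (e i) := fun i ↦ by simp [f]
  have : P.root k = ∑ j ∈ b.support, f j • P.root j := by
    rw [h, vec_eq_sum, ← Finset.sum_coe_sort b.support fun j ↦ f j • P.root j]
    exact Finset.sum_congr rfl fun i _ ↦ by rw [hf, Int.cast_smul_eq_zsmul]
  rw [Base.height_eq_sum this, ← Finset.sum_coe_sort b.support f, ← e.sum_comp]
  exact Finset.sum_congr rfl fun i _ ↦ hf i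

variable {A : Matrix (Fin n) (Fin n) ℤ} {d : Fin n → ℤ}
variable (hA : ∀ i j : b.support, b.cartanMatrix i j = A (e i) (e j))
include hA

lemma pairing_eq (i j : b.support) : P.pairing i j = (A (e i) (e j) : ℝ) := by
  have h : P.pairingIn ℤ i j = A (e i) (e j) := hA i j
  rw [← h]
  exact (P.algebraMap_pairingIn ℤ i j).symm

lemma coroot'_vec (c : Fin n → ℤ) (i : b.support) :
    P.coroot' i (vec b e c) = pair A c (e i) := by
  rw [vec_eq_sum, map_sum, pair, ← e.sum_comp]
  push_cast
  refine Finset.sum_congr rfl fun j _ ↦ ?_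
  rw [map_smul, root_coroot'_eq_pairing, pairing_eq b e hA, smul_eq_mul]

lemma isDominant_vec_iff (c : Fin n → ℤ) :
    IsDominant b (vec b e c) ↔ ∀ j, 0 ≤ pair A c j := by
  constructor
  · intro h j
    have := h (e.symm j) (e.symm j).2
    rw [coroot'_vec b e hA] at this
    simpa using this
  · intro h i hi
    have := coroot'_vec b e hA c ⟨i, hi⟩
    simp only at this
    rw [this]
    exact_mod_cast h _

lemma reflection_vec (c : Fin n → ℤ) (j : Fin n) :
    P.reflection (e.symm j) (vec b e c) = vec b e (c - pair A c j • Pi.single j 1) := by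
  rw [reflection_apply, coroot'_vec b e hA, vec_sub, vec_smul, vec_single, e.apply_symm_apply,
    Int.cast_smul_eq_zsmul]

/-- The normalization of the form `form A d`. -/
def IsScale (_ : ∀ i j : b.support, b.cartanMatrix i j = A (e i) (e j)) (d : Fin n → ℤ) (κ : ℝ) :
    Prop :=
  0 < κ ∧ ∀ i : b.support, P.RootForm (P.root i) (P.root i) = 2 * κ * d (e i)

/-- The square lengths of the simple roots satisfy the same symmetry relation as `d`, so their ratio
to `d` is constant along edges of the Dynkin diagram. The data `z`, `rk` certify that the diagram is
connected: each other node has a neighbour of smaller rank. -/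
lemma exists_isScale (hd : ∀ i, d i = 1 ∨ d i = 2) (hsymm : ∀ i j, A i j * d j = A j i * d i)
    (z : Fin n) (rk : Fin n → ℕ) (hconn : ∀ i, i ≠ z → ∃ j, rk j < rk i ∧ A i j * d j ≠ 0) :
    ∃ κ, IsScale b e hA d κ := by
  have hdpos : ∀ i, (0 : ℝ) < d i := fun i ↦ by
    rcases hd i with h | h <;> rw [h] <;> norm_num
  let r : Fin n → ℝ := fun i ↦ P.RootForm (P.root (e.symm i)) (P.root (e.symm i))
  have hr : ∀ i j, A i j * r j = A j i * r i := by
    intro i j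
    have h1 := two_mul_rootForm_root P (P.root (e.symm i)) (e.symm j)
    have h2 := two_mul_rootForm_root P (P.root (e.symm j)) (e.symm i)
    rw [root_coroot'_eq_pairing, pairing_eq b e hA] at h1 h2
    rw [rootForm_comm, h2] at h1
    simpa using h1.symm
  have key : ∀ m : ℕ, ∀ i : Fin n, rk i = m → r i * d z = r z * d i := by
    intro m
    induction m using Nat.strong_induction_on with
    | _ m ih =>
      intro i hi
      by_cases hi0 : i = z
      · rw [hi0]
      · obtain ⟨j, hj, hij⟩ := hconn i hi0
        have h1 := ih (rk j) (hi ▸ hj) j rfl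
        have h2 := hr i j
        have h3 : (A i j : ℝ) * d j = A j i * d i := by exact_mod_cast hsymm i j
        have hij' : (A i j : ℝ) ≠ 0 := by exact_mod_cast left_ne_zero_of_mul hij
        have h4 : (A i j : ℝ) * (r j * d i) = A i j * (r i * d j) := by
          linear_combination (d i : ℝ) * h2 - r i * h3
        have h5 := mul_left_cancel₀ hij' h4
        have h6 : (d j : ℝ) * (r i * d z) = d j * (r z * d i) := by
          linear_combination (-(d z : ℝ)) * h5 + (d i : ℝ) * h1
        exact mul_left_cancel₀ (hdpos j).ne' h6
  refine ⟨r z / (2 * d z), div_pos (rootForm_root_pos P _) (by have := hdpos z; positivity),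
    fun i ↦ ?_⟩
  have h1 := key _ (e i) rfl
  have h2 := hdpos z
  have h3 : r (e i) = P.RootForm (P.root i) (P.root i) := by simp [r]
  rw [← h3]
  field_simp
  linarith

variable {κ : ℝ} (hκ : IsScale b e hA d κ)
include hκ

lemma rootForm_vec_vec (c c' : Fin n → ℤ) :
    P.RootForm (vec b e c) (vec b e c') = κ * form A d c c' := by
  rw [vec_eq_sum b e c', map_sum, form, ← e.sum_comp]
  push_cast
  rw [Finset.mul_sum]
  refine Finset.sum_congr rfl fun j _ ↦ ?_
  have h1 := two_mul_rootForm_root P (vec b e c) j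
  rw [coroot'_vec b e hA, hκ.2] at h1
  rw [map_smul, smul_eq_mul]
  linear_combination (c' (e j) : ℝ) / 2 * h1

lemma isCartan (hd : ∀ i, d i = 1 ∨ d i = 2) (hsymm : ∀ i j, A i j * d j = A j i * d i) :
    IsCartan A d where
  diag i := by
    have := hA (e.symm i) (e.symm i)
    rw [b.cartanMatrix_apply_same] at this
    simpa using this.symm
  nonpos i j hij := by
    have := b.cartanMatrix_le_zero_of_ne (e.symm i) (e.symm j) (by simpa using hij)
    rw [hA] at this
    simpa using this
  d_mem := hd
  symm := hsymm
  pos c hc := by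
    have h1 : vec b e c ≠ 0 := fun h ↦ hc (vec_injective b e (by rw [h, vec_zero]))
    have h2 := P.rootForm_pos_of_ne_zero (x := vec b e c)
      (by
        change _ ∈ Submodule.span ℝ (Set.range P.root)
        rw [IsRootSystem.span_root_eq_top (P := P)]; trivial) h1
    rw [rootForm_vec_vec b e hA hκ] at h2
    have := (mul_pos_iff_of_pos_left hκ.1).mp h2
    exact_mod_cast this

omit hκ in
lemma exists_isRootCoord (hC : IsCartan A d) (k : ι) :
    ∃ c d₀, (d₀ = 1 ∨ d₀ = 2) ∧ P.root k = vec b e c ∧ IsRootCoord A d d₀ c := by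
  refine b.induction_reflect k (p := fun k ↦ ∃ c d₀, (d₀ = 1 ∨ d₀ = 2) ∧ P.root k = vec b e c ∧
    IsRootCoord A d d₀ c) ?_ ?_ ?_
  · rintro k ⟨c, d₀, hd, hc, h⟩
    refine ⟨-c, d₀, hd, ?_, hC.isRootCoord_neg h⟩
    rw [root_reflectionPerm, reflection_apply_self, hc, vec_neg]
  · intro i hi
    refine ⟨Pi.single (e ⟨i, hi⟩) 1, _, hC.d_mem (e ⟨i, hi⟩), ?_, hC.isRootCoord_single _⟩
    rw [vec_single, e.symm_apply_apply]
  · rintro k j ⟨c, d₀, hd, hc, h⟩ hj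
    refine ⟨_, d₀, hd, ?_, hC.isRootCoord_reflect h (e ⟨j, hj⟩)⟩
    rw [root_reflectionPerm, ← reflection_vec b e hA, hc, e.symm_apply_apply]

-- Induction on the height of a nonnegative c. As (c, c) > 0, some simple root α_j with c_j > 0 has
-- positive pairing with c. Reflecting in α_j lowers the height; the result is again nonnegative or
-- nonpositive, and in the latter case c is a multiple of α_j, hence α_j itself.
omit hκ in
lemma exists_root_eq_vec (hC : IsCartan A d) {c : Fin n → ℤ} {d₀ : ℤ} (hd₀ : d₀ = 1 ∨ d₀ = 2)
    (hc : IsRootCoord A d d₀ c) : ∃ k, P.root k = vec b e c := by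
  have hd₀pos : 0 < d₀ := by omega
  have main : ∀ m : ℕ, ∀ c : Fin n → ℤ, 0 ≤ c → ∑ i, c i = m → IsRootCoord A d d₀ c →
      ∃ k, P.root k = vec b e c := by
    intro m
    induction m using Nat.strong_induction_on with
    | _ m ih =>
      intro c hc0 hm hc
      obtain ⟨j, hj⟩ : ∃ j, 0 < pair A c j * (d j * c j) := by
        by_contra! hcon
        have h1 : form A d c c ≤ 0 := Finset.sum_nonpos fun j _ ↦ hcon j
        have h2 := hc.1
        omega
      have hdj := hC.d_pos j
      have hcj : 0 < c j := by
        refine lt_of_le_of_ne (hc0 j) fun h0 ↦ ?_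
        rw [← h0, mul_zero, mul_zero] at hj
        exact lt_irrefl _ hj
      have hpj : 0 < pair A c j := pos_of_mul_pos_left hj (by positivity)
      have hrefl := hC.isRootCoord_reflect hc j
      have hval : ∀ i, (c - pair A c j • Pi.single j 1 : Fin n → ℤ) i =
          if i = j then c j - pair A c j else c i := by
        intro i
        by_cases hi : i = j
        · subst hi; simp
        · simp [hi]
      rcases hC.nonneg_or_nonpos hd₀pos hrefl with h0 | h0
      · have hsum : ∑ i, (c - pair A c j • Pi.single j 1 : Fin n → ℤ) i = m - pair A c j := by
          simp only [Pi.sub_apply, Finset.sum_sub_distrib, hm, Pi.smul_apply, smul_eq_mul,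
            ← Finset.mul_sum]
          simp
        have hnn : 0 ≤ ∑ i, (c - pair A c j • Pi.single j 1 : Fin n → ℤ) i :=
          Finset.sum_nonneg fun i _ ↦ h0 i
        obtain ⟨k, hk⟩ := ih (m - pair A c j).toNat (by omega) _ h0 (by omega) hrefl
        refine ⟨P.reflectionPerm (e.symm j) k, ?_⟩
        rw [root_reflectionPerm, hk, ← reflection_vec b e hA, reflection_same]
      · have hother : ∀ i, i ≠ j → c i = 0 := by
          intro i hi
          have h1 := h0 i
          rw [hval, if_neg hi] at h1
          exact le_antisymm h1 (hc0 i)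
        have hcs : c = c j • Pi.single j 1 := by
          ext i
          by_cases hi : i = j
          · subst hi; simp
          · simp [hi, hother i hi]
        have hform := hc.1
        rw [hcs, form_smul_left, form_smul_right, form_single_right, pair_single, hC.diag] at hform
        -- For c_j ≥ 2 the square length 2 c_j² d_j would be at least 8, but it is 2d₀ ≤ 4.
        have hc1 : c j = 1 := by
          have h1 : c j * c j * d j = d₀ := by linarith
          by_contra hne
          have h2 : 2 ≤ c j := by omega
          have h3 : 4 ≤ c j * c j := by nlinarith
          have h4 := mul_le_mul_of_nonneg_right h3 hdj.le
          rw [h1] at h4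
          omega
        refine ⟨e.symm j, ?_⟩
        rw [hcs, hc1, one_smul, vec_single]
  rcases hC.nonneg_or_nonpos hd₀pos hc with h0 | h0
  · exact main (∑ i, c i).toNat c h0 (by
      rw [Int.toNat_of_nonneg]; exact Finset.sum_nonneg fun i _ ↦ h0 i) hc
  · have h1 : 0 ≤ -c := neg_nonneg.mpr h0
    obtain ⟨k, hk⟩ := main (∑ i, (-c) i).toNat (-c) h1 (by
      rw [Int.toNat_of_nonneg]; exact Finset.sum_nonneg fun i _ ↦ h1 i) (hC.isRootCoord_neg hc)
    refine ⟨P.reflectionPerm k k, ?_⟩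
    rw [root_reflectionPerm, reflection_apply_self, hk, vec_neg, neg_neg]

end Realization


/-! ### Certificates for a list of the small dominant weights. -/

section Data

variable {n : ℕ} (A : Matrix (Fin n) (Fin n) ℤ) (d : Fin n → ℤ)

/-- The dominant weight `x` arises from the dominant weight `y` by adding a block with the given
label; `k` and `l` are the co-lengths of `x` and `y`. -/
def IsStep (x y : Fin n → ℤ) (k l : ℕ) : BlockLabel → Prop
  | .one => (∀ j, d j = 1) ∧ IsRootCoord A d 1 (x - y) ∧ k = l + 1 ∧
      form A d x x = form A d y y + 2
  | .oneShort => (∃ j, d j = 2) ∧ IsRootCoord A d 1 (x - y) ∧ k = l + 1 ∧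
      form A d x x = form A d y y + 2
  | .oneLong => (∃ j, d j = 2) ∧ IsRootCoord A d 2 (x - y) ∧ k = l + 1 ∧
      form A d x x = form A d y y + 4
  | .two => (∃ β γ, IsRootCoord A d 1 β ∧ IsRootCoord A d 1 γ ∧ form A d β γ = 1 ∧ β + γ = x - y) ∧
      k = l + 2 ∧ form A d x x = form A d y y + 6

/-- A parametrization of the dominant small weights, in coordinates, together with their
co-lengths, their canonical block decompositions and their symbols. -/
structure SmallData (I : Type) where
  wt : I → Fin n → ℤ
  dom : ∀ i j, 0 ≤ pair A (wt i) j
  short : I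
  high : I
  root_short : IsRootCoord A d 1 (wt short)
  short_le_high : wt short ≤ wt high
  -- The second premise negates 2θ_s ≤ c, where θ_s = `wt short`.
  complete : ∀ c, (∀ j, 0 ≤ pair A c j) → (∃ j, c j < 2 * wt short j) → ∃ i, wt i = c
  short_unique : ∀ i, form A d (wt i) (wt i) = 2 → wt i = wt short
  high_unique : ∀ i, form A d (wt i) (wt i) = 4 → (∀ j, 2 ∣ wt i j * d j) → (∃ j, d j = 2) →
    wt i = wt high
  -- Both bounds have the form d₀ + 2 for a root of square length 2d₀. They keep 2β out of the hull
  -- and limit the blocks to two terms.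
  form_short_le : ∀ i, form A d (wt i) (wt short) ≤ 3
  form_high_le : (∃ j, d j = 2) → ∀ i, form A d (wt i) (wt high) ≤ 4
  colen : I → ℕ
  colen_zero : ∀ i, wt i = 0 → colen i = 0
  -- No root exceeds `wt high` in any coordinate, so this coordinate alone forces at least `colen i`
  -- terms.
  colen_le : ∀ i, wt i ≠ 0 → ∃ j, ((colen i : ℤ) - 1) * wt high j < wt i j
  pred : I → I
  label : I → BlockLabel
  step : ∀ i, wt i ≠ 0 → IsStep A d (wt i) (wt (pred i)) (colen i) (colen (pred i)) (label i)
  -- The alternatives are the possible effects of removing a block: one root of square length 2 or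
  -- 4, or two roots of square length 2 with scalar product 1, whose sum has square length 6.
  pred_max : ∀ i q, wt i ≠ 0 → wt q ≤ wt i →
    ((colen i = colen q + 1 ∧ (form A d (wt i) (wt i) = form A d (wt q) (wt q) + 2 ∨
      ((∃ j, d j = 2) ∧ form A d (wt i) (wt i) = form A d (wt q) (wt q) + 4))) ∨
     (colen i = colen q + 2 ∧ form A d (wt i) (wt i) = form A d (wt q) (wt q) + 6)) →
    wt q ≤ wt (pred i)
  labels : I → List BlockLabel
  labels_zero : ∀ i, wt i = 0 → labels i = []
  labels_pred : ∀ i, wt i ≠ 0 → labels i = labels (pred i) ++ [label i]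
  sym : I → WeightSymbol
  -- If the labels are [one, one], then `pred` is the first root B₁ and the difference is the second
  -- root B₂. A root orthogonal to B₁ with scalar product 1 with B₂ shows that the component of B₂
  -- is larger than A₁; evenness of all these scalar products shows that it is A₁.
  sym_spec : ∀ i,
    (sym i = .word (labels i) ∧ (labels i ≠ [.one, .one] ∨ ∃ c, IsRootCoord A d 1 c ∧
      form A d c (wt (pred i)) = 0 ∧ form A d c (wt i - wt (pred i)) = 1)) ∨
    (sym i = .oneOne ∧ labels i = [.one, .one] ∧
      ∀ c, form A d c (wt (pred i)) = 0 → 2 ∣ form A d c (wt i - wt (pred i)))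

variable {A d}

namespace IsCartan

variable (h : IsCartan A d)
include h

/-- If all d are 1, then c = 2a and 4(a, a) = 4, although the form is even. -/
lemma exists_d_eq_two {c : Fin n → ℤ} (hc : IsRootCoord A d 2 c) : ∃ j, d j = 2 := by
  by_contra! hcon
  have hd : ∀ j, d j = 1 := fun j ↦ (h.d_mem j).resolve_right (hcon j)
  have h2 : ∀ j, ∃ a, c j = 2 * a := fun j ↦ by
    have := hc.2 j
    rwa [hd, mul_one] at this
  choose a ha using h2
  have hca : c = (2 : ℤ) • a := by ext j; simp [ha]
  have h1 := hc.1
  rw [hca, form_smul_left, form_smul_right] at h1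
  have h3 : 2 * 1 ∣ form A d a a := h.two_mul_dvd_form fun j ↦ one_dvd _
  omega

lemma form_nonneg {c x : Fin n → ℤ} (hc : ∀ j, 0 ≤ pair A c j) (hx : 0 ≤ x) :
    0 ≤ form A d c x :=
  Finset.sum_nonneg fun j _ ↦ mul_nonneg (hc j) (mul_nonneg (h.d_pos j).le (hx j))

lemma form_mono {c x y : Fin n → ℤ} (hc : ∀ j, 0 ≤ pair A c j) (hxy : x ≤ y) :
    form A d c x ≤ form A d c y := by
  have := h.form_nonneg hc (sub_nonneg.mpr hxy)
  rw [form_sub_right] at this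
  omega

lemma form_self_mono {x y : Fin n → ℤ} (hx : ∀ j, 0 ≤ pair A x j) (hy : ∀ j, 0 ≤ pair A y j)
    (hxy : x ≤ y) : form A d x x ≤ form A d y y := by
  have h1 := h.form_mono hx hxy
  have h2 := h.form_mono hy hxy
  rw [h.form_comm] at h2
  omega

lemma dvd_form {d₀ : ℤ} {c : Fin n → ℤ} (hc : ∀ j, d₀ ∣ c j * d j) (x : Fin n → ℤ) :
    d₀ ∣ form A d x c := by
  refine Finset.dvd_sum fun j _ ↦ ?_
  rw [mul_comm (d j)]
  exact (hc j).mul_left _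

end IsCartan

end Data

/-! ### Minimal expressions. -/

section Expressions

variable {ι V N : Type*} [Fintype ι] [AddCommGroup V] [Module ℝ V] [AddCommGroup N] [Module ℝ N]
variable {P : RootPairing ι ℝ V N} [P.IsRootSystem] [P.IsCrystallographic] [P.IsReduced]

lemma exists_expression_smul (w : P.weylGroup) (m : Multiset ι) :
    ∃ m' : Multiset ι, Multiset.card m' = Multiset.card m ∧
      (m'.map P.root).sum = w • (m.map P.root).sum := by
  refine ⟨m.map (P.weylGroupToPerm w), by simp, ?_⟩
  induction m using Multiset.induction_on with
  | empty => simp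
  | cons a m ih =>
    rw [Multiset.map_cons, Multiset.map_cons, Multiset.sum_cons, ih, Multiset.map_cons,
      Multiset.sum_cons, smul_add, weylGroup_apply_root]

/-- Two roots with negative scalar product are opposite or add up to a root, and either case
shortens the expression. -/
lemma IsMinimalExpression.rootForm_nonneg {v : V} {m m' : Multiset ι} {i j : ι}
    (hm : IsMinimalExpression P v m) (hm' : m = i ::ₘ j ::ₘ m') :
    0 ≤ P.RootForm (P.root i) (P.root j) := by
  by_contra! hneg
  obtain ⟨hsum, hmin⟩ := hm
  subst hm'
  have h1 : P.pairing i j < 0 := by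
    have h := two_mul_rootForm_root P (P.root i) j
    rw [root_coroot'_eq_pairing] at h
    by_contra! h0
    have := mul_nonneg h0 (rootForm_root_pos P j).le
    linarith
  have h2 : P.pairingIn ℤ i j < 0 := by
    rw [← P.algebraMap_pairingIn ℤ i j] at h1
    simpa using h1
  by_cases hij : P.root i = -P.root j
  · have := hmin m' (by
      rw [← hsum]; simp [hij])
    simp at this
  · obtain ⟨k, hk⟩ := P.root_add_root_mem_of_pairingIn_neg h2 hij
    have := hmin (k ::ₘ m') (by
      rw [← hsum]; simp [hk, add_assoc])
    simp at this

end Expressions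


/-! ### Small dominant weights, their co-lengths and the shape of their blocks. -/

section Blocks

variable {ι V N : Type*} [Fintype ι] [AddCommGroup V] [Module ℝ V] [AddCommGroup N] [Module ℝ N]
variable {P : RootPairing ι ℝ V N} [P.IsRootSystem] [P.IsCrystallographic] [P.IsReduced]

lemma smul_mem_rootLattice (w : P.weylGroup) {v : V}
    (hv : v ∈ AddSubgroup.closure (Set.range P.root)) :
    w • v ∈ AddSubgroup.closure (Set.range P.root) := by
  induction hv using AddSubgroup.closure_induction with
  | mem x hx =>
    obtain ⟨k, rfl⟩ := hx
    rw [weylGroup_apply_root]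
    exact AddSubgroup.subset_closure (Set.mem_range_self _)
  | zero => rw [smul_zero]; exact zero_mem _
  | add x y _ _ hx hy => rw [smul_add]; exact add_mem hx hy
  | neg x _ hx => rw [smul_neg]; exact neg_mem hx

variable (b : P.Base) {n : ℕ} (e : b.support ≃ Fin n)
variable {A : Matrix (Fin n) (Fin n) ℤ} {d : Fin n → ℤ}
variable (hA : ∀ i j : b.support, b.cartanMatrix i j = A (e i) (e j))
variable {κ : ℝ} (hκ : IsScale b e hA d κ) (hC : IsCartan A d)
variable {I : Type} (D : SmallData A d I)
include hA hκ hC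

lemma rootForm_root_self {k : ι} {c : Fin n → ℤ} {d₀ : ℤ} (hk : P.root k = vec b e c)
    (hc : IsRootCoord A d d₀ c) : P.RootForm (P.root k) (P.root k) = 2 * κ * d₀ := by
  rw [hk, rootForm_vec_vec b e hA hκ, hc.1]; push_cast; ring

lemma coroot'_root_vec {k : ι} {c : Fin n → ℤ} {d₀ : ℤ}
    (hk : P.root k = vec b e c) (hc : IsRootCoord A d d₀ c) (x : Fin n → ℤ) :
    P.coroot' k (vec b e x) * d₀ = form A d x c := by
  have h := two_mul_rootForm_root P (vec b e x) k
  rw [rootForm_root_self b e hA hκ hC hk hc, hk, rootForm_vec_vec b e hA hκ] at h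
  have hκ0 := hκ.1
  have : κ * 2 * (P.coroot' k (vec b e x) * d₀) = κ * 2 * form A d x c := by linear_combination -h
  exact mul_left_cancel₀ (by positivity) this

include D

/-- The dominant conjugate is not above 2θ_s, whose square length 8 exceeds 2d₀ ≤ 4. It is therefore
in the list, and there its square length, with the divisibility for long roots, determines it. -/
lemma exists_smul_root_eq {k : ι} {c : Fin n → ℤ} {d₀ : ℤ} (hd₀ : d₀ = 1 ∨ d₀ = 2)
    (hk : P.root k = vec b e c) (hc : IsRootCoord A d d₀ c) :
    ∃ w : P.weylGroup, w • P.root k = vec b e (D.wt (if d₀ = 1 then D.short else D.high)) := by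
  obtain ⟨_, ⟨w, rfl⟩, hdom⟩ := exists_isDominant_mem_orbit b (P.root k)
  simp only at hdom
  refine ⟨w, ?_⟩
  obtain ⟨c', d', hd', hk', hc'⟩ := exists_isRootCoord b e hA hC (P.weylGroupToPerm w k)
  have hform : P.RootForm (w • P.root k) (w • P.root k) = P.RootForm (P.root k) (P.root k) :=
    rootForm_smul_smul P w _ _
  rw [weylGroup_apply_root] at hform hdom ⊢
  rw [rootForm_root_self b e hA hκ hC hk' hc', rootForm_root_self b e hA hκ hC hk hc] at hform
  have hκ0 := hκ.1
  have hdd : d' = d₀ := by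
    have : (d' : ℝ) = d₀ := mul_left_cancel₀ (by positivity) hform
    exact_mod_cast this
  subst hdd
  rw [hk'] at hdom ⊢
  rw [isDominant_vec_iff b e hA] at hdom
  obtain ⟨i, hi⟩ := D.complete c' hdom (by
    by_contra! hle
    have h1 : (2 : ℤ) • D.wt D.short ≤ c' := fun j ↦ by simpa using hle j
    have h2 := hC.form_self_mono (x := (2 : ℤ) • D.wt D.short)
      (fun j ↦ by rw [pair_smul]; have := D.dom D.short j; positivity) hdom h1
    rw [form_smul_left, form_smul_right, D.root_short.1, hc'.1] at h2
    omega)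
  subst hi
  rcases hd₀ with rfl | rfl
  · rw [if_pos rfl, D.short_unique i hc'.1]
  · rw [if_neg (by norm_num), D.high_unique i hc'.1 hc'.2 (hC.exists_d_eq_two hc')]

lemma le_high_of_root {k : ι} {c : Fin n → ℤ} (hk : P.root k = vec b e c) :
    c ≤ D.wt D.high := by
  obtain ⟨c', d₀, hd₀, hk', hc⟩ := exists_isRootCoord b e hA hC k
  obtain rfl : c = c' := vec_injective b e (by rw [← hk, ← hk'])
  obtain ⟨w, hw⟩ := exists_smul_root_eq b e hA hκ hC D hd₀ hk hc
  have hdom : IsDominant b (w • P.root k) := by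
    rw [hw, isDominant_vec_iff b e hA]; exact D.dom _
  have h1 := hdom.coord_le b (u := P.root k)
    (MulAction.mem_orbit_symm.mp (MulAction.mem_orbit _ w))
  rw [hw, hk, coord_vec_le_iff] at h1
  refine h1.trans ?_
  split_ifs
  · exact D.short_le_high
  · exact le_rfl

/-- Replacing a root by its dominant conjugate raises its coordinates, and pairing with a dominant
weight is monotone. -/
lemma form_wt_root_le {k : ι} {c : Fin n → ℤ} {d₀ : ℤ} (hd₀ : d₀ = 1 ∨ d₀ = 2)
    (hk : P.root k = vec b e c) (hc : IsRootCoord A d d₀ c) (i : I) :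
    form A d (D.wt i) c ≤ d₀ + 2 := by
  obtain ⟨w, hw⟩ := exists_smul_root_eq b e hA hκ hC D hd₀ hk hc
  have hdom : IsDominant b (w • P.root k) := by
    rw [hw, isDominant_vec_iff b e hA]; exact D.dom _
  have h1 := hdom.coord_le b (u := P.root k)
    (MulAction.mem_orbit_symm.mp (MulAction.mem_orbit _ w))
  rw [hw, hk, coord_vec_le_iff] at h1
  have h2 := hC.form_mono (D.dom i) h1
  rcases hd₀ with rfl | rfl
  · have := D.form_short_le i
    rw [if_pos rfl] at h2
    omega
  · have := D.form_high_le (hC.exists_d_eq_two hc) i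
    rw [if_neg (by norm_num)] at h2
    omega

lemma isSmall_vec_wt (i : I) : IsSmall P (vec b e (D.wt i)) := by
  refine ⟨(mem_rootLattice_iff b e _).mpr ⟨_, rfl⟩, fun k hk ↦ ?_⟩
  obtain ⟨c, d₀, hd₀, hkc, hc⟩ := exists_isRootCoord b e hA hC k
  obtain ⟨w, hw⟩ := exists_smul_root_eq b e hA hκ hC D hd₀ hkc hc
  have h1 := smul_mem_convexHull_orbit w hk
  rw [weylGroup_smul_smul, weylGroup_apply_root] at h1
  rw [weylGroup_apply_root] at hw
  obtain ⟨c', d', hd', hkc', hc'⟩ := exists_isRootCoord b e hA hC (P.weylGroupToPerm w k)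
  have hdom : IsDominant b (vec b e (D.wt i)) := by
    rw [isDominant_vec_iff b e hA]; exact D.dom _
  have h2 := hdom.coord_le_of_mem_convexHull b h1
  have h3 : (2 : ℝ) • P.root (P.weylGroupToPerm w k) = vec b e ((2 : ℤ) • c') := by
    rw [vec_smul, hkc', ← Int.cast_smul_eq_zsmul ℝ]; norm_num
  rw [h3, coord_vec_le_iff] at h2
  have hdom' : ∀ j, 0 ≤ pair A c' j := by
    rw [← isDominant_vec_iff b e hA, ← hkc', hw, isDominant_vec_iff b e hA]; exact D.dom _
  -- For a dominant root β of square length 2d', 2β ≤ λ would give 4d' ≤ (λ, β) ≤ d' + 2.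
  have h4 := hC.form_mono hdom' h2
  have h5 := form_wt_root_le b e hA hκ hC D hd' hkc' hc' i
  rw [form_smul_right, hc'.1, hC.form_comm] at h4
  omega

/-- If the dominant conjugate were not listed, it would lie above 2θ_s, and then 2θ_s would lie in
the hull. -/
lemma exists_smul_eq_vec_wt {v : V} (hv : IsSmall P v) :
    ∃ i, ∃ w : P.weylGroup, w • v = vec b e (D.wt i) := by
  obtain ⟨_, ⟨w, rfl⟩, hdom⟩ := exists_isDominant_mem_orbit b v
  simp only at hdom
  have hlat : w • v ∈ AddSubgroup.closure (Set.range P.root) :=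
    smul_mem_rootLattice w hv.1
  obtain ⟨c, hc⟩ := (mem_rootLattice_iff b e _).mp hlat
  have hdom' := hdom
  rw [hc, isDominant_vec_iff b e hA] at hdom'
  obtain ⟨i, rfl⟩ := D.complete c hdom' (by
    by_contra! hle
    obtain ⟨k, hk⟩ := exists_root_eq_vec b e hA hC (Or.inl rfl) D.root_short
    have h1 : vec b e ((2 : ℤ) • D.wt D.short) = (2 : ℝ) • P.root k := by
      rw [vec_smul, hk, ← Int.cast_smul_eq_zsmul ℝ]; norm_num
    refine hv.2 k ?_
    rw [← h1, ← MulAction.orbit_smul w v, hc]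
    refine IsDominant.mem_convexHull_of_coord_le b ?_ ?_
    · rw [isDominant_vec_iff b e hA]
      intro j
      rw [pair_smul]; have := D.dom D.short j; positivity
    · rw [coord_vec_le_iff]
      intro j; simpa using hle j)
  exact ⟨i, w, hc⟩

omit D in
lemma sum_eq_vec (m : Multiset ι) (c : ι → Fin n → ℤ) (hc : ∀ k, P.root k = vec b e (c k)) :
    (m.map P.root).sum = vec b e (m.map c).sum := by
  induction m using Multiset.induction_on with
  | empty => simp
  | cons a m ih => simp [vec_add, ih, hc a]

lemma colen_le_card {i : I} {m : Multiset ι} (hm : (m.map P.root).sum = vec b e (D.wt i)) :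
    D.colen i ≤ Multiset.card m := by
  by_cases hi : D.wt i = 0
  · rw [D.colen_zero i hi]; exact Nat.zero_le _
  obtain ⟨j, hj⟩ := D.colen_le i hi
  choose c hc using exists_vec_root b e
  rw [sum_eq_vec b e hA hκ hC m c hc] at hm
  have h1 := congrFun (vec_injective b e hm) j
  have h2 : ∀ m : Multiset ι, (m.map c).sum j ≤ Multiset.card m * D.wt D.high j := by
    intro m
    induction m using Multiset.induction_on with
    | empty => simp
    | cons a m ih =>
      have := le_high_of_root b e hA hκ hC D (hc a) j
      simp only [Multiset.map_cons, Multiset.sum_cons, Pi.add_apply, Multiset.card_cons]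
      push_cast
      linarith
  have h3 := h2 m
  rw [h1] at h3
  have h4 : 0 ≤ D.wt D.high j := by
    have hs : 0 ≤ D.wt D.short := by
      rcases hC.nonneg_or_nonpos one_pos D.root_short with h0 | h0
      · exact h0
      · have := hC.form_nonneg (D.dom D.short) (x := -D.wt D.short) (by simpa using h0)
        rw [← neg_one_smul ℤ, form_smul_right, D.root_short.1] at this
        omega
    exact (hs j).trans (D.short_le_high j)
  by_contra! hlt
  have h5 : (Multiset.card m : ℤ) ≤ D.colen i - 1 := by omega
  have := mul_le_mul_of_nonneg_right h5 h4
  omega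

lemma exists_card_eq_colen (i : I) :
    ∃ m : Multiset ι, (m.map P.root).sum = vec b e (D.wt i) ∧ Multiset.card m = D.colen i := by
  induction hN : D.colen i using Nat.strong_induction_on generalizing i with
  | _ N ih =>
    by_cases hi : D.wt i = 0
    · exact ⟨0, by simp [hi], by rw [← hN, D.colen_zero i hi]; rfl⟩
    have hstep := D.step i hi
    have single : ∀ d₀ : ℤ, (d₀ = 1 ∨ d₀ = 2) →
        IsRootCoord A d d₀ (D.wt i - D.wt (D.pred i)) → D.colen i = D.colen (D.pred i) + 1 →
        ∃ m : Multiset ι, (m.map P.root).sum = vec b e (D.wt i) ∧ Multiset.card m = N := by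
      intro d₀ hd₀ hc hcol
      obtain ⟨m, hm, hcard⟩ := ih (D.colen (D.pred i)) (by omega) (D.pred i) rfl
      obtain ⟨k, hk⟩ := exists_root_eq_vec b e hA hC hd₀ hc
      refine ⟨k ::ₘ m, ?_, by rw [Multiset.card_cons]; omega⟩
      rw [Multiset.map_cons, Multiset.sum_cons, hm, hk, ← vec_add, sub_add_cancel]
    cases hl : D.label i with
    | one => rw [hl] at hstep; exact single 1 (Or.inl rfl) hstep.2.1 hstep.2.2.1
    | oneShort => rw [hl] at hstep; exact single 1 (Or.inl rfl) hstep.2.1 hstep.2.2.1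
    | oneLong => rw [hl] at hstep; exact single 2 (Or.inr rfl) hstep.2.1 hstep.2.2.1
    | two =>
      rw [hl] at hstep
      obtain ⟨⟨β, γ, hβ, hγ, -, hsum⟩, hcol, -⟩ := hstep
      obtain ⟨m, hm, hcard⟩ := ih (D.colen (D.pred i)) (by omega) (D.pred i) rfl
      obtain ⟨k, hk⟩ := exists_root_eq_vec b e hA hC (Or.inl rfl) hβ
      obtain ⟨k', hk'⟩ := exists_root_eq_vec b e hA hC (Or.inl rfl) hγ
      refine ⟨k ::ₘ k' ::ₘ m, ?_, by rw [Multiset.card_cons, Multiset.card_cons]; omega⟩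
      rw [Multiset.map_cons, Multiset.sum_cons, Multiset.map_cons, Multiset.sum_cons, hm, hk, hk',
        ← add_assoc, ← vec_add, ← vec_add, hsum, sub_add_cancel]

lemma isMinimalExpression_iff (i : I) (m : Multiset ι) :
    IsMinimalExpression P (vec b e (D.wt i)) m ↔
      (m.map P.root).sum = vec b e (D.wt i) ∧ Multiset.card m = D.colen i := by
  constructor
  · rintro ⟨h1, h2⟩
    obtain ⟨m', h3, h4⟩ := exists_card_eq_colen b e hA hκ hC D i
    exact ⟨h1, le_antisymm (h4 ▸ h2 m' h3) (colen_le_card b e hA hκ hC D h1)⟩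
  · rintro ⟨h1, h2⟩
    exact ⟨h1, fun m' hm' ↦ h2 ▸ colen_le_card b e hA hκ hC D hm'⟩

/-- The blocks of a minimal expression of a small dominant weight. -/
lemma blockOf_cases {i : I} {m : Multiset ι} {k : ι}
    (hm : IsMinimalExpression P (vec b e (D.wt i)) m) (hk : k ∈ m) :
    (∃ c d₀, (d₀ = 1 ∨ d₀ = 2) ∧ P.root k = vec b e c ∧ IsRootCoord A d d₀ c ∧
      blockOf P m k = {k} ∧ form A d (D.wt i) c = 2 * d₀) ∨
    ∃ k' c c', P.root k = vec b e c ∧ P.root k' = vec b e c' ∧ IsRootCoord A d 1 c ∧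
      IsRootCoord A d 1 c' ∧ form A d c c' = 1 ∧ blockOf P m k = {k, k'} ∧
      form A d (D.wt i) c = 3 ∧ form A d (D.wt i) c' = 3 := by
  classical
  choose C δ hδ hCv hCr using exists_isRootCoord b e hA hC
  have hκ0 := hκ.1
  have hRF : ∀ i j, P.RootForm (P.root i) (P.root j) = κ * form A d (C i) (C j) := fun i j ↦ by
    rw [hCv i, hCv j, rootForm_vec_vec b e hA hκ]
  have hformsum : ∀ (x : Fin n → ℤ) (m : Multiset ι),
      form A d x (m.map C).sum = (m.map fun j ↦ form A d x (C j)).sum := by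
    intro x m
    induction m using Multiset.induction_on with
    | empty => simp [form]
    | cons a m ih =>
      rw [Multiset.map_cons, Multiset.sum_cons, Multiset.map_cons, Multiset.sum_cons, ← ih]
      have : C a + (m.map C).sum = C a - (-1 : ℤ) • (m.map C).sum := by simp
      rw [this, form_sub_right, form_smul_right]; ring
  have hwt : D.wt i = (m.map C).sum := vec_injective b e (by
    rw [← hm.1, sum_eq_vec b e hA hκ hC m C hCv])
  have hnonneg : ∀ {a a' : ι} {m' : Multiset ι}, m = a ::ₘ a' ::ₘ m' →
      0 ≤ form A d (C a) (C a') := by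
    intro a a' m' h
    have h1 := hm.rootForm_nonneg h
    rw [hRF] at h1
    have := (mul_nonneg_iff_of_pos_left hκ0).mp h1
    exact_mod_cast this
  have hbound : ∀ a, form A d (C a) (D.wt i) ≤ δ a + 2 := fun a ↦ by
    rw [hC.form_comm]; exact form_wt_root_le b e hA hκ hC D (hδ a) (hCv a) (hCr a) i
  obtain ⟨m', rfl⟩ := Multiset.exists_cons_of_mem hk
  have hnn' : ∀ a ∈ m', 0 ≤ form A d (C k) (C a) := by
    intro a ha
    obtain ⟨m'', rfl⟩ := Multiset.exists_cons_of_mem ha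
    exact hnonneg rfl
  have hpos_iff : ∀ a, 0 < P.RootForm (P.root k) (P.root a) ↔ 0 < form A d (C k) (C a) := by
    intro a
    rw [hRF, mul_pos_iff_of_pos_left hκ0]
    exact_mod_cast Iff.rfl
  have hself : 0 < form A d (C k) (C k) := by
    rw [(hCr k).1]; rcases hδ k with h | h <;> rw [h] <;> norm_num
  have hblock : blockOf P (k ::ₘ m') k =
      k ::ₘ m'.filter fun a ↦ 0 < form A d (C k) (C a) := by
    have : ∀ m : Multiset ι, blockOf P m k = m.filter fun a ↦ 0 < form A d (C k) (C a) := by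
      intro m
      rw [blockOf]
      convert Multiset.filter_congr fun a _ ↦ hpos_iff a
    rw [this, Multiset.filter_cons_of_pos (p := fun a ↦ 0 < form A d (C k) (C a)) _ hself]
  -- The other terms contribute nonnegative integers, and the total is at most δ + 2, so they
  -- contribute at most 2 - δ. For δ = 2 this is nothing; for δ = 1 at most one of them contributes,
  -- and then exactly 1.
  have htot : form A d (C k) (D.wt i) = 2 * δ k +
      (m'.map fun a ↦ form A d (C k) (C a)).sum := by
    rw [hwt, hformsum, Multiset.map_cons, Multiset.sum_cons, (hCr k).1]
  by_cases hex : ∃ k' ∈ m', 0 < form A d (C k) (C k')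
  · right
    obtain ⟨k', hk', hpos⟩ := hex
    obtain ⟨m'', rfl⟩ := Multiset.exists_cons_of_mem hk'
    have hnn'' : ∀ x ∈ m''.map fun a ↦ form A d (C k) (C a), 0 ≤ x := by
      intro x hx
      obtain ⟨a, ha, rfl⟩ := Multiset.mem_map.mp hx
      exact hnn' a (Multiset.mem_cons_of_mem ha)
    have hs := Multiset.sum_nonneg hnn''
    rw [Multiset.map_cons, Multiset.sum_cons] at htot
    have h1 := hbound k
    have hd1 : δ k = 1 := by rcases hδ k with h | h <;> omega
    have hsum0 : (m''.map fun a ↦ form A d (C k) (C a)).sum = 0 := by omega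
    have hf1 : form A d (C k) (C k') = 1 := by omega
    -- Scalar products with a long root are even, so the partner is not long.
    have hd1' : δ k' = 1 := by
      rcases hδ k' with h | h
      · exact h
      · have := hC.dvd_form (hCr k').2 (C k)
        rw [h, hf1] at this
        omega
    have hz : ∀ a ∈ m'', form A d (C k) (C a) = 0 := by
      intro a ha
      refine le_antisymm ?_ (hnn' a (Multiset.mem_cons_of_mem ha))
      rw [← hsum0]
      exact Multiset.single_le_sum hnn'' _ (Multiset.mem_map_of_mem _ ha)
    have htot' : form A d (C k') (D.wt i) = 2 * δ k' + (form A d (C k') (C k) +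
        (m''.map fun a ↦ form A d (C k') (C a)).sum) := by
      rw [hwt, hformsum, Multiset.cons_swap, Multiset.map_cons, Multiset.sum_cons, (hCr k').1,
        Multiset.map_cons, Multiset.sum_cons]
    have hs' : 0 ≤ (m''.map fun a ↦ form A d (C k') (C a)).sum := by
      refine Multiset.sum_nonneg fun x hx ↦ ?_
      obtain ⟨a, ha, rfl⟩ := Multiset.mem_map.mp hx
      obtain ⟨m₃, rfl⟩ := Multiset.exists_cons_of_mem ha
      refine hnonneg (m' := k ::ₘ m₃) ?_
      rw [Multiset.cons_swap, Multiset.cons_swap k a]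
    have h2 := hbound k'
    have h3 := hC.form_comm (C k) (C k')
    refine ⟨k', C k, C k', hCv k, hCv k', hd1 ▸ hCr k, hd1' ▸ hCr k', hf1, ?_, ?_, ?_⟩
    · rw [hblock, Multiset.filter_cons_of_pos (p := fun a ↦ 0 < form A d (C k) (C a)) _ hpos,
        Multiset.filter_eq_nil.mpr]
      · rfl
      · intro a ha; rw [hz a ha]; exact lt_irrefl _
    · rw [hC.form_comm]; omega
    · rw [hC.form_comm]; omega
  · left
    push Not at hex
    refine ⟨C k, δ k, hδ k, hCv k, hCr k, ?_, ?_⟩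
    · rw [hblock, Multiset.filter_eq_nil.mpr]
      · rfl
      · intro a ha; exact not_lt.mpr (hex a ha)
    · have : (m'.map fun a ↦ form A d (C k) (C a)).sum = 0 := by
        refine Multiset.sum_eq_zero fun x hx ↦ ?_
        obtain ⟨a, ha, rfl⟩ := Multiset.mem_map.mp hx
        exact le_antisymm (hex a ha) (hnn' a ha)
      rw [hC.form_comm, htot, this, add_zero]

end Blocks


/-! ### Removing a block from a small weight, and adding one. -/

section BlockBounds

variable {ι V N : Type*} [Fintype ι] [AddCommGroup V] [Module ℝ V] [AddCommGroup N] [Module ℝ N]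
variable {P : RootPairing ι ℝ V N} [P.IsRootSystem] [P.IsCrystallographic] [P.IsReduced]
variable (b : P.Base) {n : ℕ} (e : b.support ≃ Fin n)

lemma blockHeight_eq {B : Multiset ι} {c : Fin n → ℤ} (hc : (B.map P.root).sum = vec b e c) :
    blockHeight b B = ∑ j, c j := by
  induction B using Multiset.induction_on generalizing c with
  | empty =>
    obtain rfl : c = 0 := vec_injective b e (by rw [← hc]; simp)
    simp [blockHeight]
  | cons a B ih =>
    obtain ⟨c', hc'⟩ := exists_vec_root b e a
    have h1 : (B.map P.root).sum = vec b e (c - c') := by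
      rw [vec_sub, ← hc, Multiset.map_cons, Multiset.sum_cons, hc', add_sub_cancel_left]
    have h2 := ih h1
    rw [blockHeight] at h2 ⊢
    rw [Multiset.map_cons, Multiset.sum_cons, h2, height_eq_of_root_eq_vec b e hc']
    simp

variable {A : Matrix (Fin n) (Fin n) ℤ} {d : Fin n → ℤ}
variable (hA : ∀ i j : b.support, b.cartanMatrix i j = A (e i) (e j))
variable {κ : ℝ} (hκ : IsScale b e hA d κ) (hC : IsCartan A d)
variable {I : Type} (D : SmallData A d I)
include hA hκ hC D

/-- Lying in the hull, λ - c is small, and its dominant conjugate is a listed weight q ≤ λ. Acting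
on expressions by the Weyl group shows that the co-length drops by exactly the number of terms of B.
So `pred_max` applies to q, and λ - c ≤ q. -/
lemma sub_le_wt_pred {i : I} {m B : Multiset ι} {c : Fin n → ℤ} {N : ℤ}
    (hmem : vec b e (D.wt i - c) ∈
      convexHull ℝ (MulAction.orbit P.weylGroup (vec b e (D.wt i))))
    (hm : (m.map P.root).sum = vec b e (D.wt i - c)) (hB : (B.map P.root).sum = vec b e c)
    (hcard : Multiset.card m + Multiset.card B = D.colen i) (hi : D.wt i ≠ 0)
    (hN : form A d (D.wt i) (D.wt i) = form A d (D.wt i - c) (D.wt i - c) + N)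
    (hcase : (Multiset.card B = 1 ∧ (N = 2 ∨ ((∃ j, d j = 2) ∧ N = 4))) ∨ (Multiset.card B = 2 ∧ N = 6)) :
    D.wt i - c ≤ D.wt (D.pred i) := by
  have hsmall : IsSmall P (vec b e (D.wt i - c)) :=
    ⟨(mem_rootLattice_iff b e _).mpr ⟨_, rfl⟩, fun k hk ↦
      (isSmall_vec_wt b e hA hκ hC D i).2 k (convexHull_orbit_subset hmem hk)⟩
  obtain ⟨q, w, hq⟩ := exists_smul_eq_vec_wt b e hA hκ hC D hsmall
  have hdom : ∀ i, IsDominant b (vec b e (D.wt i)) := fun i ↦ by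
    rw [isDominant_vec_iff b e hA]; exact D.dom _
  have hqi : D.wt q ≤ D.wt i := by
    rw [← coord_vec_le_iff b e, ← hq]
    exact (hdom i).coord_le_of_mem_convexHull b (smul_mem_convexHull_orbit w hmem)
  have hcq : D.wt i - c ≤ D.wt q := by
    rw [← coord_vec_le_iff b e]
    refine (hdom q).coord_le b ?_
    rw [← hq]
    exact MulAction.mem_orbit_symm.mp (MulAction.mem_orbit _ w)
  have hform : form A d (D.wt q) (D.wt q) = form A d (D.wt i - c) (D.wt i - c) := by
    have h1 := rootForm_smul_smul P w (vec b e (D.wt i - c)) (vec b e (D.wt i - c))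
    rw [hq, rootForm_vec_vec b e hA hκ, rootForm_vec_vec b e hA hκ] at h1
    exact_mod_cast mul_left_cancel₀ hκ.1.ne' h1
  have hle : D.colen q ≤ Multiset.card m := by
    obtain ⟨m', h1, h2⟩ := exists_expression_smul w m
    rw [hm, hq] at h2
    exact h1 ▸ colen_le_card b e hA hκ hC D h2
  have hge : D.colen i ≤ D.colen q + Multiset.card B := by
    obtain ⟨m₁, h1, h2⟩ := exists_card_eq_colen b e hA hκ hC D q
    obtain ⟨m', h3, h4⟩ := exists_expression_smul w⁻¹ m₁
    rw [h1, ← hq, inv_smul_smul] at h4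
    have := colen_le_card b e hA hκ hC D (i := i) (m := m' + B) (by
      rw [Multiset.map_add, Multiset.sum_add, h4, hB, ← vec_add, sub_add_cancel])
    rw [Multiset.card_add] at this
    omega
  refine hcq.trans (D.pred_max i q hi hqi ?_)
  rw [hform]
  rcases hcase with ⟨h1, h2 | ⟨h0, h2⟩⟩ | ⟨h1, h2⟩
  · exact Or.inl ⟨by omega, Or.inl (by omega)⟩
  · exact Or.inl ⟨by omega, Or.inr ⟨h0, by omega⟩⟩
  · exact Or.inr ⟨by omega, by omega⟩

lemma IsBlock.bound {i : I} {B : Multiset ι} (hB : IsBlock P (vec b e (D.wt i)) B) :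
    D.wt i ≠ 0 ∧ ∃ c, (B.map P.root).sum = vec b e c ∧ D.wt i - c ≤ D.wt (D.pred i) ∧
      ((∃ k d₀, (d₀ = 1 ∨ d₀ = 2) ∧ B = {k} ∧ IsRootCoord A d d₀ c ∧
        form A d (D.wt i) (D.wt i) = form A d (D.wt i - c) (D.wt i - c) + 2 * d₀) ∨
      (Multiset.card B = 2 ∧
        form A d (D.wt i) (D.wt i) = form A d (D.wt i - c) (D.wt i - c) + 6)) := by
  classical
  obtain ⟨m, hm, k, hk, rfl⟩ := hB
  have hi : D.wt i ≠ 0 := by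
    intro h0
    have h1 := ((isMinimalExpression_iff b e hA hκ hC D i m).mp hm).2
    rw [D.colen_zero i h0, Multiset.card_eq_zero] at h1
    simp [h1] at hk
  refine ⟨hi, ?_⟩
  have hle : blockOf P m k ≤ m := Multiset.filter_le _ _
  obtain ⟨m', hm'⟩ := Multiset.le_iff_exists_add.mp hle
  obtain ⟨hsum, hcard⟩ := (isMinimalExpression_iff b e hA hκ hC D i m).mp hm
  have hsub : ∀ c, ((blockOf P m k).map P.root).sum = vec b e c →
      (m'.map P.root).sum = vec b e (D.wt i - c) := by
    intro c hc
    rw [vec_sub, ← hsum, ← hc, eq_sub_iff_add_eq', ← Multiset.sum_add, ← Multiset.map_add, ← hm']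
  have hcard' : Multiset.card m' + Multiset.card (blockOf P m k) = D.colen i := by
    rw [← hcard, hm', Multiset.card_add, add_comm, ← hm']
  -- Since (x, β) ≥ d₀ means ⟨x, β^∨⟩ ≥ 1, the vector x - β is on the segment from x to its
  -- reflection. A block {β, γ} is removed by doing this twice; the second time the scalar product
  -- is 3 - 1 = 2.
  have hpos : ∀ {k c d₀}, (d₀ = 1 ∨ d₀ = 2) → P.root k = vec b e c → IsRootCoord A d d₀ c →
      ∀ x, d₀ ≤ form A d x c → vec b e (x - c) ∈
        convexHull ℝ (MulAction.orbit P.weylGroup (vec b e x)) := by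
    intro k c d₀ hd₀ hk hc x hx
    rw [vec_sub, ← hk, ← one_smul ℝ (P.root k)]
    refine sub_smul_root_mem_convexHull zero_le_one ?_
    have h1 := coroot'_root_vec b e hA hκ hC hk hc x
    have h2 : (0 : ℝ) < d₀ := by rcases hd₀ with h | h <;> rw [h] <;> norm_num
    have h3 : (d₀ : ℝ) ≤ form A d x c := by exact_mod_cast hx
    rw [← h1] at h3
    exact (le_mul_iff_one_le_left h2).mp h3
  rcases blockOf_cases b e hA hκ hC D hm hk with
    ⟨c, d₀, hd₀, hkc, hc, hblock, hf⟩ | ⟨k', c, c', hkc, hkc', hc, hc', hcc, hblock, hf, hf'⟩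
  · have hs : ((blockOf P m k).map P.root).sum = vec b e c := by rw [hblock]; simpa using hkc
    have hN : form A d (D.wt i) (D.wt i) =
        form A d (D.wt i - c) (D.wt i - c) + 2 * d₀ := by
      rw [hC.form_sub_sub, hf, hc.1]; ring
    refine ⟨c, hs, ?_, Or.inl ⟨k, d₀, hd₀, hblock, hc, hN⟩⟩
    refine sub_le_wt_pred b e hA hκ hC D (hpos hd₀ hkc hc _ ?_) (hsub c hs) hs hcard' hi hN ?_
    · rcases hd₀ with h | h <;> omega
    · left
      rw [hblock]
      refine ⟨rfl, ?_⟩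
      rcases hd₀ with rfl | rfl
      · exact Or.inl rfl
      · exact Or.inr ⟨hC.exists_d_eq_two hc, rfl⟩
  · have hs : ((blockOf P m k).map P.root).sum = vec b e (c + c') := by
      rw [hblock, vec_add, ← hkc, ← hkc']; simp
    have hsub2 : D.wt i - (c + c') = D.wt i - c - c' := by abel
    have hN : form A d (D.wt i) (D.wt i) =
        form A d (D.wt i - (c + c')) (D.wt i - (c + c')) + 6 := by
      rw [hsub2, hC.form_sub_sub, hC.form_sub_sub, form_sub_left, hf, hf', hcc, hc.1, hc'.1]; ring
    have hcardB : Multiset.card (blockOf P m k) = 2 := by rw [hblock]; rfl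
    refine ⟨c + c', hs, ?_, Or.inr ⟨hcardB, hN⟩⟩
    refine sub_le_wt_pred b e hA hκ hC D ?_ (hsub _ hs) hs hcard' hi hN (Or.inr ⟨hcardB, rfl⟩)
    rw [hsub2]
    refine convexHull_orbit_subset (hpos (Or.inl rfl) hkc hc (D.wt i) (by omega))
      (hpos (Or.inl rfl) hkc' hc' (D.wt i - c) ?_)
    rw [form_sub_left, hf', hcc]; norm_num

lemma IsBlock.height_ge {i : I} {B : Multiset ι} (hB : IsBlock P (vec b e (D.wt i)) B) :
    ∑ j, (D.wt i - D.wt (D.pred i)) j ≤ blockHeight b B := by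
  obtain ⟨-, c, hc, hle, -⟩ := hB.bound b e hA hκ hC D
  rw [blockHeight_eq b e hc]
  refine Finset.sum_le_sum fun j _ ↦ ?_
  have := hle j
  simp only [Pi.sub_apply] at this ⊢
  omega

/-- A minimal expression of `x` can be extended by a block to a minimal expression of `y`. -/
lemma IsBlockDecomposition.append {i : I} {L : List (Multiset ι)}
    (hL : IsBlockDecomposition P (vec b e (D.wt (D.pred i))) L) {B : Multiset ι}
    (hsum : (B.map P.root).sum = vec b e (D.wt i - D.wt (D.pred i)))
    (hcard : D.colen i = D.colen (D.pred i) + Multiset.card B)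
    (hform : form A d (D.wt i - D.wt (D.pred i)) (D.wt (D.pred i)) = 0)
    (hne : B ≠ 0) (hpos : ∀ k ∈ B, ∀ k' ∈ B, 0 < P.RootForm (P.root k) (P.root k')) :
    IsBlockDecomposition P (vec b e (D.wt i)) (L ++ [B]) := by
  classical
  obtain ⟨m, hm, hnd, hblocks⟩ := hL
  obtain ⟨hs, hc⟩ := (isMinimalExpression_iff b e hA hκ hC D _ m).mp hm
  have hmin : IsMinimalExpression P (vec b e (D.wt i)) (B + m) := by
    rw [isMinimalExpression_iff b e hA hκ hC D]
    rw [Multiset.map_add, Multiset.sum_add, hsum, hs, ← vec_add, sub_add_cancel, Multiset.card_add]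
    exact ⟨rfl, by omega⟩
  have hnn : ∀ k ∈ B, ∀ k' ∈ m, 0 ≤ P.RootForm (P.root k) (P.root k') := by
    intro k hk k' hk'
    obtain ⟨B', rfl⟩ := Multiset.exists_cons_of_mem hk
    obtain ⟨m', rfl⟩ := Multiset.exists_cons_of_mem hk'
    refine hmin.rootForm_nonneg (m' := B' + m') ?_
    rw [Multiset.cons_add, Multiset.add_cons]
  have hsum2 : ∀ (B m : Multiset ι),
      P.RootForm (B.map P.root).sum (m.map P.root).sum =
        (B.map fun k ↦ (m.map fun k' ↦ P.RootForm (P.root k) (P.root k')).sum).sum := by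
    intro B m
    rw [map_multiset_sum, Multiset.map_map]
    induction B using Multiset.induction_on with
    | empty => simp
    | cons a B ih =>
      simp only [Multiset.map_cons, Multiset.sum_cons, map_add]
      rw [← ih, ← Multiset.sum_map_add]
      rfl
  -- By minimality of the joint expression all these scalar products are nonnegative, and their sum
  -- is (λ - `pred`, `pred`) = 0. Hence B is separated from the old blocks.
  have hzero : ∀ k ∈ B, ∀ k' ∈ m, P.RootForm (P.root k) (P.root k') = 0 := by
    have h0 : P.RootForm (B.map P.root).sum (m.map P.root).sum = 0 := by
      rw [hsum, hs, rootForm_vec_vec b e hA hκ, hform]; simp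
    rw [hsum2] at h0
    have hinner : ∀ k ∈ B, 0 ≤ (m.map fun k' ↦ P.RootForm (P.root k) (P.root k')).sum := by
      intro k hk
      refine Multiset.sum_nonneg fun x hx ↦ ?_
      obtain ⟨k', hk', rfl⟩ := Multiset.mem_map.mp hx
      exact hnn k hk k' hk'
    intro k hk k' hk'
    refine le_antisymm ?_ (hnn k hk k' hk')
    have h1 : (m.map fun k' ↦ P.RootForm (P.root k) (P.root k')).sum ≤ 0 := by
      rw [← h0]
      exact Multiset.single_le_sum (fun x hx ↦ by
        obtain ⟨k, hk, rfl⟩ := Multiset.mem_map.mp hx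
        exact hinner k hk) _ (Multiset.mem_map_of_mem _ hk)
    refine le_trans ?_ h1
    exact Multiset.single_le_sum (fun x hx ↦ by
        obtain ⟨k', hk', rfl⟩ := Multiset.mem_map.mp hx
        exact hnn k hk k' hk') _ (Multiset.mem_map_of_mem _ hk')
  have hb1 : ∀ k ∈ B, blockOf P (B + m) k = B := by
    intro k hk
    rw [blockOf, Multiset.filter_add, Multiset.filter_eq_self.mpr, Multiset.filter_eq_nil.mpr,
      add_zero]
    · intro k' hk'; rw [hzero k hk k' hk']; exact lt_irrefl _
    · exact hpos k hk
  have hb2 : ∀ k ∈ m, blockOf P (B + m) k = blockOf P m k := by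
    intro k hk
    rw [blockOf, Multiset.filter_add, Multiset.filter_eq_nil.mpr, zero_add, blockOf]
    intro k' hk'
    rw [rootForm_comm, hzero k' hk' k hk]; exact lt_irrefl _
  refine ⟨B + m, hmin, ?_, fun B' ↦ ?_⟩
  · rw [List.nodup_append]
    refine ⟨hnd, List.nodup_singleton _, ?_⟩
    rintro B₁ hB₁ B₂ hB₂ rfl
    obtain rfl := List.mem_singleton.mp hB₂
    obtain ⟨k, hk, hkB⟩ := (hblocks B₁).mp hB₁
    obtain ⟨k', hk'⟩ := Multiset.exists_mem_of_ne_zero hne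
    have h1 : k' ∈ m := by
      rw [hkB] at hk'
      exact Multiset.mem_of_le (Multiset.filter_le _ _) hk'
    have h2 := hpos k' hk' k' hk'
    rw [hzero k' hk' k' h1] at h2
    exact lt_irrefl _ h2
  · rw [List.mem_append, List.mem_singleton, hblocks]
    constructor
    · rintro (⟨k, hk, rfl⟩ | rfl)
      · exact ⟨k, Multiset.mem_add.mpr (Or.inr hk), (hb2 k hk).symm⟩
      · obtain ⟨k, hk⟩ := Multiset.exists_mem_of_ne_zero hne
        exact ⟨k, Multiset.mem_add.mpr (Or.inl hk), (hb1 k hk).symm⟩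
    · rintro ⟨k, hk, rfl⟩
      rcases Multiset.mem_add.mp hk with hk | hk
      · exact Or.inr (hb1 k hk)
      · exact Or.inl ⟨k, hk, hb2 k hk⟩

end BlockBounds


/-! ### Canonical decompositions, uniqueness of symbols and the reduction to a finite poset. -/

section Canonical

variable {ι V N : Type*} [Fintype ι] [AddCommGroup V] [Module ℝ V] [AddCommGroup N] [Module ℝ N]
variable {P : RootPairing ι ℝ V N} [P.IsRootSystem] [P.IsCrystallographic] [P.IsReduced]
variable (b : P.Base) {n : ℕ} (e : b.support ≃ Fin n)
variable {A : Matrix (Fin n) (Fin n) ℤ} {d : Fin n → ℤ}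
variable (hA : ∀ i j : b.support, b.cartanMatrix i j = A (e i) (e j))
variable {κ : ℝ} (hκ : IsScale b e hA d κ) (hC : IsCartan A d)
include hA hκ hC

lemma isSimplyLaced_of_forall (hd : ∀ j, d j = 1) : IsSimplyLaced P := by
  have key : ∀ k, P.RootForm (P.root k) (P.root k) = 2 * κ := by
    intro k
    obtain ⟨c, d₀, hd₀, hk, hc⟩ := exists_isRootCoord b e hA hC k
    rw [rootForm_root_self b e hA hκ hC hk hc]
    rcases hd₀ with rfl | rfl
    · simp
    · obtain ⟨j, hj⟩ := hC.exists_d_eq_two hc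
      rw [hd j] at hj
      norm_num at hj
  intro i j
  rw [key, key]

lemma isShort_of_isRootCoord (hd : ∃ j, d j = 2) {k : ι} {c : Fin n → ℤ}
    (hk : P.root k = vec b e c) (hc : IsRootCoord A d 1 c) : IsShort P k := by
  obtain ⟨j, hj⟩ := hd
  refine ⟨e.symm j, ?_⟩
  have h1 := hC.isRootCoord_single j
  rw [rootForm_root_self b e hA hκ hC hk hc,
    rootForm_root_self b e hA hκ hC (vec_single b e j).symm h1, hj]
  have := hκ.1
  push_cast
  linarith

lemma label_unique {B : Multiset ι} {l l' : BlockLabel} (h : HasLabel P B l)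
    (h' : HasLabel P B l') : l = l' := by
  have aux : ∀ i, IsShort P i → IsLong P i → False := by
    rintro i ⟨j, hj⟩ ⟨k, hk⟩
    obtain ⟨ci, di, hdi, hi, hci⟩ := exists_isRootCoord b e hA hC i
    obtain ⟨cj, dj, hdj, hj', hcj⟩ := exists_isRootCoord b e hA hC j
    obtain ⟨ck, dk, hdk, hk', hck⟩ := exists_isRootCoord b e hA hC k
    rw [rootForm_root_self b e hA hκ hC hi hci] at hj hk
    rw [rootForm_root_self b e hA hκ hC hj' hcj] at hj
    rw [rootForm_root_self b e hA hκ hC hk' hck] at hk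
    have hκ0 := hκ.1
    have h1 : (di : ℝ) < dj := lt_of_mul_lt_mul_left hj (by positivity)
    have h2 : (dk : ℝ) < di := lt_of_mul_lt_mul_left hk (by positivity)
    have h3 : di < dj := by exact_mod_cast h1
    have h4 : dk < di := by exact_mod_cast h2
    omega
  have hs : ∀ i, IsSimplyLaced P → ¬ IsShort P i := by
    rintro i h ⟨j, hj⟩
    exact hj.ne (h i j)
  have hl : ∀ i, IsSimplyLaced P → ¬ IsLong P i := by
    rintro i h ⟨j, hj⟩
    exact hj.ne (h j i)
  cases l <;> cases l' <;> simp only [HasLabel] at h h' <;> try rfl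
  · obtain ⟨i, -, hi⟩ := h'; exact absurd hi (hs i h.1)
  · obtain ⟨i, -, hi⟩ := h'; exact absurd hi (hl i h.1)
  · omega
  · obtain ⟨i, -, hi⟩ := h; exact absurd hi (hs i h'.1)
  · obtain ⟨i, rfl, hi⟩ := h
    obtain ⟨j, hj, hj'⟩ := h'
    obtain rfl := Multiset.singleton_inj.mp hj
    exact absurd hj' (fun h ↦ aux i hi h)
  · obtain ⟨i, rfl, hi⟩ := h; simp at h'
  · obtain ⟨i, -, hi⟩ := h; exact absurd hi (hl i h'.1)
  · obtain ⟨i, rfl, hi⟩ := h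
    obtain ⟨j, hj, hj'⟩ := h'
    obtain rfl := Multiset.singleton_inj.mp hj
    exact absurd hi (fun h ↦ aux i hj' h)
  · obtain ⟨i, rfl, hi⟩ := h; simp at h'
  · omega
  · obtain ⟨i, rfl, hi⟩ := h'; simp at h
  · obtain ⟨i, rfl, hi⟩ := h'; simp at h

variable {I : Type} (D : SmallData A d I)
include D

lemma isLong_of_isRootCoord {k : ι} {c : Fin n → ℤ}
    (hk : P.root k = vec b e c) (hc : IsRootCoord A d 2 c) : IsLong P k := by
  obtain ⟨j, hj⟩ := exists_root_eq_vec b e hA hC (Or.inl rfl) D.root_short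
  refine ⟨j, ?_⟩
  rw [rootForm_root_self b e hA hκ hC hk hc, rootForm_root_self b e hA hκ hC hj D.root_short]
  have := hκ.1
  push_cast
  linarith

lemma exists_extension {i : I} (hi : D.wt i ≠ 0) :
    ∃ B : Multiset ι, (B.map P.root).sum = vec b e (D.wt i - D.wt (D.pred i)) ∧
      ∀ L, IsBlockDecomposition P (vec b e (D.wt (D.pred i))) L →
        IsBlockDecomposition P (vec b e (D.wt i)) (L ++ [B]) := by
  have hκ0 := hκ.1
  have hstep := D.step i hi
  -- If the square length of λ exceeds that of `pred` by that of λ - `pred`, the latter two are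
  -- orthogonal.
  have hform : ∀ N, form A d (D.wt i) (D.wt i) =
      form A d (D.wt (D.pred i)) (D.wt (D.pred i)) + N →
      form A d (D.wt i - D.wt (D.pred i)) (D.wt i - D.wt (D.pred i)) = N →
      form A d (D.wt i - D.wt (D.pred i)) (D.wt (D.pred i)) = 0 := by
    intro N h1 h2
    rw [hC.form_sub_sub] at h2
    rw [form_sub_left]
    omega
  have single : ∀ d₀ : ℤ, (d₀ = 1 ∨ d₀ = 2) →
      IsRootCoord A d d₀ (D.wt i - D.wt (D.pred i)) → D.colen i = D.colen (D.pred i) + 1 →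
      form A d (D.wt i) (D.wt i) = form A d (D.wt (D.pred i)) (D.wt (D.pred i)) + 2 * d₀ →
      ∃ B : Multiset ι, (B.map P.root).sum = vec b e (D.wt i - D.wt (D.pred i)) ∧
        ∀ L, IsBlockDecomposition P (vec b e (D.wt (D.pred i))) L →
          IsBlockDecomposition P (vec b e (D.wt i)) (L ++ [B]) := by
    intro d₀ hd₀ hc hcol hN
    obtain ⟨k, hk⟩ := exists_root_eq_vec b e hA hC hd₀ hc
    have hs : (({k} : Multiset ι).map P.root).sum = vec b e (D.wt i - D.wt (D.pred i)) := by
      simpa using hk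
    refine ⟨{k}, hs, fun L hL ↦ ?_⟩
    refine hL.append b e hA hκ hC D hs (by simpa using hcol) (hform _ hN hc.1) (by simp) ?_
    intro k₁ hk₁ k₂ hk₂
    rw [Multiset.mem_singleton] at hk₁ hk₂
    subst hk₁ hk₂
    exact rootForm_root_pos P _
  cases hl : D.label i with
  | one => rw [hl] at hstep; exact single 1 (Or.inl rfl) hstep.2.1 hstep.2.2.1 hstep.2.2.2
  | oneShort => rw [hl] at hstep; exact single 1 (Or.inl rfl) hstep.2.1 hstep.2.2.1 hstep.2.2.2
  | oneLong => rw [hl] at hstep; exact single 2 (Or.inr rfl) hstep.2.1 hstep.2.2.1 hstep.2.2.2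
  | two =>
    rw [hl] at hstep
    obtain ⟨⟨β, γ, hβ, hγ, hβγ, hsum⟩, hcol, hN⟩ := hstep
    obtain ⟨k, hk⟩ := exists_root_eq_vec b e hA hC (Or.inl rfl) hβ
    obtain ⟨k', hk'⟩ := exists_root_eq_vec b e hA hC (Or.inl rfl) hγ
    have hs : (({k, k'} : Multiset ι).map P.root).sum = vec b e (D.wt i - D.wt (D.pred i)) := by
      rw [← hsum, vec_add, ← hk, ← hk']; simp
    have h6 : form A d (D.wt i - D.wt (D.pred i)) (D.wt i - D.wt (D.pred i)) = 6 := by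
      rw [← hsum]
      have : β + γ = β - (-1 : ℤ) • γ := by simp
      rw [this, hC.form_sub_sub, form_smul_right, form_smul_right, form_smul_left, hβ.1, hγ.1, hβγ]
      norm_num
    have hkk' : 0 < P.RootForm (P.root k) (P.root k') := by
      rw [hk, hk', rootForm_vec_vec b e hA hκ, hβγ]; simpa using hκ0
    refine ⟨{k, k'}, hs, fun L hL ↦ ?_⟩
    refine hL.append b e hA hκ hC D hs (by simpa using hcol) (hform _ hN h6) (by simp) ?_
    intro k₁ hk₁ k₂ hk₂
    simp only [Multiset.insert_eq_cons, Multiset.mem_cons, Multiset.mem_singleton] at hk₁ hk₂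
    rcases hk₁ with rfl | rfl <;> rcases hk₂ with rfl | rfl
    · exact rootForm_root_pos P _
    · exact hkk'
    · rw [rootForm_comm]; exact hkk'
    · exact rootForm_root_pos P _

lemma colen_pred_lt {i : I} (hi : D.wt i ≠ 0) : D.colen (D.pred i) < D.colen i := by
  have hstep := D.step i hi
  cases hl : D.label i <;> rw [hl] at hstep
  · have := hstep.2.2.1; omega
  · have := hstep.2.2.1; omega
  · have := hstep.2.2.1; omega
  · have := hstep.2.1; omega

lemma exists_isCanonical (i : I) :
    ∃ L, IsCanonical b (vec b e (D.wt i)) L ∧ IsBlockDecomposition P (vec b e (D.wt i)) L := by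
  induction hN : D.colen i using Nat.strong_induction_on generalizing i with
  | _ N ih =>
    by_cases hi : D.wt i = 0
    · rw [hi, vec_zero]
      refine ⟨[], .zero, 0, ⟨by simp, fun _ _ ↦ Nat.zero_le _⟩, List.nodup_nil, fun B ↦ ?_⟩
      simp [IsBlockIn]
    · obtain ⟨L, hL, hdec⟩ := ih _ (hN ▸ colen_pred_lt b e hA hκ hC D hi) (D.pred i) rfl
      obtain ⟨B, hB, hext⟩ := exists_extension b e hA hκ hC D hi
      refine ⟨L ++ [B], .snoc _ _ _ (hext L hdec) ?_ ?_, hext L hdec⟩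
      · intro B' hB'
        rw [blockHeight_eq b e hB]
        exact hB'.height_ge b e hA hκ hC D
      · rw [hB, ← vec_sub, sub_sub_cancel]; exact hL

/-- The block from `exists_extension` has sum λ - `pred`, so the chosen last block is no higher.
Since its sum is coordinatewise at least λ - `pred`, the two sums agree. The label follows from the
drop 2, 4 or 6 of the square length, although the block itself need not be unique. -/
lemma IsCanonical.inversion {i : I} {L : List (Multiset ι)}
    (h : IsCanonical b (vec b e (D.wt i)) L) :
    (D.wt i = 0 ∧ L = []) ∨ (D.wt i ≠ 0 ∧ ∃ L' B, L = L' ++ [B] ∧ HasLabel P B (D.label i) ∧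
      (B.map P.root).sum = vec b e (D.wt i - D.wt (D.pred i)) ∧
      IsCanonical b (vec b e (D.wt (D.pred i))) L') := by
  generalize hv : vec b e (D.wt i) = v at h
  cases h with
  | zero =>
    left
    exact ⟨vec_injective b e (by rw [hv, vec_zero]), rfl⟩
  | snoc _ L B hdecomp hmin hrest =>
    subst hv
    right
    obtain ⟨m, hm, hnd, hblocks⟩ := hdecomp
    have hB : IsBlock P (vec b e (D.wt i)) B := ⟨m, hm, (hblocks B).mp (by simp)⟩
    obtain ⟨hi, c, hc, hle, hcase⟩ := hB.bound b e hA hκ hC D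
    obtain ⟨B₀, hB₀, hext⟩ := exists_extension b e hA hκ hC D hi
    obtain ⟨L₀, -, hL₀⟩ := exists_isCanonical b e hA hκ hC D (D.pred i)
    have hB₀' : IsBlock P (vec b e (D.wt i)) B₀ := by
      obtain ⟨m₀, hm₀, -, hblocks₀⟩ := hext L₀ hL₀
      exact ⟨m₀, hm₀, (hblocks₀ B₀).mp (by simp)⟩
    have hht := hmin B₀ hB₀'
    rw [blockHeight_eq b e hc, blockHeight_eq b e hB₀] at hht
    have hle' : ∀ j, (D.wt i - D.wt (D.pred i)) j ≤ c j := fun j ↦ by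
      have := hle j
      simp only [Pi.sub_apply] at this ⊢
      omega
    have hceq : c = D.wt i - D.wt (D.pred i) := by
      ext j
      have := (Finset.sum_eq_sum_iff_of_le fun j _ ↦ hle' j).mp
        (le_antisymm (Finset.sum_le_sum fun j _ ↦ hle' j) hht) j (Finset.mem_univ j)
      exact this.symm
    refine ⟨hi, L, B, rfl, ?_, hceq ▸ hc, ?_⟩
    · have hstep := D.step i hi
      have hsub : D.wt i - c = D.wt (D.pred i) := by rw [hceq, sub_sub_cancel]
      rw [hsub] at hcase
      rcases hcase with ⟨k, d₀, hd₀, rfl, hck, hN⟩ | ⟨hcard, hN⟩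
      · have hk : P.root k = vec b e c := by simpa using hc
        cases hl : D.label i <;> rw [hl] at hstep
        · exact ⟨isSimplyLaced_of_forall b e hA hκ hC hstep.1, by simp⟩
        · have h1 := hstep.2.2.2
          obtain rfl : d₀ = 1 := by omega
          exact ⟨k, rfl, isShort_of_isRootCoord b e hA hκ hC hstep.1 hk hck⟩
        · have h1 := hstep.2.2.2
          obtain rfl : d₀ = 2 := by omega
          exact ⟨k, rfl, isLong_of_isRootCoord b e hA hκ hC D hk hck⟩
        · have h1 := hstep.2.2
          omega
      · cases hl : D.label i <;> rw [hl] at hstep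
        · have h1 := hstep.2.2.2; omega
        · have h1 := hstep.2.2.2; omega
        · have h1 := hstep.2.2.2; omega
        · exact hcard
    · rw [hc, ← vec_sub, hceq, sub_sub_cancel] at hrest
      exact hrest

lemma IsCanonical.forall₂_hasLabel {i : I} {L : List (Multiset ι)}
    (h : IsCanonical b (vec b e (D.wt i)) L) : List.Forall₂ (HasLabel P) L (D.labels i) := by
  induction hN : D.colen i using Nat.strong_induction_on generalizing i L with
  | _ N ih =>
    rcases h.inversion b e hA hκ hC D with ⟨hi, rfl⟩ | ⟨hi, L', B, rfl, hB, -, hL'⟩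
    · rw [D.labels_zero i hi]; exact .nil
    · rw [D.labels_pred i hi]
      exact List.rel_append (ih _ (hN ▸ colen_pred_lt b e hA hκ hC D hi) hL' rfl) (.cons hB .nil)

omit D in
lemma forall₂_hasLabel_unique {L : List (Multiset ι)} {w w' : List BlockLabel}
    (h : List.Forall₂ (HasLabel P) L w) (h' : List.Forall₂ (HasLabel P) L w') : w = w' := by
  induction h generalizing w' with
  | nil => cases h'; rfl
  | cons hl _ ih =>
    cases h' with
    | cons hl' ht' => rw [label_unique b e hA hκ hC hl hl', ih ht']

lemma labels_eq_of_isOneOne {i : I} {L : List (Multiset ι)}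
    (h : IsCanonical b (vec b e (D.wt i)) L) (h1 : IsOneOne P L) :
    D.labels i = [.one, .one] := by
  obtain ⟨hsl, k, k', rfl, -⟩ := h1
  refine forall₂_hasLabel_unique b e hA hκ hC (h.forall₂_hasLabel b e hA hκ hC D)
    (.cons ⟨hsl, by simp⟩ (.cons ⟨hsl, by simp⟩ .nil))

lemma exists_eq_pair_of_labels_eq {i : I} {L : List (Multiset ι)}
    (h : IsCanonical b (vec b e (D.wt i)) L) (hl : D.labels i = [.one, .one]) :
    ∃ k k', L = [{k}, {k'}] ∧ P.root k = vec b e (D.wt (D.pred i)) ∧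
      P.root k' = vec b e (D.wt i - D.wt (D.pred i)) ∧ (∀ j, d j = 1) ∧
      IsRootCoord A d 1 (D.wt i - D.wt (D.pred i)) := by
  rcases h.inversion b e hA hκ hC D with ⟨hi, -⟩ | ⟨hi, L', B, rfl, hB, hs, hL'⟩
  · rw [D.labels_zero i hi] at hl; simp at hl
  rw [D.labels_pred i hi] at hl
  obtain ⟨hl₁, hl₂⟩ := List.append_inj' (t₁ := [D.label i]) (t₂ := [.one]) (s₂ := [.one]) hl rfl
  simp only [List.cons.injEq, and_true] at hl₂
  rcases hL'.inversion b e hA hκ hC D with ⟨hp, -⟩ | ⟨hp, L'', B', rfl, hB', hs', hL''⟩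
  · rw [D.labels_zero _ hp] at hl₁; simp at hl₁
  rw [D.labels_pred _ hp] at hl₁
  obtain ⟨hl₃, hl₄⟩ := List.append_inj' (t₁ := [D.label (D.pred i)]) (t₂ := [.one]) (s₂ := []) hl₁ rfl
  simp only [List.cons.injEq, and_true] at hl₄
  rcases hL''.inversion b e hA hκ hC D with ⟨hpp, rfl⟩ | ⟨hpp, -⟩
  swap
  · rw [D.labels_pred _ hpp] at hl₃; simp at hl₃
  have hstep := D.step i hi
  rw [hl₂] at hB hstep
  rw [hl₄] at hB'
  obtain ⟨k', rfl⟩ := Multiset.card_eq_one.mp hB.2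
  obtain ⟨k, rfl⟩ := Multiset.card_eq_one.mp hB'.2
  rw [hpp, sub_zero] at hs'
  exact ⟨k, k', rfl, by simpa using hs', by simpa using hs, hstep.1, hstep.2.1⟩

/-- In a simply laced system the scalar product of a root with B₂ is 0, ±1 or ±2, and ±2 occurs only
for ±B₂. So the component of B₂ in the roots orthogonal to B₁ is A₁ exactly when ±1 does not occur
there, which is what `sym_spec` decides. -/
lemma isSymbolOfBlocks_iff {i : I} {L : List (Multiset ι)}
    (h : IsCanonical b (vec b e (D.wt i)) L) (s : WeightSymbol) :
    IsSymbolOfBlocks P L s ↔ s = D.sym i := by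
  have hforall := h.forall₂_hasLabel b e hA hκ hC D
  have hκ0 := hκ.1
  rcases D.sym_spec i with ⟨hs, hnot⟩ | ⟨hs, hl, heven⟩
  · have hone : ¬ IsOneOne P L := by
      intro h1
      have hl := labels_eq_of_isOneOne b e hA hκ hC D h h1
      obtain ⟨c, hc, hcp, hcβ⟩ := hnot.resolve_left (not_not.mpr hl)
      obtain ⟨k, k', rfl, hk, hk', -, hβ⟩ := exists_eq_pair_of_labels_eq b e hA hκ hC D h hl
      obtain ⟨-, i₁, i₂, hL, hcomp⟩ := h1
      obtain ⟨k₀, hk₀⟩ := exists_root_eq_vec b e hA hC (Or.inl rfl) hc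
      simp only [List.cons.injEq, Multiset.singleton_inj, and_true] at hL
      obtain ⟨rfl, rfl⟩ := hL
      have h2 := hcomp k₀ (by rw [hk₀, hk, rootForm_vec_vec b e hA hκ, hcp]; simp)
      rw [hk₀, hk', rootForm_vec_vec b e hA hκ, hcβ, ← vec_neg] at h2
      rcases h2 with h2 | h2 | h2
      · rw [← vec_injective b e h2, hc.1] at hcβ; omega
      · rw [← neg_eq_iff_eq_neg.mpr (vec_injective b e h2), ← neg_one_smul ℤ c, form_smul_right,
          hc.1] at hcβ
        omega
      · simp at h2; exact hκ0.ne' h2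
    rw [hs]
    cases s with
    | word w =>
      simp only [IsSymbolOfBlocks, WeightSymbol.word.injEq]
      constructor
      · rintro ⟨-, hw⟩
        exact forall₂_hasLabel_unique b e hA hκ hC hw hforall
      · rintro rfl
        exact ⟨hone, hforall⟩
    | oneOne => simp [IsSymbolOfBlocks, hone]
  · have hone : IsOneOne P L := by
      obtain ⟨k, k', rfl, hk, hk', hd, hβ⟩ := exists_eq_pair_of_labels_eq b e hA hκ hC D h hl
      refine ⟨isSimplyLaced_of_forall b e hA hκ hC hd, k, k', rfl, fun k₀ hk₀ ↦ ?_⟩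
      obtain ⟨c, d₀, hd₀, hc, hcr⟩ := exists_isRootCoord b e hA hC k₀
      obtain rfl : d₀ = 1 := by
        rcases hd₀ with rfl | rfl
        · rfl
        · obtain ⟨j, hj⟩ := hC.exists_d_eq_two hcr
          rw [hd j] at hj; norm_num at hj
      rw [hc, hk, rootForm_vec_vec b e hA hκ, mul_eq_zero_iff_left hκ0.ne'] at hk₀
      have h2 := heven c (by exact_mod_cast hk₀)
      rw [hc, hk', rootForm_vec_vec b e hA hκ, ← vec_neg]
      set β := D.wt i - D.wt (D.pred i)
      have h3 : form A d (c - β) (c - β) = 4 - 2 * form A d c β := by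
        rw [hC.form_sub_sub, hcr.1, hβ.1]; ring
      have h4 : form A d (c - -β) (c - -β) = 4 + 2 * form A d c β := by
        rw [hC.form_sub_sub, hcr.1, (hC.isRootCoord_neg hβ).1, ← neg_one_smul ℤ β,
          form_smul_right]
        ring
      rcases lt_trichotomy (form A d c β) 0 with h5 | h5 | h5
      · right; left
        by_contra hne
        have := hC.pos (c - -β) (fun h0 ↦ hne (by rw [sub_eq_zero.mp h0]))
        omega
      · right; right; rw [h5]; simp
      · left
        by_contra hne
        have := hC.pos (c - β) (fun h0 ↦ hne (by rw [sub_eq_zero.mp h0]))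
        omega
    rw [hs]
    cases s with
    | word w => simp [IsSymbolOfBlocks, hone]
    | oneOne => simp [IsSymbolOfBlocks, hone]

lemma hasSymbol_orbit_iff (i : I) (s : WeightSymbol) :
    HasSymbol b (MulAction.orbit P.weylGroup (vec b e (D.wt i))) s ↔ s = D.sym i := by
  have hdom : IsDominant b (vec b e (D.wt i)) := by
    rw [isDominant_vec_iff b e hA]; exact D.dom _
  constructor
  · rintro ⟨v, hv, hvd, L, hL, hs⟩
    rw [hdom.eq_of_mem_orbit b hvd hv] at hL
    exact (isSymbolOfBlocks_iff b e hA hκ hC D hL s).mp hs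
  · rintro rfl
    obtain ⟨L, hL, -⟩ := exists_isCanonical b e hA hκ hC D i
    exact ⟨_, MulAction.mem_orbit_self _, hdom, L, hL,
      (isSymbolOfBlocks_iff b e hA hκ hC D hL _).mpr rfl⟩

lemma mem_smallOrbits_iff (O : Set V) :
    O ∈ smallOrbits P ↔ ∃ i, O = MulAction.orbit P.weylGroup (vec b e (D.wt i)) := by
  constructor
  · rintro ⟨v, hv, rfl⟩
    obtain ⟨i, w, hw⟩ := exists_smul_eq_vec_wt b e hA hκ hC D hv
    exact ⟨i, by rw [← hw, MulAction.orbit_smul]⟩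
  · rintro ⟨i, rfl⟩
    exact ⟨_, isSmall_vec_wt b e hA hκ hC D i, rfl⟩

lemma convexHull_orbit_subset_iff (i j : I) :
    convexHull ℝ (MulAction.orbit P.weylGroup (vec b e (D.wt i))) ⊆
      convexHull ℝ (MulAction.orbit P.weylGroup (vec b e (D.wt j))) ↔ D.wt i ≤ D.wt j := by
  have hdom : ∀ i, IsDominant b (vec b e (D.wt i)) := fun i ↦ by
    rw [isDominant_vec_iff b e hA]; exact D.dom _
  constructor
  · intro h
    rw [← coord_vec_le_iff b e]
    exact (hdom j).coord_le_of_mem_convexHull b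
      (h (subset_convexHull ℝ _ (MulAction.mem_orbit_self _)))
  · intro h
    rw [← coord_vec_le_iff b e] at h
    exact convexHull_orbit_subset ((hdom i).mem_convexHull_of_coord_le b h)

/-- `S` is an explicit model of the poset of symbols, and `cls` collects the weights with a common
symbol. The order on symbols is the one carried over from `S`; its antisymmetry, which is not
automatic when several orbits share a symbol, comes from the given order on `S`. -/
theorem main_of_smallData (X : DynkinType) {S : Type} [PartialOrder S] (cls : I → S)
    (name : S → WeightSymbol) (hname : Function.Injective name) (hcls : Function.Surjective cls)
    (hsym : ∀ i, D.sym i = name (cls i))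
    (hle : ∀ s t, s ≤ t ↔ ∃ i j, cls i = s ∧ cls j = t ∧ D.wt i ≤ D.wt j)
    (hcov : ∀ x y, Covers X x y ↔ ∃ s t : S, name t = x ∧ name s = y ∧ s ⋖ t) :
    (∃ _ : PartialOrder (SmallOrbit P),
      ∀ O O' : SmallOrbit P, O ≤ O' ↔ convexHull ℝ O.1 ⊆ convexHull ℝ O'.1) ∧
    (∀ O ∈ smallOrbits P, ∃! s, HasSymbol b O s) ∧
    ∃ _ : PartialOrder (SmallSymbol b),
      (∀ s t : SmallSymbol b, s ≤ t ↔
        ∃ O ∈ smallOrbits P, ∃ O' ∈ smallOrbits P,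
          HasSymbol b O s.1 ∧ HasSymbol b O' t.1 ∧ convexHull ℝ O ⊆ convexHull ℝ O') ∧
      ∀ s t : WeightSymbol,
        (∃ s' t' : SmallSymbol b, s'.1 = s ∧ t'.1 = t ∧ s' ⋖ t') ↔ Covers X t s := by
  have horb := mem_smallOrbits_iff b e hA hκ hC D
  have hsymb := hasSymbol_orbit_iff b e hA hκ hC D
  have hconv := convexHull_orbit_subset_iff b e hA hκ hC D
  refine ⟨?_, ?_, ?_⟩
  · refine ⟨{ le := fun O O' ↦ convexHull ℝ O.1 ⊆ convexHull ℝ O'.1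
              le_refl := fun O ↦ subset_rfl
              le_trans := fun O O' O'' h h' ↦ h.trans h'
              le_antisymm := ?_ }, fun O O' ↦ Iff.rfl⟩
    rintro ⟨O, hO⟩ ⟨O', hO'⟩ h h'
    obtain ⟨i, rfl⟩ := (horb O).mp hO
    obtain ⟨j, rfl⟩ := (horb O').mp hO'
    rw [hconv] at h h'
    apply Subtype.ext
    simp only [le_antisymm h h']
  · intro O hO
    obtain ⟨i, rfl⟩ := (horb O).mp hO
    exact ⟨D.sym i, (hsymb i _).mpr rfl, fun s hs ↦ (hsymb i s).mp hs⟩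
  · have hφ : ∀ s : SmallSymbol b, ∃ σ : S, name σ = s.1 := by
      rintro ⟨s, O, hO, hs⟩
      obtain ⟨i, rfl⟩ := (horb O).mp hO
      exact ⟨cls i, by rw [← hsym]; exact ((hsymb i s).mp hs).symm⟩
    choose φ hφ' using hφ
    have hinj : Function.Injective φ := fun s t h ↦
      Subtype.ext (by rw [← hφ', ← hφ', h])
    have hsurj : Function.Surjective φ := by
      intro σ
      obtain ⟨i, rfl⟩ := hcls σ
      refine ⟨⟨name (cls i), _, (horb _).mpr ⟨i, rfl⟩, (hsymb i _).mpr (hsym i).symm⟩, ?_⟩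
      exact hname (hφ' _)
    let _ : PartialOrder (SmallSymbol b) := PartialOrder.lift φ hinj
    let ψ : SmallSymbol b ≃o S :=
      { Equiv.ofBijective φ ⟨hinj, hsurj⟩ with map_rel_iff' := Iff.rfl }
    refine ⟨inferInstance, fun s t ↦ ?_, fun s t ↦ ?_⟩
    · change φ s ≤ φ t ↔ _
      rw [hle]
      constructor
      · rintro ⟨i, j, hi, hj, hij⟩
        refine ⟨_, (horb _).mpr ⟨i, rfl⟩, _, (horb _).mpr ⟨j, rfl⟩, (hsymb i _).mpr ?_,
          (hsymb j _).mpr ?_, (hconv i j).mpr hij⟩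
        · rw [hsym, hi, hφ']
        · rw [hsym, hj, hφ']
      · rintro ⟨O, hO, O', hO', hs, ht, hsub⟩
        obtain ⟨i, rfl⟩ := (horb O).mp hO
        obtain ⟨j, rfl⟩ := (horb O').mp hO'
        refine ⟨i, j, hname ?_, hname ?_, (hconv i j).mp hsub⟩
        · rw [hφ', ← hsym, (hsymb i _).mp hs]
        · rw [hφ', ← hsym, (hsymb j _).mp ht]
    · rw [hcov]
      constructor
      · rintro ⟨s', t', rfl, rfl, h⟩
        exact ⟨φ s', φ t', hφ' _, hφ' _, (apply_covBy_apply_iff ψ).mpr h⟩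
      · rintro ⟨σ, τ, rfl, rfl, h⟩
        obtain ⟨s', rfl⟩ := hsurj σ
        obtain ⟨t', rfl⟩ := hsurj τ
        exact ⟨s', t', (hφ' _).symm, (hφ' _).symm, (apply_covBy_apply_iff ψ).mp h⟩

end Canonical


/-! ### The small weights of the exceptional types. -/

instance decidableLEFunInt {n : ℕ} : DecidableLE (Fin n → ℤ) := fun x y ↦
  decidable_of_iff (∀ j, x j ≤ y j) Iff.rfl

instance decidableIsRootCoord {n : ℕ} (A : Matrix (Fin n) (Fin n) ℤ) (d : Fin n → ℤ) (d₀ : ℤ)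
    (c : Fin n → ℤ) : Decidable (IsRootCoord A d d₀ c) :=
  inferInstanceAs (Decidable (_ ∧ _))

section Step

variable {n : ℕ} {A : Matrix (Fin n) (Fin n) ℤ} {d x y : Fin n → ℤ} {k l : ℕ}

lemma isStep_one (h : (∀ j, d j = 1) ∧ IsRootCoord A d 1 (x - y) ∧ k = l + 1 ∧
    form A d x x = form A d y y + 2) : IsStep A d x y k l .one := h

lemma isStep_oneShort (h : (∃ j, d j = 2) ∧ IsRootCoord A d 1 (x - y) ∧ k = l + 1 ∧
    form A d x x = form A d y y + 2) : IsStep A d x y k l .oneShort := h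

lemma isStep_oneLong (h : (∃ j, d j = 2) ∧ IsRootCoord A d 2 (x - y) ∧ k = l + 1 ∧
    form A d x x = form A d y y + 4) : IsStep A d x y k l .oneLong := h

lemma isStep_two (β γ : Fin n → ℤ) (h : (IsRootCoord A d 1 β ∧ IsRootCoord A d 1 γ ∧
    form A d β γ = 1 ∧ β + γ = x - y) ∧ k = l + 2 ∧ form A d x x = form A d y y + 6) :
    IsStep A d x y k l .two := ⟨⟨β, γ, h.1⟩, h.2⟩

end Step

section E6

/-- In fundamental weights: 0, ω₂, ω₁+ω₆, ω₄, ω₅+ω₆, ω₁+ω₃, 3ω₆, 3ω₁. The diagram automorphism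
exchanges the fifth with the sixth and the seventh with the eighth. -/
def e6Wt : Fin 8 → Fin 6 → ℤ :=
  ![![0, 0, 0, 0, 0, 0],
    ![1, 2, 2, 3, 2, 1],
    ![2, 2, 3, 4, 3, 2],
    ![2, 3, 4, 6, 4, 2],
    ![2, 3, 4, 6, 5, 3],
    ![3, 3, 5, 6, 4, 2],
    ![2, 3, 4, 6, 5, 4],
    ![4, 3, 5, 6, 4, 2]]

/-- The highest root θ is ω₂, so this coordinate is (λ, θ). Once it reaches 4 = (2θ, θ), the
dominance inequalities put λ above 2θ. The other exceptional types are treated alike, with θ_s = ω₄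
in F₄. -/
lemma e6_coord_le (c : Fin 6 → ℤ) (hc : ∀ j, 0 ≤ pair CartanMatrix.E₆ c j)
    (hj : ∃ j, c j < 2 * e6Wt 1 j) : c 1 ≤ 3 := by
  simp only [pair, CartanMatrix.E₆, Fin.forall_fin_succ, Fin.sum_univ_succ, Fin.exists_fin_succ,
    e6Wt] at hc hj
  simp at hc hj
  omega

lemma e6_complete (c : Fin 6 → ℤ) (hc : ∀ j, 0 ≤ pair CartanMatrix.E₆ c j)
    (hj : ∃ j, c j < 2 * e6Wt 1 j) : ∃ i, e6Wt i = c := by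
  have hbound := e6_coord_le c hc hj
  clear hj
  simp only [pair, CartanMatrix.E₆, Fin.forall_fin_succ, Fin.sum_univ_succ] at hc
  simp at hc
  obtain ⟨h1, h2, h3, h4, h5, h6⟩ := hc
  obtain ⟨m1, hm1⟩ := Int.le.dest h1
  obtain ⟨m2, hm2⟩ := Int.le.dest h2
  obtain ⟨m3, hm3⟩ := Int.le.dest h3
  obtain ⟨m4, hm4⟩ := Int.le.dest h4
  obtain ⟨m5, hm5⟩ := Int.le.dest h5
  obtain ⟨m6, hm6⟩ := Int.le.dest h6
  -- The m's are the coordinates in fundamental weights, and the bounded coordinate of c is a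
  -- positive combination of them, so finitely many cases remain. The congruence modulo 3 says that
  -- the weight is in the root lattice; the matrix in `key` is three times the inverse Cartan
  -- matrix.
  have hm : m1 + 2 * m2 + 2 * m3 + 3 * m4 + 2 * m5 + m6 ≤ 3 := by omega
  have hmod : (m1 + 2 * m3 + m5 + 2 * m6) % 3 = 0 := by omega
  have key : ∀ m1 : Fin 4, ∀ m2 : Fin 2, ∀ m3 : Fin 2, ∀ m4 : Fin 2, ∀ m5 : Fin 2, ∀ m6 : Fin 4,
      m1.1 + 2 * m2.1 + 2 * m3.1 + 3 * m4.1 + 2 * m5.1 + m6.1 ≤ 3 → (m1.1 + 2 * m3.1 + m5.1 + 2 * m6.1) % 3 = 0 →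
      ∃ i, ∀ j, 3 * e6Wt i j = (![4 * m1.1 + 3 * m2.1 + 5 * m3.1 + 6 * m4.1 + 4 * m5.1 + 2 * m6.1,
        3 * m1.1 + 6 * m2.1 + 6 * m3.1 + 9 * m4.1 + 6 * m5.1 + 3 * m6.1,
        5 * m1.1 + 6 * m2.1 + 10 * m3.1 + 12 * m4.1 + 8 * m5.1 + 4 * m6.1,
        6 * m1.1 + 9 * m2.1 + 12 * m3.1 + 18 * m4.1 + 12 * m5.1 + 6 * m6.1,
        4 * m1.1 + 6 * m2.1 + 8 * m3.1 + 12 * m4.1 + 10 * m5.1 + 5 * m6.1,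
        2 * m1.1 + 3 * m2.1 + 4 * m3.1 + 6 * m4.1 + 5 * m5.1 + 4 * m6.1] j : ℕ) := by
    decide +kernel
  obtain ⟨i, hi⟩ := key ⟨m1, by omega⟩ ⟨m2, by omega⟩ ⟨m3, by omega⟩ ⟨m4, by omega⟩ ⟨m5, by omega⟩ ⟨m6, by omega⟩ hm hmod
  refine ⟨i, ?_⟩
  simp [Fin.forall_fin_succ] at hi
  simp only [funext_iff, Fin.forall_fin_succ]
  simp
  omega

open BlockLabel in
def e6Labels : Fin 8 → List BlockLabel :=
  ![[], [one], [one, one], [two], [two, one], [two, one], [two, two], [two, two]]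

def e6Data : SmallData CartanMatrix.E₆ (fun _ ↦ 1) (Fin 8) where
  wt := e6Wt
  dom := by decide +kernel
  short := 1
  high := 1
  root_short := by decide +kernel
  short_le_high := by decide +kernel
  complete := e6_complete
  short_unique := by decide +kernel
  high_unique := by decide +kernel
  form_short_le := by decide +kernel
  form_high_le := by decide +kernel
  colen := ![0, 1, 2, 2, 3, 3, 4, 4]
  colen_zero := by decide +kernel
  colen_le := by decide +kernel
  pred := ![0, 0, 1, 0, 3, 3, 3, 3]
  label := ![.one, .one, .one, .two, .one, .one, .two, .two]
  step := by
    intro i hi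
    fin_cases i
    · exact (hi (by decide)).elim
    · exact isStep_one (by decide +kernel)
    · exact isStep_one (by decide +kernel)
    -- ω₄ = θ + (θ - α₂).
    · exact isStep_two ![1, 2, 2, 3, 2, 1] ![1, 1, 2, 3, 2, 1] (by decide +kernel)
    · exact isStep_one (by decide +kernel)
    · exact isStep_one (by decide +kernel)
    · exact isStep_two ![0, 0, 0, 0, 0, 1] ![0, 0, 0, 0, 1, 1] (by decide +kernel)
    · exact isStep_two ![1, 0, 0, 0, 0, 0] ![1, 0, 1, 0, 0, 0] (by decide +kernel)
  pred_max := by decide +kernel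
  labels := e6Labels
  labels_zero := by
    intro i hi
    fin_cases i
    · rfl
    all_goals exact absurd hi (by decide +kernel)
  labels_pred := by
    intro i hi
    fin_cases i
    · exact (hi (by decide)).elim
    all_goals rfl
  sym i := .word (e6Labels i)
  sym_spec := by
    intro i
    refine .inl ⟨rfl, ?_⟩
    fin_cases i
    · exact .inl (by simp [e6Labels])
    · exact .inl (by simp [e6Labels])
    -- α₁ is orthogonal to θ = ω₂ and has scalar product 1 with ω₁+ω₆.
    · exact .inr ⟨![1, 0, 0, 0, 0, 0], by decide +kernel⟩
    · exact .inl (by simp [e6Labels])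
    · exact .inl (by simp [e6Labels])
    · exact .inl (by simp [e6Labels])
    · exact .inl (by simp [e6Labels])
    · exact .inl (by simp [e6Labels])

end E6

section E7

/-- In fundamental weights: 0, ω₁, ω₆, 2ω₇, ω₃, ω₂+ω₇. -/
def e7Wt : Fin 6 → Fin 7 → ℤ :=
  ![![0, 0, 0, 0, 0, 0, 0],
    ![2, 2, 3, 4, 3, 2, 1],
    ![2, 3, 4, 6, 5, 4, 2],
    ![2, 3, 4, 6, 5, 4, 3],
    ![3, 4, 6, 8, 6, 4, 2],
    ![3, 5, 6, 9, 7, 5, 3]]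

lemma e7_coord_le (c : Fin 7 → ℤ) (hc : ∀ j, 0 ≤ pair CartanMatrix.E₇ c j)
    (hj : ∃ j, c j < 2 * e7Wt 1 j) : c 0 ≤ 3 := by
  simp only [pair, CartanMatrix.E₇, Fin.forall_fin_succ, Fin.sum_univ_succ, Fin.exists_fin_succ,
    e7Wt] at hc hj
  simp at hc hj
  omega

lemma e7_complete (c : Fin 7 → ℤ) (hc : ∀ j, 0 ≤ pair CartanMatrix.E₇ c j)
    (hj : ∃ j, c j < 2 * e7Wt 1 j) : ∃ i, e7Wt i = c := by
  have hbound := e7_coord_le c hc hj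
  clear hj
  simp only [pair, CartanMatrix.E₇, Fin.forall_fin_succ, Fin.sum_univ_succ] at hc
  simp at hc
  obtain ⟨h1, h2, h3, h4, h5, h6, h7⟩ := hc
  obtain ⟨m1, hm1⟩ := Int.le.dest h1
  obtain ⟨m2, hm2⟩ := Int.le.dest h2
  obtain ⟨m3, hm3⟩ := Int.le.dest h3
  obtain ⟨m4, hm4⟩ := Int.le.dest h4
  obtain ⟨m5, hm5⟩ := Int.le.dest h5
  obtain ⟨m6, hm6⟩ := Int.le.dest h6
  obtain ⟨m7, hm7⟩ := Int.le.dest h7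
  have hm : 2 * m1 + 2 * m2 + 3 * m3 + 4 * m4 + 3 * m5 + 2 * m6 + m7 ≤ 3 := by omega
  -- The root lattice has index 2 in the weight lattice.
  have hmod : (m2 + m5 + m7) % 2 = 0 := by omega
  have key : ∀ m1 : Fin 2, ∀ m2 : Fin 2, ∀ m3 : Fin 2, ∀ m4 : Fin 1, ∀ m5 : Fin 2, ∀ m6 : Fin 2, ∀ m7 : Fin 4,
      2 * m1.1 + 2 * m2.1 + 3 * m3.1 + 4 * m4.1 + 3 * m5.1 + 2 * m6.1 + m7.1 ≤ 3 → (m2.1 + m5.1 + m7.1) % 2 = 0 →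
      ∃ i, ∀ j, 2 * e7Wt i j = (![4 * m1.1 + 4 * m2.1 + 6 * m3.1 + 8 * m4.1 + 6 * m5.1 + 4 * m6.1 + 2 * m7.1,
        4 * m1.1 + 7 * m2.1 + 8 * m3.1 + 12 * m4.1 + 9 * m5.1 + 6 * m6.1 + 3 * m7.1,
        6 * m1.1 + 8 * m2.1 + 12 * m3.1 + 16 * m4.1 + 12 * m5.1 + 8 * m6.1 + 4 * m7.1,
        8 * m1.1 + 12 * m2.1 + 16 * m3.1 + 24 * m4.1 + 18 * m5.1 + 12 * m6.1 + 6 * m7.1,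
        6 * m1.1 + 9 * m2.1 + 12 * m3.1 + 18 * m4.1 + 15 * m5.1 + 10 * m6.1 + 5 * m7.1,
        4 * m1.1 + 6 * m2.1 + 8 * m3.1 + 12 * m4.1 + 10 * m5.1 + 8 * m6.1 + 4 * m7.1,
        2 * m1.1 + 3 * m2.1 + 4 * m3.1 + 6 * m4.1 + 5 * m5.1 + 4 * m6.1 + 3 * m7.1] j : ℕ) := by
    decide +kernel
  obtain ⟨i, hi⟩ := key ⟨m1, by omega⟩ ⟨m2, by omega⟩ ⟨m3, by omega⟩ ⟨m4, by omega⟩ ⟨m5, by omega⟩ ⟨m6, by omega⟩ ⟨m7, by omega⟩ hm hmod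
  refine ⟨i, ?_⟩
  simp [Fin.forall_fin_succ] at hi
  simp only [funext_iff, Fin.forall_fin_succ]
  simp
  omega

open BlockLabel in
def e7Labels : Fin 6 → List BlockLabel :=
  ![[], [one], [one, one], [one, one, one], [two], [two, one]]

def e7Data : SmallData CartanMatrix.E₇ (fun _ ↦ 1) (Fin 6) where
  wt := e7Wt
  dom := by decide +kernel
  short := 1
  high := 1
  root_short := by decide +kernel
  short_le_high := by decide +kernel
  complete := e7_complete
  short_unique := by decide +kernel
  high_unique := by decide +kernel
  form_short_le := by decide +kernel
  form_high_le := by decide +kernel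
  colen := ![0, 1, 2, 3, 2, 3]
  colen_zero := by decide +kernel
  colen_le := by decide +kernel
  pred := ![0, 0, 1, 2, 0, 4]
  label := ![.one, .one, .one, .one, .two, .one]
  step := by
    intro i hi
    fin_cases i
    · exact (hi (by decide)).elim
    · exact isStep_one (by decide +kernel)
    · exact isStep_one (by decide +kernel)
    · exact isStep_one (by decide +kernel)
    -- ω₃ = θ + (θ - α₁).
    · exact isStep_two ![2, 2, 3, 4, 3, 2, 1] ![1, 2, 3, 4, 3, 2, 1] (by decide +kernel)
    · exact isStep_one (by decide +kernel)
  pred_max := by decide +kernel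
  labels := e7Labels
  labels_zero := by
    intro i hi
    fin_cases i
    · rfl
    all_goals exact absurd hi (by decide +kernel)
  labels_pred := by
    intro i hi
    fin_cases i
    · exact (hi (by decide)).elim
    all_goals rfl
  sym i := .word (e7Labels i)
  sym_spec := by
    intro i
    refine .inl ⟨rfl, ?_⟩
    fin_cases i
    · exact .inl (by simp [e7Labels])
    · exact .inl (by simp [e7Labels])
    · exact .inr ⟨![0, 0, 0, 0, 0, 1, 0], by decide +kernel⟩
    · exact .inl (by simp [e7Labels])
    · exact .inl (by simp [e7Labels])
    · exact .inl (by simp [e7Labels])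

end E7

section E8

/-- In fundamental weights: 0, ω₈, ω₁, ω₇, ω₂. The Cartan matrices of E₈ and F₄ are unimodular, so
no congruence is needed below. -/
def e8Wt : Fin 5 → Fin 8 → ℤ :=
  ![![0, 0, 0, 0, 0, 0, 0, 0],
    ![2, 3, 4, 6, 5, 4, 3, 2],
    ![4, 5, 7, 10, 8, 6, 4, 2],
    ![4, 6, 8, 12, 10, 8, 6, 3],
    ![5, 8, 10, 15, 12, 9, 6, 3]]

lemma e8_coord_le (c : Fin 8 → ℤ) (hc : ∀ j, 0 ≤ pair CartanMatrix.E₈ c j)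
    (hj : ∃ j, c j < 2 * e8Wt 1 j) : c 7 ≤ 3 := by
  simp only [pair, CartanMatrix.E₈, Fin.forall_fin_succ, Fin.sum_univ_succ, Fin.exists_fin_succ,
    e8Wt] at hc hj
  simp at hc hj
  omega

set_option maxHeartbeats 1000000 in
lemma e8_complete (c : Fin 8 → ℤ) (hc : ∀ j, 0 ≤ pair CartanMatrix.E₈ c j)
    (hj : ∃ j, c j < 2 * e8Wt 1 j) : ∃ i, e8Wt i = c := by
  have hbound := e8_coord_le c hc hj
  clear hj
  simp only [pair, CartanMatrix.E₈, Fin.forall_fin_succ, Fin.sum_univ_succ] at hc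
  simp at hc
  obtain ⟨h1, h2, h3, h4, h5, h6, h7, h8⟩ := hc
  obtain ⟨m1, hm1⟩ := Int.le.dest h1
  obtain ⟨m2, hm2⟩ := Int.le.dest h2
  obtain ⟨m3, hm3⟩ := Int.le.dest h3
  obtain ⟨m4, hm4⟩ := Int.le.dest h4
  obtain ⟨m5, hm5⟩ := Int.le.dest h5
  obtain ⟨m6, hm6⟩ := Int.le.dest h6
  obtain ⟨m7, hm7⟩ := Int.le.dest h7
  obtain ⟨m8, hm8⟩ := Int.le.dest h8
  have hm : 2 * m1 + 3 * m2 + 4 * m3 + 6 * m4 + 5 * m5 + 4 * m6 + 3 * m7 + 2 * m8 ≤ 3 := by omega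
  have key : ∀ m1 : Fin 2, ∀ m2 : Fin 2, ∀ m3 : Fin 1, ∀ m4 : Fin 1, ∀ m5 : Fin 1, ∀ m6 : Fin 1, ∀ m7 : Fin 2, ∀ m8 : Fin 2,
      2 * m1.1 + 3 * m2.1 + 4 * m3.1 + 6 * m4.1 + 5 * m5.1 + 4 * m6.1 + 3 * m7.1 + 2 * m8.1 ≤ 3 →
      ∃ i, ∀ j, e8Wt i j = (![4 * m1.1 + 5 * m2.1 + 7 * m3.1 + 10 * m4.1 + 8 * m5.1 + 6 * m6.1 + 4 * m7.1 + 2 * m8.1,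
        5 * m1.1 + 8 * m2.1 + 10 * m3.1 + 15 * m4.1 + 12 * m5.1 + 9 * m6.1 + 6 * m7.1 + 3 * m8.1,
        7 * m1.1 + 10 * m2.1 + 14 * m3.1 + 20 * m4.1 + 16 * m5.1 + 12 * m6.1 + 8 * m7.1 + 4 * m8.1,
        10 * m1.1 + 15 * m2.1 + 20 * m3.1 + 30 * m4.1 + 24 * m5.1 + 18 * m6.1 + 12 * m7.1 + 6 * m8.1,
        8 * m1.1 + 12 * m2.1 + 16 * m3.1 + 24 * m4.1 + 20 * m5.1 + 15 * m6.1 + 10 * m7.1 + 5 * m8.1,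
        6 * m1.1 + 9 * m2.1 + 12 * m3.1 + 18 * m4.1 + 15 * m5.1 + 12 * m6.1 + 8 * m7.1 + 4 * m8.1,
        4 * m1.1 + 6 * m2.1 + 8 * m3.1 + 12 * m4.1 + 10 * m5.1 + 8 * m6.1 + 6 * m7.1 + 3 * m8.1,
        2 * m1.1 + 3 * m2.1 + 4 * m3.1 + 6 * m4.1 + 5 * m5.1 + 4 * m6.1 + 3 * m7.1 + 2 * m8.1] j : ℕ) := by
    decide +kernel
  obtain ⟨i, hi⟩ := key ⟨m1, by omega⟩ ⟨m2, by omega⟩ ⟨m3, by omega⟩ ⟨m4, by omega⟩ ⟨m5, by omega⟩ ⟨m6, by omega⟩ ⟨m7, by omega⟩ ⟨m8, by omega⟩ hm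
  refine ⟨i, ?_⟩
  simp [Fin.forall_fin_succ] at hi
  simp only [funext_iff, Fin.forall_fin_succ]
  simp
  omega

open BlockLabel in
def e8Labels : Fin 5 → List BlockLabel :=
  ![[], [one], [one, one], [two], [two, one]]

def e8Data : SmallData CartanMatrix.E₈ (fun _ ↦ 1) (Fin 5) where
  wt := e8Wt
  dom := by decide +kernel
  short := 1
  high := 1
  root_short := by decide +kernel
  short_le_high := by decide +kernel
  complete := e8_complete
  short_unique := by decide +kernel
  high_unique := by decide +kernel
  form_short_le := by decide +kernel
  form_high_le := by decide +kernel
  colen := ![0, 1, 2, 2, 3]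
  colen_zero := by decide +kernel
  colen_le := by decide +kernel
  pred := ![0, 0, 1, 0, 3]
  label := ![.one, .one, .one, .two, .one]
  step := by
    intro i hi
    fin_cases i
    · exact (hi (by decide)).elim
    · exact isStep_one (by decide +kernel)
    · exact isStep_one (by decide +kernel)
    -- ω₇ = θ + (θ - α₈).
    · exact isStep_two ![2, 3, 4, 6, 5, 4, 3, 2] ![2, 3, 4, 6, 5, 4, 3, 1] (by decide +kernel)
    · exact isStep_one (by decide +kernel)
  pred_max := by decide +kernel
  labels := e8Labels
  labels_zero := by
    intro i hi
    fin_cases i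
    · rfl
    all_goals exact absurd hi (by decide +kernel)
  labels_pred := by
    intro i hi
    fin_cases i
    · exact (hi (by decide)).elim
    all_goals rfl
  sym i := .word (e8Labels i)
  sym_spec := by
    intro i
    refine .inl ⟨rfl, ?_⟩
    fin_cases i
    · exact .inl (by simp [e8Labels])
    · exact .inl (by simp [e8Labels])
    · exact .inr ⟨![1, 0, 0, 0, 0, 0, 0, 0], by decide +kernel⟩
    · exact .inl (by simp [e8Labels])
    · exact .inl (by simp [e8Labels])

end E8

section F4

/-- In fundamental weights: 0, ω₄ (the highest short root), ω₁ (the highest root), ω₃. -/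
def f4Wt : Fin 4 → Fin 4 → ℤ :=
  ![![0, 0, 0, 0],
    ![1, 2, 3, 2],
    ![2, 3, 4, 2],
    ![2, 4, 6, 3]]

lemma f4_coord_le (c : Fin 4 → ℤ) (hc : ∀ j, 0 ≤ pair CartanMatrix.F₄ c j)
    (hj : ∃ j, c j < 2 * f4Wt 1 j) : c 3 ≤ 3 := by
  simp only [pair, CartanMatrix.F₄, Fin.forall_fin_succ, Fin.sum_univ_succ, Fin.exists_fin_succ,
    f4Wt] at hc hj
  simp at hc hj
  omega

lemma f4_complete (c : Fin 4 → ℤ) (hc : ∀ j, 0 ≤ pair CartanMatrix.F₄ c j)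
    (hj : ∃ j, c j < 2 * f4Wt 1 j) : ∃ i, f4Wt i = c := by
  have hbound := f4_coord_le c hc hj
  clear hj
  simp only [pair, CartanMatrix.F₄, Fin.forall_fin_succ, Fin.sum_univ_succ] at hc
  simp at hc
  obtain ⟨h1, h2, h3, h4⟩ := hc
  obtain ⟨m1, hm1⟩ := Int.le.dest h1
  obtain ⟨m2, hm2⟩ := Int.le.dest h2
  obtain ⟨m3, hm3⟩ := Int.le.dest h3
  obtain ⟨m4, hm4⟩ := Int.le.dest h4
  have hm : 2 * m1 + 4 * m2 + 3 * m3 + 2 * m4 ≤ 3 := by omega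
  have key : ∀ m1 : Fin 2, ∀ m2 : Fin 1, ∀ m3 : Fin 2, ∀ m4 : Fin 2,
      2 * m1.1 + 4 * m2.1 + 3 * m3.1 + 2 * m4.1 ≤ 3 →
      ∃ i, ∀ j, f4Wt i j = (![2 * m1.1 + 3 * m2.1 + 2 * m3.1 + m4.1,
        3 * m1.1 + 6 * m2.1 + 4 * m3.1 + 2 * m4.1,
        4 * m1.1 + 8 * m2.1 + 6 * m3.1 + 3 * m4.1,
        2 * m1.1 + 4 * m2.1 + 3 * m3.1 + 2 * m4.1] j : ℕ) := by
    decide +kernel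
  obtain ⟨i, hi⟩ := key ⟨m1, by omega⟩ ⟨m2, by omega⟩ ⟨m3, by omega⟩ ⟨m4, by omega⟩ hm
  refine ⟨i, ?_⟩
  simp [Fin.forall_fin_succ] at hi
  simp only [funext_iff, Fin.forall_fin_succ]
  simp
  omega

open BlockLabel in
def f4Labels : Fin 4 → List BlockLabel :=
  ![[], [oneShort], [oneLong], [oneLong, oneShort]]

def f4Data : SmallData CartanMatrix.F₄ ![2, 2, 1, 1] (Fin 4) where
  wt := f4Wt
  dom := by decide +kernel
  short := 1
  high := 2
  root_short := by decide +kernel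
  short_le_high := by decide +kernel
  complete := f4_complete
  short_unique := by decide +kernel
  high_unique := by decide +kernel
  form_short_le := by decide +kernel
  form_high_le := by decide +kernel
  colen := ![0, 1, 1, 2]
  colen_zero := by decide +kernel
  colen_le := by decide +kernel
  pred := ![0, 0, 0, 2]
  label := ![.oneShort, .oneShort, .oneLong, .oneShort]
  step := by
    intro i hi
    fin_cases i
    · exact (hi (by decide)).elim
    · exact isStep_oneShort (by decide +kernel)
    · exact isStep_oneLong (by decide +kernel)
    · exact isStep_oneShort (by decide +kernel)
  pred_max := by decide +kernel
  labels := f4Labels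
  labels_zero := by
    intro i hi
    fin_cases i
    · rfl
    all_goals exact absurd hi (by decide +kernel)
  labels_pred := by
    intro i hi
    fin_cases i
    · exact (hi (by decide)).elim
    all_goals rfl
  sym i := .word (f4Labels i)
  sym_spec := by
    intro i
    refine .inl ⟨rfl, ?_⟩
    fin_cases i
    · exact .inl (by simp [f4Labels])
    · exact .inl (by simp [f4Labels])
    · exact .inl (by simp [f4Labels])
    · exact .inl (by simp [f4Labels])

end F4


/-! ### The cover relations in the exceptional types. -/

variable {ι V N : Type*} [Fintype ι] [AddCommGroup V] [Module ℝ V] [AddCommGroup N] [Module ℝ N]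
variable {P : RootPairing ι ℝ V N} [P.IsRootSystem] [P.IsCrystallographic] [P.IsReduced]

/-- The three assertions of the main theorem. -/
def HasCovers (b : P.Base) (X : DynkinType) : Prop :=
  (∃ _ : PartialOrder (SmallOrbit P),
    ∀ O O' : SmallOrbit P, O ≤ O' ↔ convexHull ℝ O.1 ⊆ convexHull ℝ O'.1) ∧
  (∀ O ∈ smallOrbits P, ∃! s, HasSymbol b O s) ∧
  ∃ _ : PartialOrder (SmallSymbol b),
    (∀ s t : SmallSymbol b, s ≤ t ↔
      ∃ O ∈ smallOrbits P, ∃ O' ∈ smallOrbits P,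
        HasSymbol b O s.1 ∧ HasSymbol b O' t.1 ∧ convexHull ℝ O ⊆ convexHull ℝ O') ∧
    ∀ s t : WeightSymbol,
      (∃ s' t' : SmallSymbol b, s'.1 = s ∧ t'.1 = t ∧ s' ⋖ t') ↔ Covers X t s

theorem hasCovers_of_smallData (b : P.Base) {n : ℕ} (e : b.support ≃ Fin n)
    {A : Matrix (Fin n) (Fin n) ℤ} {d : Fin n → ℤ}
    (hA : ∀ i j : b.support, b.cartanMatrix i j = A (e i) (e j))
    (hd : ∀ i, d i = 1 ∨ d i = 2) (hsymm : ∀ i j, A i j * d j = A j i * d i)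
    (z : Fin n) (rk : Fin n → ℕ) (hconn : ∀ i, i ≠ z → ∃ j, rk j < rk i ∧ A i j * d j ≠ 0)
    {I : Type} (D : SmallData A d I) (X : DynkinType) {S : Type} [PartialOrder S] (cls : I → S)
    (name : S → WeightSymbol) (hname : Function.Injective name) (hcls : Function.Surjective cls)
    (hsym : ∀ i, D.sym i = name (cls i))
    (hle : ∀ s t, s ≤ t ↔ ∃ i j, cls i = s ∧ cls j = t ∧ D.wt i ≤ D.wt j)
    (hcov : ∀ x y, Covers X x y ↔ ∃ s t : S, name t = x ∧ name s = y ∧ s ⋖ t) :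
    HasCovers b X := by
  obtain ⟨κ, hκ⟩ := exists_isScale b e hA hd hsymm z rk hconn
  exact main_of_smallData b e hA hκ (isCartan b e hA hκ hd hsymm) D X cls name hname hcls hsym hle
    hcov

section E6

open BlockLabel WeightSymbol in
def e6Name : Fin 6 → WeightSymbol :=
  ![word [], word [one], word [one, one], word [two], word [two, one], word [two, two]]

lemma e6_covBy (s t : Fin 6) : s ⋖ t ↔
    (t = 5 ∧ s = 4) ∨
    (t = 4 ∧ s = 3) ∨
    (t = 3 ∧ s = 2) ∨
    (t = 2 ∧ s = 1) ∨
    (t = 1 ∧ s = 0) := by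
  have h : ∀ s t : Fin 6, (s < t ∧ ∀ c : Fin 6, s < c → ¬ c < t) ↔
    (t = 5 ∧ s = 4) ∨
    (t = 4 ∧ s = 3) ∨
    (t = 3 ∧ s = 2) ∨
    (t = 2 ∧ s = 1) ∨
    (t = 1 ∧ s = 0) := by
    decide +kernel
  exact h s t

theorem hasCovers_e6 (b : P.Base) (e : b.support ≃ Fin 6)
    (hA : ∀ i j : b.support, b.cartanMatrix i j = CartanMatrix.E₆ (e i) (e j)) :
    HasCovers b .E6 := by
  -- The class map identifies the weights exchanged by the diagram automorphism; on classes the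
  -- order is a chain.
  refine hasCovers_of_smallData b e hA (by decide +kernel) (by decide +kernel)
    5 (fun i ↦ 6 - i) (by decide +kernel)
       e6Data .E6 (S := Fin 6) ![0, 1, 2, 3, 4, 4, 5, 5] e6Name ?_ ?_ ?_ ?_ ?_
  · intro s t h
    fin_cases s <;> fin_cases t <;> first | rfl | simp [e6Name] at h
  · decide +kernel
  · intro i
    fin_cases i <;> rfl
  · exact (by decide +kernel : ∀ s t : Fin 6, s ≤ t ↔ ∃ i j : Fin 8, (![0, 1, 2, 3, 4, 4, 5, 5] : Fin 8 → Fin 6) i = s ∧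
      (![0, 1, 2, 3, 4, 4, 5, 5] : Fin 8 → Fin 6) j = t ∧ e6Wt i ≤ e6Wt j)
  · intro x y
    constructor
    · intro h
      cases h
      · exact ⟨(4 : Fin 6), (5 : Fin 6), rfl, rfl, (e6_covBy _ _).mpr (by decide)⟩
      · exact ⟨(3 : Fin 6), (4 : Fin 6), rfl, rfl, (e6_covBy _ _).mpr (by decide)⟩
      · exact ⟨(2 : Fin 6), (3 : Fin 6), rfl, rfl, (e6_covBy _ _).mpr (by decide)⟩
      · exact ⟨(1 : Fin 6), (2 : Fin 6), rfl, rfl, (e6_covBy _ _).mpr (by decide)⟩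
      · exact ⟨(0 : Fin 6), (1 : Fin 6), rfl, rfl, (e6_covBy _ _).mpr (by decide)⟩
    · rintro ⟨s, t, rfl, rfl, h⟩
      rcases (e6_covBy _ _).mp h with ⟨rfl, rfl⟩ | ⟨rfl, rfl⟩ | ⟨rfl, rfl⟩ | ⟨rfl, rfl⟩ | ⟨rfl, rfl⟩
      · exact .E6_a
      · exact .E6_b
      · exact .E6_c
      · exact .E6_d
      · exact .E6_e

end E6

section E7

/-- The orbits in type `E₇`, ordered by inclusion of convex hulls. -/
structure E7Class where
  /-- The number of the weight. -/
  idx : Fin 6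

noncomputable instance : PartialOrder E7Class :=
  PartialOrder.lift (fun s : E7Class ↦ e7Wt s.idx) fun s t h ↦ congrArg E7Class.mk
    ((by decide +kernel : ∀ s t : Fin 6, e7Wt s = e7Wt t → s = t) s.idx t.idx h)

open BlockLabel WeightSymbol in
def e7Name : Fin 6 → WeightSymbol :=
  ![word [], word [one], word [one, one], word [one, one, one], word [two], word [two, one]]

/-- Here the order is not a chain: 2ω₇ and ω₃ are incomparable. -/
lemma e7_covBy (s t : E7Class) : s ⋖ t ↔
    (t.idx = 5 ∧ s.idx = 3) ∨
    (t.idx = 3 ∧ s.idx = 2) ∨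
    (t.idx = 2 ∧ s.idx = 1) ∨
    (t.idx = 1 ∧ s.idx = 0) ∨
    (t.idx = 5 ∧ s.idx = 4) ∨
    (t.idx = 4 ∧ s.idx = 2) := by
  have h : ∀ s t : Fin 6, ((e7Wt s ≤ e7Wt t ∧ ¬ e7Wt t ≤ e7Wt s) ∧ ∀ c : Fin 6,
      (e7Wt s ≤ e7Wt c ∧ ¬ e7Wt c ≤ e7Wt s) → ¬ (e7Wt c ≤ e7Wt t ∧ ¬ e7Wt t ≤ e7Wt c)) ↔
    (t = 5 ∧ s = 3) ∨
    (t = 3 ∧ s = 2) ∨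
    (t = 2 ∧ s = 1) ∨
    (t = 1 ∧ s = 0) ∨
    (t = 5 ∧ s = 4) ∨
    (t = 4 ∧ s = 2) := by
    decide +kernel
  rw [← h]
  exact ⟨fun H ↦ ⟨lt_iff_le_not_ge.mp H.1, fun c h₁ h₂ ↦ H.2 (c := ⟨c⟩) (lt_iff_le_not_ge.mpr h₁)
    (lt_iff_le_not_ge.mpr h₂)⟩, fun H ↦ ⟨lt_iff_le_not_ge.mpr H.1, fun c h₁ h₂ ↦
    H.2 c.idx (lt_iff_le_not_ge.mp h₁) (lt_iff_le_not_ge.mp h₂)⟩⟩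

theorem hasCovers_e7 (b : P.Base) (e : b.support ≃ Fin 7)
    (hA : ∀ i j : b.support, b.cartanMatrix i j = CartanMatrix.E₇ (e i) (e j)) :
    HasCovers b .E7 := by
  refine hasCovers_of_smallData b e hA (by decide +kernel) (by decide +kernel)
    6 (fun i ↦ 7 - i) (by decide +kernel)
       e7Data .E7 (S := E7Class) E7Class.mk (e7Name ·.idx) ?_ ?_ ?_ ?_ ?_
  · rintro ⟨s⟩ ⟨t⟩ h
    fin_cases s <;> fin_cases t <;> first | rfl | simp [e7Name] at h
  · exact fun ⟨s⟩ ↦ ⟨s, rfl⟩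
  · intro i
    fin_cases i <;> rfl
  · exact fun s t ↦ ⟨fun h ↦ ⟨s.idx, t.idx, rfl, rfl, h⟩, by rintro ⟨_, _, rfl, rfl, h⟩; exact h⟩
  · intro x y
    constructor
    · intro h
      cases h
      · exact ⟨⟨(3 : Fin 6)⟩, ⟨(5 : Fin 6)⟩, rfl, rfl, (e7_covBy _ _).mpr (by decide)⟩
      · exact ⟨⟨(2 : Fin 6)⟩, ⟨(3 : Fin 6)⟩, rfl, rfl, (e7_covBy _ _).mpr (by decide)⟩
      · exact ⟨⟨(1 : Fin 6)⟩, ⟨(2 : Fin 6)⟩, rfl, rfl, (e7_covBy _ _).mpr (by decide)⟩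
      · exact ⟨⟨(0 : Fin 6)⟩, ⟨(1 : Fin 6)⟩, rfl, rfl, (e7_covBy _ _).mpr (by decide)⟩
      · exact ⟨⟨(4 : Fin 6)⟩, ⟨(5 : Fin 6)⟩, rfl, rfl, (e7_covBy _ _).mpr (by decide)⟩
      · exact ⟨⟨(2 : Fin 6)⟩, ⟨(4 : Fin 6)⟩, rfl, rfl, (e7_covBy _ _).mpr (by decide)⟩
    · rintro ⟨⟨s⟩, ⟨t⟩, rfl, rfl, h⟩
      rcases (e7_covBy _ _).mp h with ⟨rfl, rfl⟩ | ⟨rfl, rfl⟩ | ⟨rfl, rfl⟩ | ⟨rfl, rfl⟩ | ⟨rfl, rfl⟩ | ⟨rfl, rfl⟩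
      · exact .E7_a
      · exact .E7_b
      · exact .E7_c
      · exact .E7_d
      · exact .E7_e
      · exact .E7_f

end E7

section E8

open BlockLabel WeightSymbol in
def e8Name : Fin 5 → WeightSymbol :=
  ![word [], word [one], word [one, one], word [two], word [two, one]]

lemma e8_covBy (s t : Fin 5) : s ⋖ t ↔
    (t = 4 ∧ s = 3) ∨
    (t = 3 ∧ s = 2) ∨
    (t = 2 ∧ s = 1) ∨
    (t = 1 ∧ s = 0) := by
  have h : ∀ s t : Fin 5, (s < t ∧ ∀ c : Fin 5, s < c → ¬ c < t) ↔
    (t = 4 ∧ s = 3) ∨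
    (t = 3 ∧ s = 2) ∨
    (t = 2 ∧ s = 1) ∨
    (t = 1 ∧ s = 0) := by
    decide +kernel
  exact h s t

theorem hasCovers_e8 (b : P.Base) (e : b.support ≃ Fin 8)
    (hA : ∀ i j : b.support, b.cartanMatrix i j = CartanMatrix.E₈ (e i) (e j)) :
    HasCovers b .E8 := by
  refine hasCovers_of_smallData b e hA (by decide +kernel) (by decide +kernel)
    7 (fun i ↦ 8 - i) (by decide +kernel)
       e8Data .E8 (S := Fin 5) id e8Name ?_ ?_ ?_ ?_ ?_
  · intro s t h
    fin_cases s <;> fin_cases t <;> first | rfl | simp [e8Name] at h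
  · exact Function.surjective_id
  · intro i
    fin_cases i <;> rfl
  · exact (by decide +kernel : ∀ s t : Fin 5, s ≤ t ↔ ∃ i j : Fin 5, i = s ∧
      j = t ∧ e8Wt i ≤ e8Wt j)
  · intro x y
    constructor
    · intro h
      cases h
      · exact ⟨(3 : Fin 5), (4 : Fin 5), rfl, rfl, (e8_covBy _ _).mpr (by decide)⟩
      · exact ⟨(2 : Fin 5), (3 : Fin 5), rfl, rfl, (e8_covBy _ _).mpr (by decide)⟩
      · exact ⟨(1 : Fin 5), (2 : Fin 5), rfl, rfl, (e8_covBy _ _).mpr (by decide)⟩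
      · exact ⟨(0 : Fin 5), (1 : Fin 5), rfl, rfl, (e8_covBy _ _).mpr (by decide)⟩
    · rintro ⟨s, t, rfl, rfl, h⟩
      rcases (e8_covBy _ _).mp h with ⟨rfl, rfl⟩ | ⟨rfl, rfl⟩ | ⟨rfl, rfl⟩ | ⟨rfl, rfl⟩
      · exact .E8_a
      · exact .E8_b
      · exact .E8_c
      · exact .E8_d

end E8

section F4

open BlockLabel WeightSymbol in
def f4Name : Fin 4 → WeightSymbol :=
  ![word [], word [oneShort], word [oneLong], word [oneLong, oneShort]]

lemma f4_covBy (s t : Fin 4) : s ⋖ t ↔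
    (t = 3 ∧ s = 2) ∨
    (t = 2 ∧ s = 1) ∨
    (t = 1 ∧ s = 0) := by
  have h : ∀ s t : Fin 4, (s < t ∧ ∀ c : Fin 4, s < c → ¬ c < t) ↔
    (t = 3 ∧ s = 2) ∨
    (t = 2 ∧ s = 1) ∨
    (t = 1 ∧ s = 0) := by
    decide +kernel
  exact h s t

theorem hasCovers_f4 (b : P.Base) (e : b.support ≃ Fin 4)
    (hA : ∀ i j : b.support, b.cartanMatrix i j = CartanMatrix.F₄ (e i) (e j)) :
    HasCovers b .F4 := by
  refine hasCovers_of_smallData b e hA (by decide +kernel) (by decide +kernel)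
    3 (fun i ↦ 4 - i) (by decide +kernel)
       f4Data .F4 (S := Fin 4) id f4Name ?_ ?_ ?_ ?_ ?_
  · intro s t h
    fin_cases s <;> fin_cases t <;> first | rfl | simp [f4Name] at h
  · exact Function.surjective_id
  · intro i
    fin_cases i <;> rfl
  · exact (by decide +kernel : ∀ s t : Fin 4, s ≤ t ↔ ∃ i j : Fin 4, i = s ∧
      j = t ∧ f4Wt i ≤ f4Wt j)
  · intro x y
    constructor
    · intro h
      cases h
      · exact ⟨(2 : Fin 4), (3 : Fin 4), rfl, rfl, (f4_covBy _ _).mpr (by decide)⟩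
      · exact ⟨(1 : Fin 4), (2 : Fin 4), rfl, rfl, (f4_covBy _ _).mpr (by decide)⟩
      · exact ⟨(0 : Fin 4), (1 : Fin 4), rfl, rfl, (f4_covBy _ _).mpr (by decide)⟩
    · rintro ⟨s, t, rfl, rfl, h⟩
      rcases (f4_covBy _ _).mp h with ⟨rfl, rfl⟩ | ⟨rfl, rfl⟩ | ⟨rfl, rfl⟩
      · exact .F4_a
      · exact .F4_b
      · exact .F4_c

end F4


/-! ### Concave integer sequences. -/

section Coordinates

variable {n : ℕ}

/-- The `m`th coordinate, counted from `1`, and zero if there is none. -/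
def nth (c : Fin n → ℤ) (m : ℕ) : ℤ := ∑ i : Fin n, if (i : ℕ) + 1 = m then c i else 0

lemma nth_zero (c : Fin n → ℤ) : nth c 0 = 0 := by simp [nth]

lemma nth_succ (c : Fin n → ℤ) (j : Fin n) : nth c (j + 1) = c j := by
  rw [nth, Finset.sum_eq_single j]
  · simp
  · intro i _ hij
    rw [if_neg]
    intro h
    exact hij (Fin.ext (by omega))
  · simp

lemma nth_succ' (c : Fin n → ℤ) {j : ℕ} (hj : j < n) : nth c (j + 1) = c ⟨j, hj⟩ :=
  nth_succ c ⟨j, hj⟩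

lemma nth_of_lt (c : Fin n → ℤ) {m : ℕ} (hm : n < m) : nth c m = 0 := by
  refine Finset.sum_eq_zero fun i _ ↦ if_neg ?_
  omega

lemma form_eq_sum_mul (A : Matrix (Fin n) (Fin n) ℤ) (d x c : Fin n → ℤ) :
    form A d x c = ∑ j, pair A x j * d j * c j :=
  Finset.sum_congr rfl fun j _ ↦ by ring

lemma le_succ_of_concave {n : ℕ} {F : ℕ → ℤ}
    (h1 : ∀ m, m + 1 < n → F m + F (m + 2) ≤ 2 * F (m + 1)) (h2 : F (n - 1) ≤ F n) :
    ∀ m < n, F m ≤ F (m + 1) := by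
  have key : ∀ k < n, F (n - 1 - k) ≤ F (n - 1 - k + 1) := by
    intro k hk
    induction k with
    | zero => rwa [Nat.sub_zero, show n - 1 + 1 = n by omega]
    | succ k ih =>
      have h3 := ih (by omega)
      have h4 := h1 (n - 1 - (k + 1)) (by omega)
      rw [show n - 1 - (k + 1) + 1 = n - 1 - k by omega,
        show n - 1 - (k + 1) + 2 = n - 1 - k + 1 by omega] at h4
      rw [show n - 1 - (k + 1) + 1 = n - 1 - k by omega]
      omega
  intro m hm
  have := key (n - 1 - m) (by omega)
  rwa [show n - 1 - (n - 1 - m) = m by omega] at this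

lemma le_of_le_succ {n : ℕ} {F : ℕ → ℤ} (h : ∀ m < n, F m ≤ F (m + 1)) {k m : ℕ} (hkm : k ≤ m)
    (hm : m ≤ n) : F k ≤ F m := by
  induction m with
  | zero => obtain rfl : k = 0 := by omega
            rfl
  | succ m ih =>
    rcases hkm.lt_or_eq with hlt | rfl
    · exact (ih (by omega) (by omega)).trans (h m hm)
    · rfl

lemma succ_le_of_concave {n : ℕ} {F : ℕ → ℤ} {a : ℤ}
    (h1 : ∀ m, m + 1 < n → F m + F (m + 2) ≤ 2 * F (m + 1)) (h2 : F 1 ≤ F 0 + a) :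
    ∀ m < n, F (m + 1) ≤ F m + a := by
  intro m hm
  induction m with
  | zero => exact h2
  | succ m ih =>
    have h3 := ih (by omega)
    have h4 := h1 m hm
    change F (m + 2) ≤ F (m + 1) + a
    omega

/-- The steps are 0 or 1 and do not increase, so all steps 1 precede all steps 0. -/
lemma eq_min_of_concave {n : ℕ} {F : ℕ → ℤ} (h0 : F 0 = 0) (h1 : ∀ m < n, F m ≤ F (m + 1))
    (h2 : ∀ m < n, F (m + 1) ≤ F m + 1)
    (h3 : ∀ m, m + 1 < n → F m + F (m + 2) ≤ 2 * F (m + 1)) :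
    ∀ m ≤ n, F m = min (m : ℤ) (F n) := by
  have hle : ∀ m ≤ n, F m ≤ m := by
    intro m hm
    induction m with
    | zero => simp [h0]
    | succ m ih =>
      have := ih (by omega)
      have := h2 m (by omega)
      push_cast
      omega
  induction n with
  | zero =>
    intro m hm
    obtain rfl : m = 0 := by omega
    simp [h0]
  | succ n ih =>
    have ih' := ih (fun m hm ↦ h1 m (by omega)) (fun m hm ↦ h2 m (by omega))
      (fun m hm ↦ h3 m (by omega)) (fun m hm ↦ hle m (by omega))
    have h4 := h1 n (by omega)
    have h5 := h2 n (by omega)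
    intro m hm
    rcases hm.lt_or_eq with hm | rfl
    · rw [ih' m (by omega)]
      by_cases h6 : F (n + 1) = F n
      · rw [h6]
      -- A last step equal to 1 forces all earlier steps to be 1.
      · have key : ∀ k ≤ n, F (n - k + 1) = F (n - k) + 1 := by
          intro k hk
          induction k with
          | zero => simp; omega
          | succ k ihk =>
            have := ihk (by omega)
            have h7 := h3 (n - (k + 1)) (by omega)
            have h8 := h2 (n - (k + 1)) (by omega)
            rw [show n - (k + 1) + 1 = n - k by omega,
              show n - (k + 1) + 2 = n - k + 1 by omega] at h7
            rw [show n - (k + 1) + 1 = n - k by omega] at h8 ⊢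
            omega
        have key' : ∀ k ≤ n + 1, F k = k := by
          intro k hk
          induction k with
          | zero => simp [h0]
          | succ k ihk =>
            have h7 := key (n - k) (by omega)
            rw [show n - (n - k) = k by omega, ihk (by omega)] at h7
            push_cast
            exact h7
        rw [key' n (by omega), key' (n + 1) le_rfl]
        push_cast
        omega
    · have := hle (n + 1) le_rfl
      omega

end Coordinates

/-! ### Type B. -/

section B

variable {n : ℕ}

lemma pair_B (c : Fin n → ℤ) (j : Fin n) : pair (CartanMatrix.B n) c j =
    2 * nth c (j + 1) - (if (j : ℕ) + 1 = n then 2 else 1) * nth c j - nth c (j + 2) := by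
  simp only [pair, nth, CartanMatrix.B, Matrix.of_apply, Finset.mul_sum,
    ← Finset.sum_sub_distrib]
  refine Finset.sum_congr rfl fun i _ ↦ ?_
  simp only [Fin.ext_iff]
  split_ifs <;> omega

/-- Half the square lengths of the simple roots. -/
def bLength (n : ℕ) (j : Fin n) : ℤ := if (j : ℕ) + 1 = n then 1 else 2

/-- The vector `e₁ + ⋯ + e_k`. -/
def bWt (k : ℕ) (j : Fin n) : ℤ := min ((j : ℤ) + 1) k

lemma nth_bWt (k : ℕ) {m : ℕ} (hm : m ≤ n) : nth (bWt (n := n) k) m = min (m : ℤ) k := by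
  cases m with
  | zero => simp [nth_zero]
  | succ m => rw [nth_succ' _ (by omega), bWt]; push_cast; rfl

lemma pair_bWt {k : ℕ} (hk : k ≤ n) (j : Fin n) :
    pair (CartanMatrix.B n) (bWt k) j * bLength n j = if (j : ℕ) + 1 = k then 2 else 0 := by
  have hj := j.2
  rw [pair_B, nth_bWt k (by omega), nth_bWt k (by omega), bLength]
  by_cases hjn : (j : ℕ) + 1 = n
  · rw [nth_of_lt _ (by omega)]
    push_cast
    split_ifs <;> omega
  · rw [nth_bWt k (by omega)]
    push_cast
    split_ifs <;> omega

/-- For the simple roots e_i - e_{i+1} and eₙ, the `m`th coordinate is the sum of the first m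
orthogonal coordinates, and the form is twice the standard scalar product. -/
lemma form_bWt {k : ℕ} (hk : k ≤ n) (c : Fin n → ℤ) :
    form (CartanMatrix.B n) (bLength n) (bWt k) c = 2 * nth c k := by
  rw [form_eq_sum_mul, nth, Finset.mul_sum]
  refine Finset.sum_congr rfl fun j _ ↦ ?_
  rw [pair_bWt hk]
  split_ifs <;> simp

lemma form_bWt_bWt {k l : ℕ} (hk : k ≤ n) :
    form (CartanMatrix.B n) (bLength n) (bWt k) (bWt l) = 2 * min (k : ℤ) l := by
  rw [form_bWt hk, nth_bWt l hk]

lemma form_bWt_sub {k l : ℕ} (hk : k ≤ n) (hl : l ≤ k) :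
    form (CartanMatrix.B n) (bLength n) (bWt k - bWt l) (bWt k - bWt l) = 2 * (k - l) := by
  rw [form_sub_left, form_sub_right, form_sub_right, form_bWt_bWt hk,
    form_bWt_bWt hk, form_bWt_bWt (by omega), form_bWt_bWt (by omega)]
  omega

lemma bWt_eq_zero_iff (hn : n ≠ 0) {k : ℕ} : bWt (n := n) k = 0 ↔ k = 0 := by
  constructor
  · intro h
    have := congrFun h ⟨0, by omega⟩
    simp only [bWt, Pi.zero_apply] at this
    push_cast at this
    omega
  · rintro rfl
    ext j
    simp only [bWt, Pi.zero_apply]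
    omega

lemma bWt_le_iff {k l : ℕ} (hk : k ≤ n) : bWt (n := n) k ≤ bWt l ↔ k ≤ l := by
  constructor
  · intro h
    rcases Nat.eq_zero_or_pos k with rfl | h0
    · omega
    have := h ⟨k - 1, by omega⟩
    simp only [bWt] at this
    omega
  · intro h j
    simp only [bWt]
    omega

/-- Dominance makes the partial sums concave and nondecreasing. Here θ_s = e₁, so smallness says
that some partial sum, hence the first one, is at most 1. Then all steps are 0 or 1. -/
lemma b_complete (hn : 2 ≤ n) (c : Fin n → ℤ) (hc : ∀ j, 0 ≤ pair (CartanMatrix.B n) c j)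
    (hj : ∃ j, c j < 2 * bWt 1 j) : ∃ k : Fin (n + 1), bWt k = c := by
  have h1 : ∀ m, m + 1 < n → nth c m + nth c (m + 2) ≤ 2 * nth c (m + 1) := by
    intro m hm
    have := hc ⟨m, by omega⟩
    rw [pair_B] at this
    simp only [if_neg hm.ne] at this
    omega
  have h3 : ∀ m < n, nth c m ≤ nth c (m + 1) := by
    refine le_succ_of_concave h1 ?_
    have := hc ⟨n - 1, by omega⟩
    rw [pair_B] at this
    simp only [show n - 1 + 1 = n by omega, if_true,
      nth_of_lt c (show n < n - 1 + 2 by omega)] at this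
    omega
  have h4 : nth c 1 ≤ 1 := by
    obtain ⟨j, hj⟩ := hj
    have := le_of_le_succ h3 (k := 1) (m := j + 1) (by omega) (by omega)
    rw [nth_succ] at this
    simp only [bWt] at hj
    omega
  have h5 := succ_le_of_concave h1 (a := 1) (by rw [nth_zero]; exact h4)
  have h6 := eq_min_of_concave (nth_zero c) h3 h5 h1
  have h7 : 0 ≤ nth c n := by
    have := h6 0 (by omega)
    rw [nth_zero] at this
    omega
  have h8 := h6 n le_rfl
  refine ⟨⟨(nth c n).toNat, by omega⟩, ?_⟩
  ext j
  have := h6 (j + 1) j.2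
  rw [nth_succ] at this
  simp only [bWt]
  rw [this]
  push_cast
  omega

open BlockLabel in
/-- The small weights of type `B`. -/
def bData (hn : 2 ≤ n) : SmallData (CartanMatrix.B n) (bLength n) (Fin (n + 1)) where
  wt k := bWt k
  dom k j := by
    have h := pair_bWt (Nat.lt_succ_iff.mp k.2) j
    have h1 : 0 < bLength n j := by unfold bLength; split_ifs <;> norm_num
    by_contra! h2
    have := mul_neg_of_neg_of_pos h2 h1
    rw [h] at this
    split_ifs at this <;> omega
  short := ⟨1, by omega⟩
  high := ⟨2, by omega⟩
  root_short := by
    refine ⟨?_, fun j ↦ one_dvd _⟩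
    simp only
    rw [form_bWt_bWt (by omega)]
    norm_num
  short_le_high := (bWt_le_iff (by simp; omega)).mpr (by simp)
  complete := b_complete hn
  short_unique k hk := by
    have h1 := k.2
    rw [form_bWt_bWt (by omega)] at hk
    have : (k : ℕ) = 1 := by omega
    simp only [this]
  high_unique k hk _ _ := by
    have h1 := k.2
    rw [form_bWt_bWt (by omega)] at hk
    have : (k : ℕ) = 2 := by omega
    simp only [this]
  form_short_le k := by
    have h1 := k.2
    simp only
    rw [form_bWt_bWt (by omega)]
    omega
  form_high_le _ k := by
    have h1 := k.2
    simp only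
    rw [form_bWt_bWt (by omega)]
    omega
  -- The summands e_i are grouped in pairs, which are long roots; for odd k a short root is left
  -- over.
  colen k := (k + 1) / 2
  colen_zero k hk := by
    rw [bWt_eq_zero_iff (by omega)] at hk
    simp [hk]
  colen_le k hk := by
    rw [Ne, bWt_eq_zero_iff (by omega)] at hk
    have := k.2
    -- The last coordinate of the highest root e₁+e₂ is 2.
    refine ⟨⟨n - 1, by omega⟩, ?_⟩
    simp only [bWt]
    rw [min_eq_right (by omega), min_eq_right (by omega)]
    omega
  pred k := ⟨if (k : ℕ) % 2 = 1 then k - 1 else k - 2, by split_ifs <;> omega⟩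
  label k := if (k : ℕ) % 2 = 1 then oneShort else oneLong
  step k hk := by
    rw [Ne, bWt_eq_zero_iff (by omega)] at hk
    have hk' := k.2
    have hd : ∃ j, bLength n j = 2 := ⟨⟨0, by omega⟩, if_neg (by simp; omega)⟩
    by_cases h : (k : ℕ) % 2 = 1
    · simp only [h, if_true]
      refine isStep_oneShort ⟨hd, ⟨?_, fun _ ↦ one_dvd _⟩, by omega, ?_⟩
      · rw [form_bWt_sub (by omega) (by omega)]; omega
      · rw [form_bWt_bWt (by omega), form_bWt_bWt (by omega)]; omega
    · simp only [h, if_false]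
      refine isStep_oneLong ⟨hd, ⟨?_, fun j ↦ ?_⟩, by omega, ?_⟩
      · rw [form_bWt_sub (by omega) (by omega)]; omega
      · have hj := j.2
        simp only [bLength, Pi.sub_apply, bWt]
        split_ifs <;> omega
      · rw [form_bWt_bWt (by omega), form_bWt_bWt (by omega)]; omega
  pred_max k q hk hqk h := by
    have h1 := k.2
    have h2 := q.2
    rw [Ne, bWt_eq_zero_iff (by omega)] at hk
    rw [bWt_le_iff (by omega)] at hqk
    rw [form_bWt_bWt (by omega), form_bWt_bWt (by omega)] at h
    rw [bWt_le_iff (by omega)]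
    simp only
    split_ifs <;> omega
  labels k := List.replicate (k / 2) oneLong ++ List.replicate (k % 2) oneShort
  labels_zero k hk := by
    rw [bWt_eq_zero_iff (by omega)] at hk
    simp [hk]
  labels_pred k hk := by
    rw [Ne, bWt_eq_zero_iff (by omega)] at hk
    by_cases h : (k : ℕ) % 2 = 1
    · simp only [h, if_true]
      rw [show ((k : ℕ) - 1) / 2 = k / 2 by omega, show ((k : ℕ) - 1) % 2 = 0 by omega]
      simp
    · simp only [h, if_false]
      rw [show ((k : ℕ) - 2) / 2 = k / 2 - 1 by omega, show ((k : ℕ) - 2) % 2 = 0 by omega,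
        show (k : ℕ) % 2 = 0 by omega]
      obtain ⟨l, hl⟩ : ∃ l, (k : ℕ) / 2 = l + 1 := ⟨k / 2 - 1, by omega⟩
      rw [hl, List.replicate_succ']
      simp
  sym k := .word (List.replicate (k / 2) oneLong ++ List.replicate (k % 2) oneShort)
  sym_spec k := by
    refine .inl ⟨rfl, .inl fun h ↦ ?_⟩
    have : one ∈ List.replicate ((k : ℕ) / 2) oneLong ++ List.replicate (k % 2) oneShort := by
      rw [h]; simp
    simp [List.mem_replicate] at this

/-- The symbol of the `k`th small weight of type `B`. -/
def bName (k : ℕ) : WeightSymbol :=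
  .word (List.replicate (k / 2) .oneLong ++ List.replicate (k % 2) .oneShort)

lemma bName_two_mul (k : ℕ) : bName (2 * k) = longs k := by
  simp [bName, longs]

lemma bName_two_mul_add_one (k : ℕ) : bName (2 * k + 1) = longsShort k := by
  simp [bName, longsShort, Nat.mul_add_div]

lemma bName_injective : Function.Injective bName := by
  intro k l h
  simp only [bName, WeightSymbol.word.injEq] at h
  have h1 := congrArg (List.countP fun x ↦ x matches .oneLong) h
  have h2 := congrArg List.length h
  simp [List.countP_append, List.countP_replicate] at h1 h2
  omega

end B

section Covers

variable {ι V N : Type*} [Fintype ι] [AddCommGroup V] [Module ℝ V] [AddCommGroup N] [Module ℝ N]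
variable {P : RootPairing ι ℝ V N} [P.IsRootSystem] [P.IsCrystallographic] [P.IsReduced]

theorem hasCovers_b {n : ℕ} (hn : 2 ≤ n) (b : P.Base) (e : b.support ≃ Fin n)
    (hA : ∀ i j : b.support, b.cartanMatrix i j = CartanMatrix.B n (e i) (e j)) :
    HasCovers b (.B n hn) := by
  refine hasCovers_of_smallData b e hA (fun i ↦ ?_) (fun i j ↦ ?_) ⟨0, by omega⟩ (fun i ↦ i)
    (fun i hi ↦ ?_) (bData hn) (.B n hn) (S := Fin (n + 1)) id (fun k ↦ bName k) ?_ ?_ ?_ ?_ ?_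
  · unfold bLength; split_ifs <;> simp
  · simp only [bLength, CartanMatrix.B, Matrix.of_apply, Fin.ext_iff]
    split_ifs <;> omega
  · have h0 : (i : ℕ) ≠ 0 := fun h ↦ hi (Fin.ext h)
    refine ⟨⟨i - 1, by omega⟩, by simp; omega, ?_⟩
    simp only [bLength, CartanMatrix.B, Matrix.of_apply, Fin.ext_iff]
    split_ifs <;> omega
  · exact fun s t h ↦ Fin.ext (bName_injective h)
  · exact Function.surjective_id
  · exact fun i ↦ rfl
  · intro s t
    constructor
    · exact fun h ↦ ⟨s, t, rfl, rfl, (bWt_le_iff (by omega)).mpr h⟩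
    · rintro ⟨_, _, rfl, rfl, h⟩
      exact (bWt_le_iff (by omega)).mp h
  · intro x y
    have hcov : ∀ s t : Fin (n + 1), s ⋖ t ↔ (t : ℕ) = s + 1 := by
      intro s t
      rw [Fin.covBy_iff, Nat.covBy_iff_add_one_eq, eq_comm]
    have h0 : bName 0 = .word [] := by simp [bName]
    have h1 : bName 1 = .word [.oneShort] := by simp [bName]
    have h2 : bName 2 = .word [.oneLong] := by simp [bName]
    constructor
    · intro h
      cases h with
      | B_a _ _ k hk h =>
        exact ⟨⟨2 * k, by omega⟩, ⟨2 * k + 1, by omega⟩, bName_two_mul_add_one k, bName_two_mul k,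
          (hcov _ _).mpr rfl⟩
      | B_b _ _ k hk h =>
        exact ⟨⟨2 * (k - 1) + 1, by omega⟩, ⟨2 * k, by omega⟩, bName_two_mul k,
          bName_two_mul_add_one _, (hcov _ _).mpr (by simp; omega)⟩
      | B_c => exact ⟨⟨1, by omega⟩, ⟨2, by omega⟩, h2, h1, (hcov _ _).mpr rfl⟩
      | B_d => exact ⟨⟨0, by omega⟩, ⟨1, by omega⟩, h1, h0, (hcov _ _).mpr rfl⟩
    · rintro ⟨⟨s, hs⟩, ⟨t, ht⟩, rfl, rfl, h⟩
      obtain rfl : t = s + 1 := (hcov _ _).mp h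
      simp only
      obtain ⟨k, rfl | rfl⟩ := Nat.even_or_odd' s
      · rw [bName_two_mul, bName_two_mul_add_one]
        rcases Nat.eq_zero_or_pos k with rfl | hk
        · exact .B_d n hn
        · exact .B_a n hn k hk (by omega)
      · rw [bName_two_mul_add_one, show 2 * k + 1 + 1 = 2 * (k + 1) by ring, bName_two_mul]
        exact .B_b n hn (k + 1) (by omega) (by omega)

end Covers


/-! ### The poset that indexes the small weights of types C and D. -/

section Index

/-- The pairs `(b, s)` that index the small weights of type `C`, ordered componentwise. -/
abbrev SmallIndex (n : ℕ) : Type := {p : ℕ × ℕ // p.1 ≤ 1 ∧ p.1 ≤ p.2 ∧ 2 * p.2 ≤ n + p.1}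

variable {n : ℕ}

lemma SmallIndex.le_iff (x y : SmallIndex n) : x ≤ y ↔ x.1.1 ≤ y.1.1 ∧ x.1.2 ≤ y.1.2 := Iff.rfl

lemma SmallIndex.lt_iff (x y : SmallIndex n) :
    x < y ↔ x.1.1 ≤ y.1.1 ∧ x.1.2 ≤ y.1.2 ∧ (x.1.1 < y.1.1 ∨ x.1.2 < y.1.2) := by
  rw [lt_iff_le_not_ge, le_iff, le_iff]
  omega

lemma SmallIndex.covBy_iff (hn : 2 ≤ n) (x y : SmallIndex n) :
    x ⋖ y ↔ (x.1.1 = y.1.1 ∧ y.1.2 = x.1.2 + 1) ∨ (x.1.1 < y.1.1 ∧ x.1.2 = y.1.2) := by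
  obtain ⟨⟨b, s⟩, hx⟩ := x
  obtain ⟨⟨b', s'⟩, hy⟩ := y
  simp only at hx hy
  constructor
  · rintro ⟨h1, h2⟩
    rw [lt_iff] at h1
    simp only at h1 ⊢
    by_contra hcon
    rcases h1.2.1.lt_or_eq with h3 | h3
    -- A strict increase of s that is not a cover passes through (b, s + 1) if that index exists,
    -- and otherwise through (1, s).
    · by_cases h4 : 2 * (s + 1) ≤ n + b
      · exact h2 (c := ⟨(b, s + 1), by simp only; omega⟩)
          ((lt_iff _ _).mpr (by simp only; omega)) ((lt_iff _ _).mpr (by simp only; omega))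
      · exact h2 (c := ⟨(1, s), by simp only; omega⟩)
          ((lt_iff _ _).mpr (by simp only; omega)) ((lt_iff _ _).mpr (by simp only; omega))
    · omega
  · intro h
    refine ⟨(lt_iff _ _).mpr (by simp only at h ⊢; omega), fun z h1 h2 ↦ ?_⟩
    rw [lt_iff] at h1 h2
    simp only at h h1 h2
    omega

/-- F stands for the partial sums. If F 1 ≤ 1, all steps are 0 or 1 and b = 0. Otherwise the steps
after the first are 0 or 1, and `eq_min_of_concave` applies to the sequence shifted by one. -/
lemma exists_smallIndex (hn : 2 ≤ n) {F : ℕ → ℤ} {z : ℤ} (h0 : F 0 = 0)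
    (h1 : ∀ m, m + 1 < n → F m + F (m + 2) ≤ 2 * F (m + 1)) (h2 : ∀ m < n, F m ≤ F (m + 1))
    (hz : F n = 2 * z) (hF : F 1 ≤ 1 ∨ F 2 ≤ 3) : ∃ p : SmallIndex n, ∀ m ≤ n,
      F m = if m = 0 then 0 else min (m : ℤ) (2 * p.1.2 - p.1.1) + p.1.1 := by
  rcases le_or_gt (F 1) 1 with h3 | h3
  · have h4 := eq_min_of_concave h0 h2 (succ_le_of_concave h1 (a := 1) (by omega)) h1
    have h5 := h4 n le_rfl
    have h6 := h4 0 (by omega)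
    refine ⟨⟨(0, z.toNat), by simp only; omega⟩, fun m hm ↦ ?_⟩
    rw [h4 m hm]
    simp only
    split_ifs <;> omega
  · have h4 : F 2 ≤ 3 := by omega
    have h5 := h2 1 (by omega)
    have hconc : ∀ m, m + 1 < n - 1 → F (m + 1) - F 1 + (F (m + 2 + 1) - F 1) ≤
        2 * (F (m + 1 + 1) - F 1) := by
      intro m hm
      have : F (m + 1) + F (m + 2 + 1) ≤ 2 * F (m + 1 + 1) := h1 (m + 1) (by omega)
      omega
    have h6 := eq_min_of_concave (n := n - 1) (F := fun m ↦ F (m + 1) - F 1) (by simp)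
      (fun m hm ↦ sub_le_sub_right (h2 (m + 1) (by omega)) _)
      (succ_le_of_concave (a := 1) hconc
        (by simp only [sub_self]; simp only [zero_add, Nat.reduceAdd] at h5 ⊢; omega)) hconc
    simp only [show n - 1 + 1 = n by omega] at h6
    have h7 := h6 (n - 1) le_rfl
    simp only [show n - 1 + 1 = n by omega] at h7
    have h8 := h6 1 (by omega)
    simp only [Nat.reduceAdd] at h8 h5
    -- The other possibility, F 1 = F 2 = 3, would make F constant equal to 3 from there on, but F n
    -- is even.
    have h9 : F 1 = 2 := by omega
    refine ⟨⟨(1, z.toNat), by simp only; omega⟩, fun m hm ↦ ?_⟩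
    cases m with
    | zero => simpa using h0
    | succ m =>
      have h10 := h6 m (by omega)
      simp only [Nat.add_eq_zero_iff, one_ne_zero, and_false, if_false]
      push_cast
      omega

end Index

/-! ### Type C. -/

section C

variable {n : ℕ}

lemma pair_C (c : Fin n → ℤ) (j : Fin n) : pair (CartanMatrix.C n) c j =
    2 * nth c (j + 1) - nth c j - (if (j : ℕ) + 2 = n then 2 else 1) * nth c (j + 2) := by
  simp only [pair, nth, CartanMatrix.C, Matrix.of_apply, Finset.mul_sum,
    ← Finset.sum_sub_distrib]
  refine Finset.sum_congr rfl fun i _ ↦ ?_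
  simp only [Fin.ext_iff]
  split_ifs <;> omega

/-- Half the square lengths of the simple roots. -/
def cLength (n : ℕ) (j : Fin n) : ℤ := if (j : ℕ) + 1 = n then 2 else 1

/-- The sum of the first `m` orthogonal coordinates. -/
def cSum (c : Fin n → ℤ) (m : ℕ) : ℤ := (if m = n then 2 else 1) * nth c m

/-- The coefficient of the last simple root 2eₙ is half the sum of all orthogonal coordinates, hence
the factor 2 in `cSum`. Multiplication by `cLength` turns values of coroots into standard scalar
products with the simple roots. -/
lemma pair_C_mul (c : Fin n → ℤ) (j : Fin n) : pair (CartanMatrix.C n) c j * cLength n j =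
    if (j : ℕ) + 1 = n then 2 * (cSum c (j + 1) - cSum c j)
      else 2 * cSum c (j + 1) - cSum c j - cSum c (j + 2) := by
  have hj := j.2
  rw [pair_C, cLength, cSum, cSum, cSum]
  by_cases h : (j : ℕ) + 1 = n
  · rw [nth_of_lt c (show n < (j : ℕ) + 2 by omega)]
    split_ifs <;> omega
  · split_ifs <;> omega

/-- The vectors `e₁ + ⋯ + e_{2 s}` (if `b = 0`) and `2 e₁ + e₂ + ⋯ + e_{2 s - 1}` (if `b = 1`). -/
def cWt (b s : ℕ) (j : Fin n) : ℤ :=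
  if (j : ℕ) + 1 = n then s else min ((j : ℤ) + 1) (2 * s - b) + b

lemma cSum_cWt {b s : ℕ} (hs : 2 * s ≤ n + b) {m : ℕ} (hm : m ≤ n) :
    cSum (cWt (n := n) b s) m = if m = 0 then 0 else min (m : ℤ) (2 * s - b) + b := by
  cases m with
  | zero => simp [cSum, nth_zero]
  | succ m =>
    rw [cSum, nth_succ' _ (by omega), cWt]
    push_cast
    split_ifs <;> omega

lemma pair_cWt (hn : 2 ≤ n) {b s : ℕ} (hb : b ≤ 1) (hbs : b ≤ s) (hs : 2 * s ≤ n + b)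
    (j : Fin n) : pair (CartanMatrix.C n) (cWt b s) j * cLength n j =
      (if 2 * s - b = n then 2 else 1) * (if (j : ℕ) + 1 = 2 * s - b then 1 else 0) +
        b * (if (j : ℕ) + 1 = 1 then 1 else 0) := by
  have hj := j.2
  rw [pair_C_mul, cSum_cWt hs (by omega), cSum_cWt hs (by omega)]
  by_cases h : (j : ℕ) + 1 = n
  · rw [if_pos h]
    push_cast
    obtain rfl | rfl : b = 0 ∨ b = 1 := by omega
    all_goals split_ifs <;> omega
  · rw [if_neg h, cSum_cWt hs (by omega)]
    push_cast
    obtain rfl | rfl : b = 0 ∨ b = 1 := by omega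
    all_goals split_ifs <;> omega

lemma form_cWt (hn : 2 ≤ n) {b s : ℕ} (hb : b ≤ 1) (hbs : b ≤ s) (hs : 2 * s ≤ n + b)
    (c : Fin n → ℤ) : form (CartanMatrix.C n) (cLength n) (cWt b s) c =
      cSum c (2 * s - b) + b * cSum c 1 := by
  rw [form_eq_sum_mul, cSum, cSum, if_neg (show 1 ≠ n by omega), one_mul, nth, nth,
    Finset.mul_sum, Finset.mul_sum, ← Finset.sum_add_distrib]
  refine Finset.sum_congr rfl fun j _ ↦ ?_
  rw [pair_cWt hn hb hbs hs]
  split_ifs <;> ring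

lemma form_cWt_cWt (hn : 2 ≤ n) {b s b' s' : ℕ} (hb : b ≤ 1) (hbs : b ≤ s) (hs : 2 * s ≤ n + b)
    (hb' : b' ≤ 1) (hbs' : b' ≤ s') (hs' : 2 * s' ≤ n + b') :
    form (CartanMatrix.C n) (cLength n) (cWt b s) (cWt b' s') =
      (if s = 0 then 0 else min (2 * s - b : ℤ) (2 * s' - b') + b') +
        (if b = 0 then 0 else min (1 : ℤ) (2 * s' - b') + b') := by
  rw [form_cWt hn hb hbs hs, cSum_cWt hs' (by omega), cSum_cWt hs' (by omega)]
  obtain rfl | rfl : b = 0 ∨ b = 1 := by omega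
  all_goals split_ifs <;> omega

lemma form_cWt_self (hn : 2 ≤ n) {b s : ℕ} (hb : b ≤ 1) (hbs : b ≤ s) (hs : 2 * s ≤ n + b) :
    form (CartanMatrix.C n) (cLength n) (cWt b s) (cWt b s) = 2 * s + 2 * b := by
  rw [form_cWt_cWt hn hb hbs hs hb hbs hs]
  split_ifs <;> omega

lemma cWt_le_iff (hn : 2 ≤ n) {b s b' s' : ℕ} (hb : b ≤ 1) (hbs : b ≤ s)
    (hb' : b' ≤ 1) (hbs' : b' ≤ s') :
    cWt (n := n) b s ≤ cWt b' s' ↔ b ≤ b' ∧ s ≤ s' := by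
  constructor
  · intro h
    have h1 := h ⟨0, by omega⟩
    have h2 := h ⟨n - 1, by omega⟩
    simp only [cWt] at h1 h2
    rw [if_neg (by omega), if_neg (by omega)] at h1
    rw [if_pos (by omega), if_pos (by omega)] at h2
    push_cast at h1
    omega
  · rintro ⟨h1, h2⟩ j
    simp only [cWt]
    split_ifs <;> omega

lemma cWt_eq_zero_iff (hn : 2 ≤ n) {b s : ℕ} (hbs : b ≤ s) :
    cWt (n := n) b s = 0 ↔ s = 0 := by
  constructor
  · intro h
    have := congrFun h ⟨n - 1, by omega⟩
    simp only [cWt, Pi.zero_apply] at this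
    rw [if_pos (by omega)] at this
    omega
  · rintro rfl
    obtain rfl : b = 0 := by omega
    ext j
    simp only [cWt, Pi.zero_apply]
    split_ifs <;> omega

lemma c_complete (hn : 2 ≤ n) (c : Fin n → ℤ) (hc : ∀ j, 0 ≤ pair (CartanMatrix.C n) c j)
    (hj : ∃ j, c j < 2 * cWt 0 1 j) : ∃ p : SmallIndex n, cWt p.1.1 p.1.2 = c := by
  have hc' : ∀ j, 0 ≤ pair (CartanMatrix.C n) c j * cLength n j := fun j ↦
    mul_nonneg (hc j) (by unfold cLength; split_ifs <;> norm_num)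
  have h1 : ∀ m, m + 1 < n → cSum c m + cSum c (m + 2) ≤ 2 * cSum c (m + 1) := by
    intro m hm
    have := hc' ⟨m, by omega⟩
    rw [pair_C_mul, if_neg (by simp; omega)] at this
    simp only at this
    omega
  have h2 : ∀ m < n, cSum c m ≤ cSum c (m + 1) := by
    refine le_succ_of_concave h1 ?_
    have := hc' ⟨n - 1, by omega⟩
    rw [pair_C_mul, if_pos (by simp; omega)] at this
    simp only [show n - 1 + 1 = n by omega] at this
    omega
  have h0 : cSum c 0 = 0 := by simp [cSum, nth_zero]
  have hval : ∀ j : Fin n, cSum c (j + 1) = if (j : ℕ) + 1 = n then 2 * c j else c j := by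
    intro j
    rw [cSum, nth_succ]
    split_ifs <;> ring
  set z : ℤ := c ⟨n - 1, by omega⟩ with hz
  have hlast : cSum c n = 2 * z := by
    have := hval ⟨n - 1, by omega⟩
    simpa only [show n - 1 + 1 = n by omega, if_true] using this
  -- The partial sums of 2θ_s = 2(e₁+e₂) are 2, 4, 4, …. So either the first partial sum is at most
  -- 1, or some later one, hence the second, is at most 3.
  obtain ⟨⟨⟨b, s⟩, hb, hbs, hs⟩, hp⟩ := exists_smallIndex hn h0 h1 h2 hlast (by
    obtain ⟨j, hj⟩ := hj
    have h3 := hval j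
    simp only [cWt] at hj
    rcases Nat.eq_zero_or_pos j with h4 | h4
    · left
      rw [h4] at h3 hj
      rw [if_neg (by omega)] at h3 hj
      simp only [zero_add] at h3
      push_cast at hj
      omega
    · right
      have h5 := le_of_le_succ h2 (k := 2) (m := j + 1) (by omega) (by omega)
      split_ifs at h3 hj <;> omega)
  refine ⟨⟨(b, s), hb, hbs, hs⟩, ?_⟩
  simp only at hb hbs hs hp
  have h3 := hp n le_rfl
  rw [if_neg (by omega)] at h3
  ext j
  have h4 := hval j
  rw [hp _ (by omega), if_neg (by omega)] at h4
  simp only [cWt]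
  push_cast at h4
  split_ifs at h4 ⊢ with h5
  · rw [show j = ⟨n - 1, by omega⟩ from Fin.ext (by simp; omega)]
    omega
  · omega

open BlockLabel in
/-- The small weights of type `C`. -/
def cData (hn : 2 ≤ n) : SmallData (CartanMatrix.C n) (cLength n) (SmallIndex n) where
  wt p := cWt p.1.1 p.1.2
  dom p j := by
    have h := pair_cWt hn p.2.1 p.2.2.1 p.2.2.2 j
    have h1 : 0 < cLength n j := by unfold cLength; split_ifs <;> norm_num
    by_contra! h2
    have := mul_neg_of_neg_of_pos h2 h1
    rw [h] at this
    split_ifs at this <;> omega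
  short := ⟨(0, 1), by simp only; omega⟩
  high := ⟨(1, 1), by simp only; omega⟩
  root_short := by
    refine ⟨?_, fun j ↦ one_dvd _⟩
    rw [form_cWt_self hn (by simp) (by simp) (by simp only; omega)]
    norm_num
  short_le_high := by
    rw [cWt_le_iff hn (by simp) (by simp) (by simp) (by simp)]
    simp
  complete := c_complete hn
  short_unique p hp := by
    obtain ⟨⟨b, s⟩, h1, h2, h3⟩ := p
    simp only at h1 h2 h3 hp ⊢
    rw [form_cWt_self hn h1 h2 h3] at hp
    obtain ⟨rfl, rfl⟩ : b = 0 ∧ s = 1 := by omega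
    rfl
  high_unique p hp hdvd _ := by
    obtain ⟨⟨b, s⟩, h1, h2, h3⟩ := p
    simp only at h1 h2 h3 hp hdvd ⊢
    rw [form_cWt_self hn h1 h2 h3] at hp
    -- The competitor e₁+e₂+e₃+e₄ has the right square length but an odd first coordinate.
    have h4 := hdvd ⟨0, by omega⟩
    simp only [cWt, cLength] at h4
    rw [if_neg (by omega), if_neg (by omega)] at h4
    push_cast at h4
    obtain ⟨rfl, rfl⟩ : b = 1 ∧ s = 1 := by omega
    rfl
  form_short_le p := by
    obtain ⟨⟨b, s⟩, h1, h2, h3⟩ := p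
    simp only at h1 h2 h3 ⊢
    rw [form_cWt_cWt hn h1 h2 h3 (by simp) (by simp) (by omega)]
    split_ifs <;> omega
  form_high_le _ p := by
    obtain ⟨⟨b, s⟩, h1, h2, h3⟩ := p
    simp only at h1 h2 h3 ⊢
    rw [form_cWt_cWt hn h1 h2 h3 (by simp) (by simp) (by omega)]
    split_ifs <;> omega
  colen p := p.1.2
  colen_zero p hp := (cWt_eq_zero_iff hn p.2.2.1).mp hp
  colen_le p hp := by
    -- The last coordinate of the highest root 2e₁ is 1.
    refine ⟨⟨n - 1, by omega⟩, ?_⟩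
    simp only [cWt]
    rw [if_pos (by omega), if_pos (by omega)]
    omega
  -- The weight 2e₁ is a single long root and leaves 0; otherwise the last two e_i are removed, and
  -- their sum is a short root.
  pred p := ⟨if p.1.1 = 1 ∧ p.1.2 = 1 then (0, 0) else (p.1.1, p.1.2 - 1), by
    obtain ⟨⟨b, s⟩, h1, h2, h3⟩ := p
    simp only at h1 h2 h3 ⊢
    split_ifs <;> simp only <;> omega⟩
  label p := if p.1.1 = 1 ∧ p.1.2 = 1 then oneLong else oneShort
  step p hp := by
    rw [Ne, cWt_eq_zero_iff hn p.2.2.1] at hp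
    obtain ⟨⟨b, s⟩, h1, h2, h3⟩ := p
    simp only at h1 h2 h3 hp
    have hd : ∃ j, cLength n j = 2 := ⟨⟨n - 1, by omega⟩, if_pos (by simp; omega)⟩
    by_cases h : b = 1 ∧ s = 1
    · simp only [h, and_self, if_true]
      obtain ⟨rfl, rfl⟩ := h
      refine isStep_oneLong ⟨hd, ⟨?_, fun j ↦ ?_⟩, by omega, ?_⟩
      · rw [form_sub_left, form_sub_right, form_sub_right, form_cWt_self hn h1 h2 h3,
          form_cWt_self hn (by omega) (by omega) (by omega),
          form_cWt_cWt hn (by omega) (by omega) (by omega) (by omega) (by omega) (by omega),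
          form_cWt_cWt hn (by omega) (by omega) (by omega) (by omega) (by omega) (by omega)]
        simp
      · simp only [cLength, Pi.sub_apply, cWt]
        split_ifs <;> omega
      · rw [form_cWt_self hn h1 h2 h3, form_cWt_self hn (by omega) (by omega) (by omega)]
        simp
    · simp only [h, if_false]
      refine isStep_oneShort ⟨hd, ⟨?_, fun j ↦ one_dvd _⟩, by omega, ?_⟩
      · rw [form_sub_left, form_sub_right, form_sub_right, form_cWt_self hn h1 h2 h3,
          form_cWt_self hn (by omega) (by omega) (by omega),
          form_cWt_cWt hn (by omega) (by omega) (by omega) (by omega) (by omega) (by omega),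
          form_cWt_cWt hn (by omega) (by omega) (by omega) (by omega) (by omega) (by omega)]
        split_ifs <;> omega
      · rw [form_cWt_self hn h1 h2 h3, form_cWt_self hn (by omega) (by omega) (by omega)]
        omega
  pred_max p q hp hqp h := by
    rw [Ne, cWt_eq_zero_iff hn p.2.2.1] at hp
    rw [cWt_le_iff hn q.2.1 q.2.2.1 p.2.1 p.2.2.1] at hqp
    obtain ⟨⟨b, s⟩, h1, h2, h3⟩ := p
    obtain ⟨⟨b', s'⟩, h1', h2', h3'⟩ := q
    simp only at h1 h2 h3 h1' h2' h3' hp hqp h ⊢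
    rw [form_cWt_self hn h1 h2 h3, form_cWt_self hn h1' h2' h3'] at h
    by_cases h4 : b = 1 ∧ s = 1
    · rw [if_pos h4, cWt_le_iff hn h1' h2' (by simp) (by simp)]
      simp only
      omega
    · rw [if_neg h4, cWt_le_iff hn h1' h2' h1 (by simp only; omega)]
      simp only
      omega
  labels p := List.replicate p.1.1 oneLong ++ List.replicate (p.1.2 - p.1.1) oneShort
  labels_zero p hp := by
    rw [cWt_eq_zero_iff hn p.2.2.1] at hp
    have := p.2.2.1
    rw [hp, show p.1.1 = 0 by omega]
    rfl
  labels_pred p hp := by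
    rw [Ne, cWt_eq_zero_iff hn p.2.2.1] at hp
    obtain ⟨⟨b, s⟩, h1, h2, h3⟩ := p
    simp only at h1 h2 h3 hp ⊢
    by_cases h : b = 1 ∧ s = 1
    · obtain ⟨rfl, rfl⟩ := h
      rfl
    · rw [if_neg h, if_neg h]
      simp only
      obtain ⟨t, rfl⟩ : ∃ t, s = b + t + 1 := ⟨s - b - 1, by omega⟩
      rw [show b + t + 1 - b = t + 1 by omega, show b + t + 1 - 1 - b = t by omega,
        List.replicate_succ', List.append_assoc]
  sym p := .word (List.replicate p.1.1 oneLong ++ List.replicate (p.1.2 - p.1.1) oneShort)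
  sym_spec p := by
    refine .inl ⟨rfl, .inl fun h ↦ ?_⟩
    have : one ∈ List.replicate p.1.1 oneLong ++ List.replicate (p.1.2 - p.1.1) oneShort := by
      rw [h]; simp
    simp [List.mem_replicate] at this

/-- The symbols of the small weights of type `C`. -/
def cName (p : ℕ × ℕ) : WeightSymbol :=
  .word (List.replicate p.1 .oneLong ++ List.replicate (p.2 - p.1) .oneShort)

lemma cName_zero (s : ℕ) : cName (0, s) = shorts s := by simp [cName, shorts]

lemma cName_one (s : ℕ) : cName (1, s + 1) = longShorts s := by simp [cName, longShorts]

lemma cName_injective {p q : ℕ × ℕ} (hp : p.1 ≤ p.2) (hq : q.1 ≤ q.2) (h : cName p = cName q) :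
    p = q := by
  simp only [cName, WeightSymbol.word.injEq] at h
  have h1 := congrArg (List.countP fun x ↦ x matches .oneLong) h
  have h2 := congrArg List.length h
  simp [List.countP_append, List.countP_replicate] at h1 h2
  exact Prod.ext (by omega) (by omega)

variable {ι V N : Type*} [Fintype ι] [AddCommGroup V] [Module ℝ V] [AddCommGroup N] [Module ℝ N]
variable {P : RootPairing ι ℝ V N} [P.IsRootSystem] [P.IsCrystallographic] [P.IsReduced]

theorem hasCovers_c {n : ℕ} (hn : 2 ≤ n) (b : P.Base) (e : b.support ≃ Fin n)
    (hA : ∀ i j : b.support, b.cartanMatrix i j = CartanMatrix.C n (e i) (e j)) :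
    HasCovers b (.C n hn) := by
  refine hasCovers_of_smallData b e hA (fun i ↦ ?_) (fun i j ↦ ?_) ⟨0, by omega⟩ (fun i ↦ i)
    (fun i hi ↦ ?_) (cData hn) (.C n hn) (S := SmallIndex n) id (fun p ↦ cName p.1) ?_ ?_ ?_ ?_ ?_
  · unfold cLength; split_ifs <;> simp
  · simp only [cLength, CartanMatrix.C, Matrix.of_apply, Fin.ext_iff]
    split_ifs <;> omega
  · have h0 : (i : ℕ) ≠ 0 := fun h ↦ hi (Fin.ext h)
    refine ⟨⟨i - 1, by omega⟩, by simp; omega, ?_⟩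
    simp only [cLength, CartanMatrix.C, Matrix.of_apply, Fin.ext_iff]
    split_ifs <;> omega
  · exact fun p q h ↦ Subtype.ext (cName_injective p.2.2.1 q.2.2.1 h)
  · exact Function.surjective_id
  · exact fun p ↦ rfl
  · intro p q
    have := cWt_le_iff hn p.2.1 p.2.2.1 q.2.1 q.2.2.1
    constructor
    · exact fun h ↦ ⟨p, q, rfl, rfl, this.mpr h⟩
    · rintro ⟨_, _, rfl, rfl, h⟩
      exact this.mp h
  · intro x y
    have hcov := SmallIndex.covBy_iff hn
    have h1 : cName (0, 1) = .word [.oneShort] := rfl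
    have h2 : cName (1, 1) = .word [.oneLong] := rfl
    constructor
    · intro h
      cases h with
      | C_a _ _ k hk h =>
        obtain ⟨k, rfl⟩ : ∃ l, k = l + 1 := ⟨k - 1, by omega⟩
        exact ⟨⟨(1, k + 1), by simp only; omega⟩, ⟨(1, k + 1 + 1), by simp only; omega⟩,
          cName_one _, cName_one _, (hcov _ _).mpr (by simp)⟩
      | C_b _ _ k hk h =>
        exact ⟨⟨(0, k + 1), by simp only; omega⟩, ⟨(1, k + 1), by simp only; omega⟩,
          cName_one _, cName_zero _, (hcov _ _).mpr (by simp)⟩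
      | C_c _ _ k hk h =>
        exact ⟨⟨(0, k), by simp only; omega⟩, ⟨(0, k + 1), by simp only; omega⟩,
          cName_zero _, cName_zero _, (hcov _ _).mpr (by simp)⟩
      | C_d =>
        exact ⟨⟨(0, 1), by simp only; omega⟩, ⟨(1, 1), by simp only; omega⟩, h2, h1,
          (hcov _ _).mpr (by simp)⟩
      | C_e =>
        exact ⟨⟨(0, 0), by simp only; omega⟩, ⟨(0, 1), by simp only; omega⟩, h1, rfl,
          (hcov _ _).mpr (by simp)⟩
    · rintro ⟨⟨⟨b, s⟩, hx⟩, ⟨⟨b', s'⟩, hy⟩, rfl, rfl, h⟩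
      rw [hcov] at h
      simp only at hx hy h ⊢
      rcases h with ⟨rfl, rfl⟩ | ⟨hlt, rfl⟩
      · obtain rfl | rfl : b = 0 ∨ b = 1 := by omega
        · rcases Nat.eq_zero_or_pos s with rfl | hs
          · exact .C_e n hn
          · rw [cName_zero, cName_zero]
            exact .C_c n hn s hs (by omega)
        · obtain ⟨k, rfl⟩ : ∃ l, s = l + 1 := ⟨s - 1, by omega⟩
          rw [cName_one, cName_one]
          exact .C_a n hn (k + 1) (by omega) (by omega)
      · obtain ⟨rfl, rfl⟩ : b = 0 ∧ b' = 1 := by omega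
        obtain ⟨k, rfl⟩ : ∃ l, s = l + 1 := ⟨s - 1, by omega⟩
        rcases Nat.eq_zero_or_pos k with rfl | hk
        · exact .C_d n hn
        · rw [cName_zero, cName_one]
          exact .C_b n hn k hk (by omega)

end C


/-! ### Type D: coordinates and completeness of the list. -/

section D

variable {n : ℕ}

lemma pair_D (hn : 4 ≤ n) (c : Fin n → ℤ) (j : Fin n) : pair (CartanMatrix.D n) c j =
    2 * nth c (j + 1) - (if (j : ℕ) + 1 = n then 0 else 1) * nth c j -
      (if (j : ℕ) + 1 = n then 1 else 0) * nth c (j - 1) -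
      (if (j : ℕ) + 2 < n then 1 else 0) * nth c (j + 2) -
      (if (j : ℕ) + 3 = n then 1 else 0) * nth c (j + 3) := by
  simp only [pair, nth, CartanMatrix.D, Matrix.of_apply, Finset.mul_sum,
    ← Finset.sum_sub_distrib]
  refine Finset.sum_congr rfl fun i _ ↦ ?_
  have hi := i.2
  have hj := j.2
  simp only [Fin.ext_iff]
  obtain h | h | h | h : (j : ℕ) + 1 = n ∨ (j : ℕ) + 2 = n ∨ (j : ℕ) + 3 = n ∨ (j : ℕ) + 3 < n := by
    omega
  · simp only [h, show ¬ n ≤ 2 by omega, show ¬ (j : ℕ) + 2 < n by omega,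
      show ¬ (j : ℕ) + 3 = n by omega, if_true, if_false,
      or_true, true_or, and_true, and_false, or_false, false_or, false_and, true_and]
    split_ifs <;> omega
  · simp only [h, show ¬ n ≤ 2 by omega, show ¬ (j : ℕ) + 1 = n by omega,
      show ¬ (j : ℕ) + 3 = n by omega, if_false,
      lt_irrefl, or_true, true_or, and_true, and_false, or_false, false_or, false_and, true_and]
    split_ifs <;> omega
  · simp only [h, show ¬ n ≤ 2 by omega, show ¬ (j : ℕ) + 1 = n by omega,
      show (j : ℕ) + 2 < n by omega, if_true, if_false,
      or_true, true_or, and_true, and_false, or_false, false_or, false_and, true_and]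
    split_ifs <;> omega
  · simp only [show ¬ n ≤ 2 by omega, show ¬ (j : ℕ) + 1 = n by omega,
      show (j : ℕ) + 2 < n by omega, show ¬ (j : ℕ) + 3 = n by omega, if_true, if_false,
      or_true, true_or, and_true, and_false, or_false, false_or, false_and, true_and]
    split_ifs <;> omega

/-- The sum of the first `m` orthogonal coordinates; for `m = n`, the sign of the last coordinate
is changed if `ε ≠ 0`. -/
def dSum (ε : ℕ) (c : Fin n → ℤ) (m : ℕ) : ℤ :=
  if m = n then 2 * (if ε = 0 then nth c n else nth c (n - 1))
  else if m + 1 = n then nth c (n - 1) + nth c n else nth c m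

/-- The vectors `e₁ + ⋯ + e_{2 s}` (if `b = 0`) and `2 e₁ + e₂ + ⋯ + e_{2 s - 1}` (if `b = 1`),
where the sign of `eₙ` is changed if `ε ≠ 0`. -/
def dWt (b ε s : ℕ) (j : Fin n) : ℤ :=
  if (j : ℕ) + 1 = n then (if 2 * s - b = n ∧ ε ≠ 0 then (s : ℤ) - 1 else s)
  else if (j : ℕ) + 2 = n then (if 2 * s - b = n ∧ ε = 0 then (s : ℤ) - 1 else s)
  else min ((j : ℤ) + 1) (2 * s - b) + b

lemma nth_dWt (b ε s : ℕ) {m : ℕ} (hm : m + 1 < n) : nth (dWt (n := n) b ε s) m =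
    if m = 0 then 0 else min (m : ℤ) (2 * s - b) + b := by
  cases m with
  | zero => simp [nth_zero]
  | succ m =>
    rw [nth_succ' _ (by omega), dWt, if_neg (by simp only; omega), if_neg (by simp only; omega),
      if_neg (by omega)]
    push_cast
    rfl

lemma nth_dWt_sub_one (b ε s : ℕ) (hn : 2 ≤ n) : nth (dWt (n := n) b ε s) (n - 1) =
    if 2 * s - b = n ∧ ε = 0 then (s : ℤ) - 1 else s := by
  obtain ⟨m, rfl⟩ : ∃ m, n = m + 2 := ⟨n - 2, by omega⟩
  rw [show m + 2 - 1 = m + 1 by omega, nth_succ' _ (by omega), dWt, if_neg (by simp), if_pos rfl]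

lemma nth_dWt_self (b ε s : ℕ) (hn : 2 ≤ n) : nth (dWt (n := n) b ε s) n =
    if 2 * s - b = n ∧ ε ≠ 0 then (s : ℤ) - 1 else s := by
  obtain ⟨m, rfl⟩ : ∃ m, n = m + 1 := ⟨n - 1, by omega⟩
  rw [nth_succ' _ (by omega), dWt, if_pos rfl]

/-- The coefficients of e_{n-1} - eₙ and e_{n-1} + eₙ are half the sums of all coordinates with the
last one counted negatively and positively. They add up to the sum of the first n - 1 coordinates.
-/
lemma pair_D_eq_dSum (hn : 4 ≤ n) (c : Fin n → ℤ) (j : Fin n) : pair (CartanMatrix.D n) c j =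
    if (j : ℕ) + 1 = n then dSum 0 c n - dSum 0 c (n - 2)
    else if (j : ℕ) + 2 = n then dSum 1 c n - dSum 0 c (n - 2)
    else 2 * dSum 0 c (j + 1) - dSum 0 c j - dSum 0 c (j + 2) := by
  have hj := j.2
  rw [pair_D hn]
  generalize (j : ℕ) = k at hj
  simp only [dSum, if_true, one_ne_zero, if_false]
  obtain h | h | h | h : k + 1 = n ∨ k + 2 = n ∨ k + 3 = n ∨ k + 3 < n := by omega
  · subst h
    have h1 : k + 1 - 2 + 1 ≠ k + 1 := by omega
    have h2 : k + 1 - 2 ≠ k + 1 := by omega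
    have h3 : k + 1 - 2 = k - 1 := by omega
    simp [h1, h2, h3]
    omega
  · subst h
    simp
  · subst h
    simp
    omega
  · simp only [show ¬ k + 1 = n by omega, show ¬ k + 2 = n by omega, show ¬ k = n by omega,
      show ¬ k + 2 + 1 = n by omega, show ¬ k + 1 + 1 = n by omega, show k + 2 < n by omega,
      show ¬ k + 3 = n by omega, if_true, if_false]
    ring

lemma dSum_dWt_self (hn : 4 ≤ n) {b ε s : ℕ} (ε' : ℕ) : dSum ε' (dWt (n := n) b ε s) n =
      2 * (if 2 * s - b = n ∧ (ε = 0 ↔ ε' ≠ 0) then (s : ℤ) - 1 else s) := by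
  rw [dSum, if_pos rfl, nth_dWt_self _ _ _ (by omega), nth_dWt_sub_one _ _ _ (by omega)]
  by_cases h : ε' = 0 <;> by_cases h' : ε = 0 <;> simp [h, h']

lemma dSum_dWt_of_lt (hn : 4 ≤ n) {b ε s : ℕ} (hs : 2 * s ≤ n + b)
    {ε' m : ℕ} (hm : m < n) : dSum ε' (dWt (n := n) b ε s) m =
      if m = 0 then 0 else min (m : ℤ) (2 * s - b) + b := by
  rw [dSum, if_neg hm.ne]
  by_cases h1 : m + 1 < n
  · rw [if_neg (by omega), nth_dWt _ _ _ h1]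
  · rw [nth_dWt_self _ _ _ (by omega), nth_dWt_sub_one _ _ _ (by omega), if_pos (by omega)]
    by_cases h2 : 2 * s - b = n <;> by_cases h3 : ε = 0 <;>
      simp only [h2, h3, true_and, false_and, if_true, if_false, not_true, not_false_eq_true,
        ne_eq, show ¬ m = 0 by omega] <;>
      omega

/-- In each alternative the sign of eₙ is harmless: the signs agree, the sum stops before n, or the
last coordinate is 0. -/
lemma dSum_dWt (hn : 4 ≤ n) {b ε s : ℕ} (hs : 2 * s ≤ n + b) {ε' m : ℕ}
    (hm : m ≤ n) (h : ε' = ε ∨ m < n ∨ 2 * s - b < n) : dSum ε' (dWt (n := n) b ε s) m =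
      if m = 0 then 0 else min (m : ℤ) (2 * s - b) + b := by
  rcases hm.lt_or_eq with hm | rfl
  · exact dSum_dWt_of_lt hn hs hm
  · rw [dSum_dWt_self hn, if_neg, if_neg (by omega)]
    · omega
    · rintro ⟨h1, h2⟩
      omega

lemma pair_dWt (hn : 4 ≤ n) {b ε s : ℕ} (hb : b ≤ 1) (hbs : b ≤ s) (hs : 2 * s ≤ n + b)
    (j : Fin n) : pair (CartanMatrix.D n) (dWt b ε s) j =
      (if 2 * s - b = n then 2 * (if (j : ℕ) + 1 = (if ε = 0 then n else n - 1) then 1 else 0)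
        else if 2 * s - b + 1 = n then
          (if (j : ℕ) + 1 = n - 1 then 1 else 0) + (if (j : ℕ) + 1 = n then 1 else 0)
        else if (j : ℕ) + 1 = 2 * s - b then 1 else 0) +
      b * (if (j : ℕ) + 1 = 1 then 1 else 0) := by
  have hj := j.2
  rw [pair_D_eq_dSum hn, dSum_dWt_self hn, dSum_dWt_self hn,
    dSum_dWt_of_lt hn hs (show n - 2 < n by omega), dSum_dWt_of_lt hn hs hj]
  obtain h | h | h : (j : ℕ) + 1 = n ∨ (j : ℕ) + 2 = n ∨ (j : ℕ) + 2 < n := by omega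
  · simp only [h, if_true, show ¬ n - 2 = 0 by omega, show ¬ n = 1 by omega, if_false, mul_zero,
      show ¬ n = n - 1 by omega]
    by_cases h1 : 2 * s - b = n
    · by_cases h2 : ε = 0 <;> simp [h1, h2] <;> omega
    · simp only [h1, false_and, if_false]
      split_ifs <;> omega
  · simp only [h, show ¬ (j : ℕ) + 1 = n by omega, if_true, show ¬ n - 2 = 0 by omega,
      show ¬ (j : ℕ) + 1 = 1 by omega, if_false, mul_zero, show (j : ℕ) + 1 = n - 1 by omega]
    by_cases h1 : 2 * s - b = n
    · by_cases h2 : ε = 0 <;> simp [h1, h2] <;> omega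
    · simp only [h1, false_and, if_false]
      split_ifs <;> omega
  · rw [dSum_dWt_of_lt hn hs (show (j : ℕ) + 1 < n by omega), dSum_dWt_of_lt hn hs h]
    simp only [show ¬ (j : ℕ) + 1 = n by omega, show ¬ (j : ℕ) + 2 = n by omega, if_false,
      show ¬ (j : ℕ) + 1 = n - 1 by omega, show ¬ (j : ℕ) + 1 = (if ε = 0 then n else n - 1) by
        split_ifs <;> omega, mul_zero, add_zero, show ¬ (j : ℕ) + 1 = 0 by omega,
      show ¬ (j : ℕ) + 2 = 0 by omega]
    push_cast
    obtain rfl | rfl : b = 0 ∨ b = 1 := by omega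
    all_goals split_ifs <;> omega

lemma form_dWt (hn : 4 ≤ n) {b ε s : ℕ} (hb : b ≤ 1) (hbs : b ≤ s) (hs : 2 * s ≤ n + b)
    (c : Fin n → ℤ) : form (CartanMatrix.D n) (fun _ ↦ 1) (dWt b ε s) c =
      dSum ε c (2 * s - b) + b * nth c 1 := by
  have key : ∀ m, nth c m = ∑ j : Fin n, (if (j : ℕ) + 1 = m then 1 else 0) * c j := fun m ↦
    Finset.sum_congr rfl fun j _ ↦ by split_ifs <;> simp
  rw [form_eq_sum_mul]
  simp only [pair_dWt hn hb hbs hs, mul_one, add_mul, Finset.sum_add_distrib, mul_assoc,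
    ← Finset.mul_sum, ← key]
  congr 1
  rw [dSum]
  split_ifs with h1 h2 h3
  · simp only [mul_assoc, ← Finset.mul_sum, ← key]
  · simp only [mul_assoc, ← Finset.mul_sum, ← key]
  · simp only [add_mul, Finset.sum_add_distrib, ← key]
  · simp only [← key]

lemma form_dWt_dWt (hn : 4 ≤ n) {b ε s b' ε' s' : ℕ} (hb : b ≤ 1) (hbs : b ≤ s)
    (hs : 2 * s ≤ n + b) (hb' : b' ≤ 1) (hbs' : b' ≤ s') (hs' : 2 * s' ≤ n + b')
    (h : ε = ε' ∨ 2 * s - b < n ∨ 2 * s' - b' < n) :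
    form (CartanMatrix.D n) (fun _ ↦ 1) (dWt b ε s) (dWt b' ε' s') =
      (if s = 0 then 0 else min (2 * s - b : ℤ) (2 * s' - b') + b') +
        (if b = 0 then 0 else min (1 : ℤ) (2 * s' - b') + b') := by
  rw [form_dWt hn hb hbs hs, dSum_dWt hn hs' (by omega) h, nth_dWt _ _ _ (by omega)]
  obtain rfl | rfl : b = 0 ∨ b = 1 := by omega
  all_goals split_ifs <;> omega

lemma form_dWt_self (hn : 4 ≤ n) {b ε s : ℕ} (hb : b ≤ 1) (hbs : b ≤ s) (hs : 2 * s ≤ n + b) :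
    form (CartanMatrix.D n) (fun _ ↦ 1) (dWt b ε s) (dWt b ε s) = 2 * s + 2 * b := by
  rw [form_dWt_dWt hn hb hbs hs hb hbs hs (.inl rfl)]
  split_ifs <;> omega

lemma le_of_dWt_le (hn : 4 ≤ n) {b ε s b' ε' s' : ℕ} (hb : b ≤ 1) (hbs : b ≤ s)
    (hb' : b' ≤ 1) (hbs' : b' ≤ s') (h : dWt (n := n) b ε s ≤ dWt b' ε' s') : b ≤ b' ∧ s ≤ s' := by
  have h1 := h ⟨0, by omega⟩
  have h2 := h ⟨n - 2, by omega⟩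
  have h3 := h ⟨n - 1, by omega⟩
  simp only [dWt, show ¬ n - 2 + 1 = n by omega, show n - 2 + 2 = n by omega,
    show n - 1 + 1 = n by omega, show ¬ 0 + 1 = n by omega, show ¬ 0 + 2 = n by omega, if_true,
    if_false] at h1 h2 h3
  push_cast at h1
  split_ifs at h2 h3 <;> omega

lemma dWt_le (hn : 4 ≤ n) {b ε s b' ε' s' : ℕ} (hs : 2 * s ≤ n + b) (h : ε = ε' ∨ 2 * s' - b' < n)
    (hle : b ≤ b' ∧ s ≤ s') :
    dWt (n := n) b ε s ≤ dWt b' ε' s' := by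
  intro j
  simp only [dWt]
  split_ifs <;> omega

lemma dWt_eq_zero_iff (hn : 4 ≤ n) {b ε s : ℕ} (hbs : b ≤ s) :
    dWt (n := n) b ε s = 0 ↔ s = 0 := by
  constructor
  · intro h
    have := congrFun h ⟨0, by omega⟩
    simp only [dWt, Pi.zero_apply] at this
    rw [if_neg (by omega), if_neg (by omega)] at this
    push_cast at this
    omega
  · rintro rfl
    obtain rfl : b = 0 := by omega
    ext j
    simp only [dWt, Pi.zero_apply]
    split_ifs <;> omega

lemma dWt_congr {b s : ℕ} (ε ε' : ℕ) (h : 2 * s - b ≠ n) :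
    dWt (n := n) b ε s = dWt b ε' s := by
  ext j
  simp only [dWt, h, false_and]

lemma d_complete (hn : 4 ≤ n) (c : Fin n → ℤ) (hc : ∀ j, 0 ≤ pair (CartanMatrix.D n) c j)
    (hj : ∃ j, c j < 2 * dWt 0 0 1 j) :
    ∃ p : SmallIndex n × Fin 2, dWt p.1.1.1 p.2 p.1.1.2 = c := by
  -- The maximum replaces the last orthogonal coordinate by its absolute value. This restores
  -- monotonicity, so that the argument for type C applies; the sign is recovered at the end as ε.
  set F : ℕ → ℤ := fun m ↦ if m = n then 2 * max (nth c n) (nth c (n - 1))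
    else if m + 1 = n then nth c (n - 1) + nth c n else nth c m with hFdef
  have hF : ∀ m, m + 1 < n → F m = nth c m := fun m hm ↦ by
    rw [hFdef]; simp only; rw [if_neg (by omega), if_neg (by omega)]
  have hF1 : F (n - 1) = nth c (n - 1) + nth c n := by
    rw [hFdef]; simp only; rw [if_neg (by omega), if_pos (by omega)]
  have hF2 : F n = 2 * max (nth c n) (nth c (n - 1)) := by
    simp only [hFdef, if_true]
  have hq : nth c (n - 2) ≤ 2 * nth c (n - 1) := by
    have h := hc ⟨n - 2, by omega⟩
    rw [pair_D hn] at h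
    simp only [show n - 2 + 1 = n - 1 by omega, show n - 2 + 2 = n by omega,
      show ¬ n - 1 = n by omega, show ¬ n - 2 + 3 = n by omega, if_false, lt_irrefl] at h
    omega
  have hp : nth c (n - 2) ≤ 2 * nth c n := by
    have h := hc ⟨n - 1, by omega⟩
    rw [pair_D hn] at h
    simp only [show n - 1 + 1 = n by omega, show n - 1 - 1 = n - 2 by omega,
      show ¬ n - 1 + 2 < n by omega, show ¬ n - 1 + 3 = n by omega, if_false, if_true] at h
    omega
  have h1 : ∀ m, m + 1 < n → F m + F (m + 2) ≤ 2 * F (m + 1) := by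
    intro m hm
    have h := hc ⟨m, by omega⟩
    rw [pair_D hn] at h
    obtain h2 | h2 | h2 : m + 2 = n ∨ m + 3 = n ∨ m + 3 < n := by omega
    · rw [h2, show m + 1 = n - 1 by omega, show m = n - 2 by omega, hF _ (by omega), hF1, hF2]
      omega
    · rw [show m + 2 = n - 1 by omega, hF1, hF _ (by omega), hF _ (by omega)]
      simp only [h2, show ¬ m + 1 = n by omega, show m + 2 = n - 1 by omega,
        show n - 1 < n by omega, if_true, if_false] at h
      omega
    · rw [hF _ (by omega), hF _ (by omega), hF _ (by omega)]
      simp only [show ¬ m + 1 = n by omega, show m + 2 < n by omega,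
        show ¬ m + 3 = n by omega, if_true, if_false] at h
      omega
  have h2 : ∀ m < n, F m ≤ F (m + 1) := by
    refine le_succ_of_concave h1 ?_
    rw [hF1, hF2]
    omega
  have h0 : F 0 = 0 := by rw [hF _ (by omega), nth_zero]
  obtain ⟨⟨⟨b, s⟩, hb, hbs, hs⟩, hbs'⟩ := exists_smallIndex (by omega) h0 h1 h2 hF2 (by
    obtain ⟨j, hj⟩ := hj
    have hj' := j.2
    simp only [dWt] at hj
    rw [← nth_succ c j] at hj
    have h3 := le_of_le_succ h2 (k := 2) (m := n - 2) (by omega) (by omega)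
    rw [hF (n - 2) (by omega)] at h3
    obtain h | h | h | h : (j : ℕ) = 0 ∨ (j : ℕ) + 1 = n ∨ (j : ℕ) + 2 = n ∨
      (0 < (j : ℕ) ∧ (j : ℕ) + 2 < n) := by omega
    · left
      rw [h, if_neg (by omega), if_neg (by omega)] at hj
      push_cast at hj
      rw [hF _ (by omega)]
      omega
    · right
      rw [h, if_pos rfl] at hj
      split_ifs at hj <;> omega
    · right
      rw [if_neg (by omega), if_pos h, show (j : ℕ) + 1 = n - 1 by omega] at hj
      split_ifs at hj <;> omega
    · right
      rw [if_neg (by omega), if_neg (by omega), ← hF _ (by omega)] at hj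
      have h4 := le_of_le_succ h2 (k := 2) (m := j + 1) (by omega) (by omega)
      omega)
  simp only at hb hbs hs hbs'
  have h3 := hbs' n le_rfl
  have h4 := hbs' (n - 1) (by omega)
  rw [if_neg (by omega), hF2] at h3
  rw [if_neg (by omega), hF1] at h4
  have key : ∀ ε : Fin 2, (nth c n = if 2 * s - b = n ∧ (ε : ℕ) ≠ 0 then (s : ℤ) - 1 else s) →
      (nth c (n - 1) = if 2 * s - b = n ∧ (ε : ℕ) = 0 then (s : ℤ) - 1 else s) →
      dWt b ε s = c := by
    intro ε h5 h6
    ext j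
    have hj' := j.2
    rw [← nth_succ c j]
    simp only [dWt]
    obtain h | h | h : (j : ℕ) + 1 = n ∨ (j : ℕ) + 2 = n ∨ (j : ℕ) + 2 < n := by omega
    · rw [if_pos h, h, h5]
    · rw [if_neg (by omega), if_pos h, show (j : ℕ) + 1 = n - 1 by omega, h6]
    · rw [if_neg (by omega), if_neg (by omega), ← hF _ (by omega), hbs' _ (by omega),
        if_neg (by omega)]
      push_cast
      rfl
  rcases le_or_gt (nth c (n - 1)) (nth c n) with h5 | h5
  · refine ⟨(⟨(b, s), hb, hbs, hs⟩, 0), key 0 ?_ ?_⟩ <;>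
      simp only [Fin.val_zero, ne_eq, not_true, and_false, and_true, if_false] <;>
      (try split_ifs) <;> omega
  · refine ⟨(⟨(b, s), hb, hbs, hs⟩, 1), key 1 ?_ ?_⟩ <;>
      simp only [Fin.val_one, one_ne_zero, ne_eq, not_false_eq_true, and_false, and_true,
        if_false] <;>
      (try split_ifs) <;> omega

end D


/-! ### Type D: blocks, symbols and covers. -/

section D

variable {n : ℕ}

lemma cartanMatrix_D_symm (i j : Fin n) :
    CartanMatrix.D n i j * 1 = CartanMatrix.D n j i * 1 := by
  rw [mul_one, mul_one, ← Matrix.transpose_apply (CartanMatrix.D n), CartanMatrix.D_transpose]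

lemma form_dWt_sub (hn : 4 ≤ n) {b ε s b' ε' s' : ℕ} (hb : b ≤ 1) (hbs : b ≤ s)
    (hs : 2 * s ≤ n + b) (hb' : b' ≤ 1) (hbs' : b' ≤ s') (hs' : 2 * s' ≤ n + b')
    (h : ε = ε' ∨ 2 * s - b < n ∨ 2 * s' - b' < n) (hle : b' ≤ b ∧ s' ≤ s) :
    form (CartanMatrix.D n) (fun _ ↦ 1) (dWt b ε s - dWt b' ε' s') (dWt b ε s - dWt b' ε' s') =
      2 * (s - s') + if b = b' then 0 else if s' = 0 ∨ s' = s then 2 else 0 := by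
  rw [form_sub_left, form_sub_right, form_sub_right, form_dWt_self hn hb hbs hs,
    form_dWt_self hn hb' hbs' hs', form_dWt_dWt hn hb hbs hs hb' hbs' hs' h,
    form_dWt_dWt hn hb' hbs' hs' hb hbs hs (by omega)]
  obtain rfl | rfl : b = 0 ∨ b = 1 := by omega
  all_goals
    obtain rfl | rfl : b' = 0 ∨ b' = 1 := by omega
    all_goals split_ifs <;> first | contradiction | omega

/-- The labels of the blocks of the small weights of type `D`. -/
def dLabels (b s : ℕ) : List BlockLabel :=
  if b = 0 then List.replicate s .one
  else if s = 1 then [.one, .one] else .two :: List.replicate (s - 2) .one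

/-- The symbols of the small weights of type `D`. -/
def dName (n : ℕ) (p : ℕ × ℕ) : WeightSymbol :=
  if p.1 = 0 then onesD n p.2 else if p.2 = 1 then .oneOne else twoOnes (p.2 - 2)

/-- The index of the dominant weight left by the smallest block. -/
def dPred (p : ℕ × ℕ) : ℕ × ℕ :=
  -- From 2e₁ the root e₁-e₂ is removed and e₁+e₂ is left; 2e₁+e₂+e₃ is a single block and leaves 0.
  if p.1 = 1 ∧ p.2 ≤ 2 then (0, 2 - p.2) else (p.1, p.2 - 1)

open BlockLabel in
/-- The small weights of type `D`. -/
def dData (hn : 4 ≤ n) : SmallData (CartanMatrix.D n) (fun _ ↦ 1) (SmallIndex n × Fin 2) where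
  wt p := dWt p.1.1.1 p.2 p.1.1.2
  dom p j := by
    rw [pair_dWt hn p.1.2.1 p.1.2.2.1 p.1.2.2.2]
    split_ifs <;> omega
  short := (⟨(0, 1), by simp only; omega⟩, 0)
  high := (⟨(0, 1), by simp only; omega⟩, 0)
  root_short := by
    refine ⟨?_, fun j ↦ one_dvd _⟩
    rw [form_dWt_self hn (by simp) (by simp) (by simp only; omega)]
    norm_num
  short_le_high := le_rfl
  complete := d_complete hn
  short_unique p hp := by
    obtain ⟨⟨⟨b, s⟩, h1, h2, h3⟩, ε⟩ := p
    simp only at h1 h2 h3 hp ⊢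
    rw [form_dWt_self hn h1 h2 h3] at hp
    obtain ⟨rfl, rfl⟩ : b = 0 ∧ s = 1 := by omega
    exact dWt_congr _ _ (by omega)
  high_unique p _ _ h := by simp at h
  form_short_le p := by
    obtain ⟨⟨⟨b, s⟩, h1, h2, h3⟩, ε⟩ := p
    simp only at h1 h2 h3 ⊢
    rw [form_dWt_dWt hn h1 h2 h3 (by simp) (by simp) (by omega) (by omega)]
    split_ifs <;> omega
  form_high_le h := by simp at h
  -- In contrast to type C, 2e₁ is not a root: it is (e₁+e₂) + (e₁-e₂).
  colen p := if p.1.1.1 = 1 ∧ p.1.1.2 = 1 then 2 else p.1.1.2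
  colen_zero p hp := by
    rw [dWt_eq_zero_iff hn p.1.2.2.1] at hp
    simp [hp]
  colen_le p hp := by
    rw [Ne, dWt_eq_zero_iff hn p.1.2.2.1] at hp
    obtain ⟨⟨⟨b, s⟩, h1, h2, h3⟩, ε⟩ := p
    simp only at h1 h2 h3 hp ⊢
    by_cases h : b = 1 ∧ s = 1
    · obtain ⟨rfl, rfl⟩ := h
      refine ⟨⟨0, by omega⟩, ?_⟩
      simp only [dWt, show ¬ 0 + 1 = n by omega, show ¬ 0 + 2 = n by omega, if_false]
      simp
    · simp only [h, if_false]
      -- The highest root e₁+e₂ has coordinate 1 at both end nodes; ε tells at which of them λ is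
      -- sure to have coordinate s.
      by_cases hε : (ε : ℕ) = 0
      · refine ⟨⟨n - 1, by omega⟩, ?_⟩
        simp only [dWt, show n - 1 + 1 = n by omega, if_true, hε]
        simp
      · refine ⟨⟨n - 2, by omega⟩, ?_⟩
        simp only [dWt, show ¬ n - 2 + 1 = n by omega, show n - 2 + 2 = n by omega, if_true,
          if_false, hε, and_false]
        rw [if_neg (by omega)]
        push_cast
        omega
  pred p := (⟨dPred p.1.1, by
    obtain ⟨⟨⟨b, s⟩, h1, h2, h3⟩, ε⟩ := p
    simp only [dPred] at h1 h2 h3 ⊢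
    split_ifs <;> simp only <;> omega⟩, p.2)
  label p := if p.1.1 = (1, 2) then two else one
  step p hp := by
    rw [Ne, dWt_eq_zero_iff hn p.1.2.2.1] at hp
    obtain ⟨⟨⟨b, s⟩, h1, h2, h3⟩, ε⟩ := p
    simp only at h1 h2 h3 hp
    simp only [Prod.mk.injEq, dPred]
    by_cases h : b = 1 ∧ s = 2
    · obtain ⟨rfl, rfl⟩ := h
      simp only [and_self, if_true, le_refl]
      have hz : dWt (n := n) 0 ε 0 = 0 := (dWt_eq_zero_iff hn le_rfl).mpr rfl
      have e1 : form (CartanMatrix.D n) (fun _ ↦ 1) (dWt 0 ε 1) (dWt 1 ε 2) = 3 := by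
        rw [form_dWt_dWt hn (by omega) (by omega) (by omega) (by omega) (by omega) (by omega)
          (by omega)]
        simp
      -- 2e₁+e₂+e₃ = (e₁+e₂) + (e₁+e₃).
      refine isStep_two (dWt 0 ε 1) (dWt 1 ε 2 - dWt 0 ε 1)
        ⟨⟨⟨?_, fun j ↦ one_dvd _⟩, ⟨?_, fun j ↦ one_dvd _⟩, ?_, ?_⟩, by simp, ?_⟩
      · rw [form_dWt_self hn (by omega) (by omega) (by omega)]; simp
      · rw [form_dWt_sub hn h1 h2 h3 (by omega) (by omega) (by omega) (by omega) (by omega)]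
        simp
      · rw [form_sub_right, form_dWt_self hn (by omega) (by omega) (by omega), e1]; simp
      · rw [add_sub_cancel, hz, sub_zero]
      · rw [form_dWt_self hn h1 h2 h3, form_dWt_self hn (by omega) (by omega) (by omega)]
        simp
    · simp only [h, if_false]
      by_cases h4 : b = 1 ∧ s ≤ 2
      · obtain ⟨rfl, rfl⟩ : b = 1 ∧ s = 1 := by omega
        refine isStep_one ⟨fun _ ↦ rfl, ⟨?_, fun j ↦ one_dvd _⟩, by simp, ?_⟩
        · simp only [h4, if_true, and_self]
          rw [form_dWt_sub hn h1 h2 h3 (by omega) (by omega) (by omega) (by omega) (by omega)]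
          simp
        · simp only [h4, if_true, and_self]
          rw [form_dWt_self hn h1 h2 h3, form_dWt_self hn (by omega) (by omega) (by omega)]
          simp
      · simp only [h4, if_false]
        refine isStep_one ⟨fun _ ↦ rfl, ⟨?_, fun j ↦ one_dvd _⟩, ?_, ?_⟩
        · rw [form_dWt_sub hn h1 h2 h3 (by omega) (by omega) (by omega) (by omega) (by omega)]
          simp only [if_true]
          omega
        · split_ifs <;> omega
        · rw [form_dWt_self hn h1 h2 h3, form_dWt_self hn (by omega) (by omega) (by omega)]
          omega
  pred_max p q hp hqp h := by
    rw [Ne, dWt_eq_zero_iff hn p.1.2.2.1] at hp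
    have hle := le_of_dWt_le hn q.1.2.1 q.1.2.2.1 p.1.2.1 p.1.2.2.1 hqp
    obtain ⟨⟨⟨b, s⟩, h1, h2, h3⟩, ε⟩ := p
    obtain ⟨⟨⟨b', s'⟩, h1', h2', h3'⟩, ε'⟩ := q
    simp only at h1 h2 h3 h1' h2' h3' hp hle h ⊢
    rw [form_dWt_self hn h1 h2 h3, form_dWt_self hn h1' h2' h3'] at h
    simp only [OfNat.one_ne_ofNat, false_and, or_false, exists_false] at h
    simp only [dPred]
    by_cases h4 : b = 1 ∧ s ≤ 2
    · simp only [h4, and_self, if_true]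
      refine dWt_le hn h3' (.inr (by omega)) ?_
      split_ifs at h <;> omega
    · simp only [h4, if_false]
      refine dWt_le hn h3' ?_ ?_
      · right
        split_ifs at h <;> omega
      · split_ifs at h <;> omega
  labels p := dLabels p.1.1.1 p.1.1.2
  labels_zero p hp := by
    rw [dWt_eq_zero_iff hn p.1.2.2.1] at hp
    have := p.1.2.2.1
    rw [hp, show p.1.1.1 = 0 by omega]
    rfl
  labels_pred p hp := by
    rw [Ne, dWt_eq_zero_iff hn p.1.2.2.1] at hp
    obtain ⟨⟨⟨b, s⟩, h1, h2, h3⟩, ε⟩ := p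
    simp only [Prod.mk.injEq, dPred] at h1 h2 h3 hp ⊢
    obtain rfl | ⟨rfl, rfl⟩ | ⟨rfl, rfl⟩ | ⟨rfl, hs⟩ :
        b = 0 ∨ (b = 1 ∧ s = 1) ∨ (b = 1 ∧ s = 2) ∨ (b = 1 ∧ 3 ≤ s) := by omega
    · obtain ⟨t, rfl⟩ : ∃ t, s = t + 1 := ⟨s - 1, by omega⟩
      simp [dLabels, List.replicate_succ']
    · rfl
    · rfl
    · obtain ⟨t, rfl⟩ : ∃ t, s = t + 3 := ⟨s - 3, by omega⟩
      simp [dLabels, List.replicate_succ']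
  sym p := dName n p.1.1
  sym_spec p := by
    obtain ⟨⟨⟨b, s⟩, h1, h2, h3⟩, ε⟩ := p
    simp only [dName] at h1 h2 h3 ⊢
    obtain ⟨rfl, h⟩ | ⟨rfl, rfl, h⟩ | ⟨rfl, rfl, h⟩ | ⟨rfl, rfl⟩ | ⟨rfl, hs⟩ :
        (b = 0 ∧ s ≠ 2) ∨ (b = 0 ∧ s = 2 ∧ n ≠ 4) ∨ (b = 0 ∧ s = 2 ∧ n = 4) ∨
          (b = 1 ∧ s = 1) ∨ (b = 1 ∧ 2 ≤ s) := by omega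
    · refine .inl ⟨by simp [onesD, h, dLabels, ones], .inl fun h4 ↦ h ?_⟩
      simpa [dLabels] using congrArg List.length h4
    -- The witness is e₄-e₅, available as n ≥ 5: it is orthogonal to e₁+e₂ and has scalar product 1
    -- with e₃+e₄.
    · obtain ⟨i, hi⟩ : ∃ i : Fin n, (i : ℕ) = 3 := ⟨⟨3, by omega⟩, rfl⟩
      have e2 : nth (Pi.single i (1 : ℤ)) 2 = 0 := by
        rw [nth_succ' _ (show 1 < n by omega)]
        simp [Fin.ext_iff, hi]
      have e4 : nth (Pi.single i (1 : ℤ)) 4 = 1 := by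
        rw [nth_succ' _ (show 3 < n by omega)]
        simp [Pi.single_apply, Fin.ext_iff, hi]
      have e5 : 5 = n → nth (Pi.single i (1 : ℤ)) 5 = 0 := by
        intro h5
        rw [nth_succ' _ (show 4 < n by omega)]
        simp [Fin.ext_iff, hi]
      have d2 : dSum ε (Pi.single i 1) (2 * 1) = 0 := by
        rw [dSum, if_neg (show ¬ 2 * 1 = n by omega), if_neg (show ¬ 2 * 1 + 1 = n by omega), e2]
      have d4 : dSum ε (Pi.single i 1) (2 * 2) = 1 := by
        rw [dSum, if_neg (show ¬ 2 * 2 = n by omega)]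
        split_ifs with h5
        · rw [show n - 1 = 4 by omega, e4, congrArg (nth _) h5.symm, e5 h5, add_zero]
        · exact e4
      have key : ∀ s, 2 * s ≤ n → form (CartanMatrix.D n) (fun _ ↦ 1)
          (Pi.single i 1) (dWt 0 ε s) = dSum ε (Pi.single i 1) (2 * s) := by
        intro s hs
        rw [form_comm_of_symm cartanMatrix_D_symm, form_dWt hn (by simp) (by simp) (by omega)]
        simp
      refine .inl ⟨by simp [onesD, h, dLabels, ones], .inr ⟨Pi.single i 1, ?_, ?_, ?_⟩⟩
      · exact ⟨by rw [form_single_right, pair_single]; simp [CartanMatrix.D], fun _ ↦ one_dvd _⟩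
      · change form _ _ _ (dWt 0 ε 1) = 0
        rw [key 1 (by omega), d2]
      · rw [form_sub_right]
        change form _ _ _ (dWt 0 ε 2) - form _ _ _ (dWt 0 ε 1) = 1
        rw [key 2 (by omega), key 1 (by omega), d2, d4, sub_zero]
    · subst h
      -- For n = 4 the weight is e₁+e₂+e₃±e₄, and its scalar products with the root lattice are
      -- even, as are those of 2e₁ for every n.
      refine .inr ⟨by simp [onesD], rfl, fun c hc ↦ ?_⟩
      rw [form_sub_right, hc, sub_zero, form_comm_of_symm cartanMatrix_D_symm,
        form_dWt hn h1 h2 h3]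
      simp only [dSum, Nat.cast_zero, zero_mul, add_zero]
      split_ifs <;> simp
    · refine .inr ⟨by simp, rfl, fun c hc ↦ ?_⟩
      rw [form_sub_right, hc, sub_zero, form_comm_of_symm cartanMatrix_D_symm,
        form_dWt hn h1 h2 h3]
      rw [dSum, if_neg (by omega), if_neg (by omega)]
      exact ⟨nth c 1, by simp; ring⟩
    · obtain ⟨t, rfl⟩ : ∃ t, s = t + 2 := ⟨s - 2, by omega⟩
      exact .inl ⟨by simp [dLabels, twoOnes], .inl (by simp [dLabels])⟩

/-- For n = 4 this fails, as (0, 2) and (1, 1) both give `oneOne`. -/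
lemma dName_injective (hn : n ≠ 4) {p q : ℕ × ℕ} (hp : p.1 ≤ 1 ∧ p.1 ≤ p.2)
    (hq : q.1 ≤ 1 ∧ q.1 ≤ q.2) (h : dName n p = dName n q) : p = q := by
  obtain ⟨b, s⟩ := p
  obtain ⟨b', s'⟩ := q
  simp only at hp hq
  have two_ne : ∀ k l : ℕ, BlockLabel.two :: List.replicate k .one ≠ List.replicate l .one := by
    intro k l h
    have : BlockLabel.two ∈ List.replicate l BlockLabel.one := by
      rw [← h]
      simp
    simp [List.mem_replicate] at this
  simp only [dName, onesD, hn, false_and, if_false, ones, twoOnes] at h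
  rcases (show b = 0 ∨ b = 1 by omega) with rfl | rfl <;>
    rcases (show b' = 0 ∨ b' = 1 by omega) with rfl | rfl
  · simpa using congrArg List.length (WeightSymbol.word.inj h)
  · simp only [if_true, one_ne_zero, if_false] at h
    split_ifs at h with h1
    exact absurd (WeightSymbol.word.inj h).symm (two_ne _ _)
  · simp only [if_true, one_ne_zero, if_false] at h
    split_ifs at h with h1
    exact absurd (WeightSymbol.word.inj h) (two_ne _ _)
  · simp only [one_ne_zero, if_false] at h
    split_ifs at h with h1 h2
    · rw [h1, h2]
    · have := congrArg List.length (WeightSymbol.word.inj h)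
      simp only [List.length_cons, List.length_replicate] at this
      rw [show s = s' by omega]

variable {ι V N : Type*} [Fintype ι] [AddCommGroup V] [Module ℝ V] [AddCommGroup N] [Module ℝ N]
variable {P : RootPairing ι ℝ V N} [P.IsRootSystem] [P.IsCrystallographic] [P.IsReduced]

lemma exists_cartanMatrix_D_ne_zero (hn : 4 ≤ n) (i : Fin n) (hi : i ≠ ⟨0, by omega⟩) :
    ∃ j : Fin n, (j : ℕ) < i ∧ CartanMatrix.D n i j * 1 ≠ 0 := by
  have h0 : (i : ℕ) ≠ 0 := fun h ↦ hi (Fin.ext h)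
  by_cases h : (i : ℕ) + 1 = n
  -- The last node is joined to the branch node and not to its predecessor.
  · refine ⟨⟨n - 3, by omega⟩, by simp only; omega, ?_⟩
    simp only [CartanMatrix.D, Matrix.of_apply, Fin.ext_iff]
    split_ifs <;> omega
  · refine ⟨⟨i - 1, by omega⟩, by simp only; omega, ?_⟩
    simp only [CartanMatrix.D, Matrix.of_apply, Fin.ext_iff]
    split_ifs <;> omega

theorem hasCovers_d_of_ne {n : ℕ} (hn : 4 ≤ n) (hn4 : n ≠ 4) (b : P.Base)
    (e : b.support ≃ Fin n)
    (hA : ∀ i j : b.support, b.cartanMatrix i j = CartanMatrix.D n (e i) (e j)) :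
    HasCovers b (.D n hn) := by
  refine hasCovers_of_smallData b e hA (fun i ↦ .inl rfl) cartanMatrix_D_symm ⟨0, by omega⟩
    (fun i ↦ i) (exists_cartanMatrix_D_ne_zero hn) (dData hn) (.D n hn) (S := SmallIndex n)
    Prod.fst (fun p ↦ dName n p.1) ?_ ?_ ?_ ?_ ?_
  · exact fun p q h ↦ Subtype.ext
      (dName_injective hn4 ⟨p.2.1, p.2.2.1⟩ ⟨q.2.1, q.2.2.1⟩ h)
  · exact fun p ↦ ⟨(p, 0), rfl⟩
  · exact fun p ↦ rfl
  · intro p q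
    constructor
    · exact fun h ↦ ⟨(p, 0), (q, 0), rfl, rfl, dWt_le hn p.2.2.2 (.inl rfl) h⟩
    · rintro ⟨⟨p, ε⟩, ⟨q, ε'⟩, rfl, rfl, h⟩
      exact le_of_dWt_le hn p.2.1 p.2.2.1 q.2.1 q.2.2.1 h
  · intro x y
    have hcov := SmallIndex.covBy_iff (n := n) (by omega)
    have h0 : dName n (0, 0) = .word [] := by simp [dName, onesD, hn4, ones]
    have h1 : dName n (0, 1) = .word [.one] := by simp [dName, onesD, hn4, ones]
    have h2 : dName n (1, 1) = .oneOne := by simp [dName]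
    have h3 : dName n (1, 2) = .word [.two] := by simp [dName, twoOnes]
    have h4 : ∀ s, dName n (0, s) = onesD n s := fun s ↦ by simp [dName]
    have h5 : ∀ s, dName n (1, s + 2) = twoOnes s := fun s ↦ by simp [dName]
    constructor
    · intro h
      cases h with
      | D_a _ _ k hk h =>
        obtain ⟨k, rfl⟩ : ∃ l, k = l + 1 := ⟨k - 1, by omega⟩
        exact ⟨⟨(1, k + 2), by simp only; omega⟩, ⟨(1, k + 1 + 2), by simp only; omega⟩,
          h5 _, h5 _, (hcov _ _).mpr (by simp)⟩
      | D_b _ _ k h =>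
        exact ⟨⟨(0, k + 2), by simp only; omega⟩, ⟨(1, k + 2), by simp only; omega⟩,
          h5 _, h4 _, (hcov _ _).mpr (by simp)⟩
      | D_c _ _ k h =>
        exact ⟨⟨(0, k + 1), by simp only; omega⟩, ⟨(0, k + 2), by simp only; omega⟩,
          h4 _, h4 _, (hcov _ _).mpr (by simp)⟩
      | D_d =>
        exact ⟨⟨(1, 1), by simp only; omega⟩, ⟨(1, 2), by simp only; omega⟩, h3, h2,
          (hcov _ _).mpr (by simp)⟩
      | D_e =>
        exact ⟨⟨(0, 1), by simp only; omega⟩, ⟨(1, 1), by simp only; omega⟩, h2, h1,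
          (hcov _ _).mpr (by simp)⟩
      | D_f =>
        exact ⟨⟨(0, 0), by simp only; omega⟩, ⟨(0, 1), by simp only; omega⟩, h1, h0,
          (hcov _ _).mpr (by simp)⟩
    · rintro ⟨⟨⟨b, s⟩, hx⟩, ⟨⟨b', s'⟩, hy⟩, rfl, rfl, h⟩
      rw [hcov] at h
      simp only at hx hy h ⊢
      rcases h with ⟨rfl, rfl⟩ | ⟨hlt, rfl⟩
      · obtain rfl | rfl : b = 0 ∨ b = 1 := by omega
        · rcases Nat.eq_zero_or_pos s with rfl | hs
          · rw [h0, h1]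
            exact .D_f n hn
          · obtain ⟨k, rfl⟩ : ∃ l, s = l + 1 := ⟨s - 1, by omega⟩
            rw [h4, h4]
            exact .D_c n hn k (by omega)
        · obtain rfl | hs : s = 1 ∨ 2 ≤ s := by omega
          · rw [h2, h3]
            exact .D_d n hn
          · obtain ⟨k, rfl⟩ : ∃ l, s = l + 2 := ⟨s - 2, by omega⟩
            rw [show k + 2 + 1 = k + 1 + 2 by ring, h5, h5]
            exact .D_a n hn (k + 1) (by omega) (by omega)
      · obtain ⟨rfl, rfl⟩ : b = 0 ∧ b' = 1 := by omega
        obtain rfl | hs : s = 1 ∨ 2 ≤ s := by omega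
        · rw [h1, h2]
          exact .D_e n hn
        · obtain ⟨k, rfl⟩ : ∃ l, s = l + 2 := ⟨s - 2, by omega⟩
          rw [h4, h5]
          exact .D_b n hn k (by omega)

-- Triality permutes the orbits of 2e₁ and e₁+e₂+e₃±e₄, which share the symbol [1,1]. Accordingly b
-- + s, which agrees on (0, 2) and (1, 1), labels the classes, and they form a chain of four.
open BlockLabel WeightSymbol in
theorem hasCovers_d_four (b : P.Base) (e : b.support ≃ Fin 4)
    (hA : ∀ i j : b.support, b.cartanMatrix i j = CartanMatrix.D 4 (e i) (e j)) :
    HasCovers b (.D 4 le_rfl) := by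
  have hval : ∀ p : SmallIndex 4, (p.1.1 = 0 ∧ p.1.2 ≤ 2) ∨ (p.1.1 = 1 ∧ 1 ≤ p.1.2 ∧ p.1.2 ≤ 2) :=
    fun p ↦ by
      have := p.2
      omega
  let name : Fin 4 → WeightSymbol := ![word [], word [one], oneOne, word [two]]
  let cls : SmallIndex 4 × Fin 2 → Fin 4 := fun p ↦ ⟨p.1.1.1 + p.1.1.2, by
    have := hval p.1
    omega⟩
  let rep : Fin 4 → SmallIndex 4 :=
    ![⟨(0, 0), by simp⟩, ⟨(0, 1), by simp⟩, ⟨(1, 1), by simp⟩, ⟨(1, 2), by simp⟩]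
  have hrep : ∀ s ε, cls (rep s, ε) = s := by
    intro s ε
    fin_cases s <;> rfl
  refine hasCovers_of_smallData b e hA (fun i ↦ .inl rfl) cartanMatrix_D_symm 0
    (fun i ↦ i) (exists_cartanMatrix_D_ne_zero le_rfl) (dData le_rfl) (.D 4 le_rfl) cls name
    ?_ ?_ ?_ ?_ ?_
  · intro s t h
    fin_cases s <;> fin_cases t <;> first | rfl | simp [name] at h
  · exact fun s ↦ ⟨(rep s, 0), hrep s 0⟩
  · rintro ⟨⟨⟨b, s⟩, hp⟩, ε⟩
    have := hval ⟨⟨b, s⟩, hp⟩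
    simp only at this
    obtain ⟨rfl, rfl⟩ | ⟨rfl, rfl⟩ | ⟨rfl, rfl⟩ | ⟨rfl, rfl⟩ | ⟨rfl, rfl⟩ :
        (b = 0 ∧ s = 0) ∨ (b = 0 ∧ s = 1) ∨ (b = 0 ∧ s = 2) ∨ (b = 1 ∧ s = 1) ∨
          (b = 1 ∧ s = 2) := by omega
    all_goals rfl
  · intro s t
    constructor
    · intro h
      refine ⟨(rep s, 0), (rep t, 0), hrep s 0, hrep t 0,
        dWt_le le_rfl (rep s).2.2.2 (.inl rfl) ?_⟩
      have : ∀ s t : Fin 4, s ≤ t → (rep s).1.1 ≤ (rep t).1.1 ∧ (rep s).1.2 ≤ (rep t).1.2 := by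
        intro s t
        fin_cases s <;> fin_cases t <;> simp [rep]
      exact this s t h
    · rintro ⟨⟨p, ε⟩, ⟨q, ε'⟩, rfl, rfl, h⟩
      have := le_of_dWt_le le_rfl p.2.1 p.2.2.1 q.2.1 q.2.2.1 h
      change p.1.1 + p.1.2 ≤ q.1.1 + q.1.2
      omega
  · intro x y
    have hcov : ∀ s t : Fin 4, s ⋖ t ↔ (t : ℕ) = s + 1 := by
      intro s t
      rw [Fin.covBy_iff, Nat.covBy_iff_add_one_eq, eq_comm]
    constructor
    · intro h
      cases h with
      | D_a _ _ k hk h => omega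
      | D_b _ _ k h =>
        obtain rfl : k = 0 := by omega
        exact ⟨2, 3, rfl, rfl, (hcov _ _).mpr rfl⟩
      | D_c _ _ k h =>
        obtain rfl : k = 0 := by omega
        exact ⟨1, 2, rfl, rfl, (hcov _ _).mpr rfl⟩
      | D_d => exact ⟨2, 3, rfl, rfl, (hcov _ _).mpr rfl⟩
      | D_e => exact ⟨1, 2, rfl, rfl, (hcov _ _).mpr rfl⟩
      | D_f => exact ⟨0, 1, rfl, rfl, (hcov _ _).mpr rfl⟩
    · rintro ⟨s, t, rfl, rfl, h⟩
      rw [hcov] at h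
      obtain ⟨rfl, rfl⟩ | ⟨rfl, rfl⟩ | ⟨rfl, rfl⟩ :
          (s = 0 ∧ t = 1) ∨ (s = 1 ∧ t = 2) ∨ (s = 2 ∧ t = 3) := by
        simp only [Fin.ext_iff]
        omega
      · exact .D_f 4 le_rfl
      · exact .D_e 4 le_rfl
      · exact .D_d 4 le_rfl

theorem hasCovers_d {n : ℕ} (hn : 4 ≤ n) (b : P.Base) (e : b.support ≃ Fin n)
    (hA : ∀ i j : b.support, b.cartanMatrix i j = CartanMatrix.D n (e i) (e j)) :
    HasCovers b (.D n hn) := by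
  by_cases h : n = 4
  · subst h
    exact hasCovers_d_four b e hA
  · exact hasCovers_d_of_ne hn h b e hA

end D

end SmallWeights

theorem mainTheorem5 {ι V N : Type*} [Fintype ι] [AddCommGroup V] [Module ℝ V]
    [AddCommGroup N] [Module ℝ N] (P : RootPairing ι ℝ V N) [P.IsRootSystem]
    [P.IsCrystallographic] [P.IsReduced] (b : P.Base) (X : SmallWeights.DynkinType)
    (e : b.support ≃ Fin X.rank)
    (hX : ∀ i j : b.support, b.cartanMatrix i j = X.cartanMatrix (e i) (e j)) :
    -- inclusion of convex hulls is a partial order on the orbits of small weights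
    (∃ _ : PartialOrder (SmallWeights.SmallOrbit P),
      ∀ O O' : SmallWeights.SmallOrbit P, O ≤ O' ↔ convexHull ℝ O.1 ⊆ convexHull ℝ O'.1) ∧
    -- each such orbit has exactly one symbol
    (∀ O ∈ SmallWeights.smallOrbits P, ∃! s, SmallWeights.HasSymbol b O s) ∧
    -- the induced relation on symbols is a partial order, and its covers are those of the list
    ∃ _ : PartialOrder (SmallWeights.SmallSymbol b),
      (∀ s t : SmallWeights.SmallSymbol b, s ≤ t ↔
        ∃ O ∈ SmallWeights.smallOrbits P, ∃ O' ∈ SmallWeights.smallOrbits P,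
          SmallWeights.HasSymbol b O s.1 ∧ SmallWeights.HasSymbol b O' t.1 ∧
            convexHull ℝ O ⊆ convexHull ℝ O') ∧
      ∀ s t : SmallWeights.WeightSymbol,
        (∃ s' t' : SmallWeights.SmallSymbol b, s'.1 = s ∧ t'.1 = t ∧ s' ⋖ t') ↔
          SmallWeights.Covers X t s := by
  cases X with
  | B n hn => exact SmallWeights.hasCovers_b hn b e hX
  | C n hn => exact SmallWeights.hasCovers_c hn b e hX
  | D n hn => exact SmallWeights.hasCovers_d hn b e hX
  | E6 => exact SmallWeights.hasCovers_e6 b e hX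
  | E7 => exact SmallWeights.hasCovers_e7 b e hX
  | E8 => exact SmallWeights.hasCovers_e8 b e hX
  | F4 => exact SmallWeights.hasCovers_f4 b e hX
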